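/- **Setting.** Let $K$ be an algebraically closed field and $T\ge 0$ an integer. Let $\Gamma$ be the quiver with vertices $0,1,2,3$ (indices modulo $4$) and, for each vertex $i$, two arrows $a_i,b_i$ from $i$ to $i+1$. Paths are written from left to right. Let $e_i\in K\Gamma$ be the trivial path at $i$, and put $x=\sum_{i=0}^{3}a_i$, $y=\sum_{i=0}^{3}b_i$ in the path algebra $K\Gamma$, and $$A_T=K\Gamma/\langle xy,\; x^{4T+2}+y^{4T+2},\; yx\rangle .$$ Put $N=4T+1$. For a vertex $i$ set $(u,v)=(x,y)$ if $i\in\{0,2\}$ and $(u,v)=(y,x)$ if $i\in\{1,3\}$. **The sets $\mathcal G^n$.** Put $g^0_{i,0}=e_i$, and define $g^n_{i,j}\in K\Gamma$ for $n\ge1$, $0\le i\le 3$, $0\le j\le n$ inductively as follows. If $n=2m+1$: $$g^{n}_{i,j}=\begin{cases} g^{2m}_{i,0}u & j=0\\ g^{2m}_{i,j-1}v^{N}+g^{2m}_{i,j}u & 1\le j\le m\\ g^{2m}_{i,j-1}v+g^{2m}_{i,j}u^{N} & m+1\le j\le 2m\\ g^{2m}_{i,2m}v & j=2m+1.\end{cases}$$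 If $n=2m\geq 2$: $$g^{n}_{i,j}=\begin{cases} g^{2m-1}_{i,0}v & j=0\\ g^{2m-1}_{i,j-1}u^{N}+g^{2m-1}_{i,j}v & 1\le j\le m-1\\ g^{2m-1}_{i,m-1}u^{N}+g^{2m-1}_{i,m}v^{N} & j=m\\ g^{2m-1}_{i,j-1}u+g^{2m-1}_{i,j}v^{N} & m+1\le j\le 2m-1\\ g^{2m-1}_{i,2m-1}u & j=2m.\end{cases}$$ Let $\mathcal G^n=\{g^n_{i,j}\mid 0\le i\le3,\ 0\le j\le n\}$. Every $g=g^n_{i,j}$ has origin $\mathfrak o(g)=e_i$ and terminus $\mathfrak t(g)=e_{i+n}$. **The complex $(Q^\bullet,\partial)$.** With $\otimes=\otimes_K$, let $$Q^n=\bigoplus_{g\in\mathcal G^n}A_T\,\mathfrak o(g)\otimes\mathfrak t(g)A_T=\bigoplus_{i=0}^{3}\bigoplus_{j=0}^{n}A_T\,\mathfrak a^n_{i,j}A_T,\qquad \mathfrak a^n_{i,j}=\mathfrak o(g^n_{i,j})\otimes\mathfrak t(g^n_{i,j}).$$ Let $\partial^0:Q^0\to A_T$ be the multiplication map. For $n\ge1$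 let $\partial^n:Q^n\to Q^{n-1}$ be the homomorphism of $A_T$-$A_T$-bimodules determined by the following formulas, in which $\mathfrak a_{k,l}$ stands for $\mathfrak a^{n-1}_{k,l}$ and the first subscript is taken modulo $4$. If $n=2m+1$: $$\partial^{n}(\mathfrak a^{n}_{i,j})=\begin{cases}\mathfrak a_{i,0}u-u\,\mathfrak a_{i+1,0} & j=0\\ \mathfrak a_{i,j-1}v^{N}+\mathfrak a_{i,j}u-u\,\mathfrak a_{i+1,j}-v^{N}\mathfrak a_{i+1,j-1} & 1\le j\le m\\ \mathfrak a_{i,j-1}v+\mathfrak a_{i,j}u^{N}-u^{N}\mathfrak a_{i+1,j}-v\,\mathfrak a_{i+1,j-1} & m+1\le j\le 2m\\ \mathfrak a_{i,2m}v-v\,\mathfrak a_{i+1,2m} & j=2m+1.\end{cases}$$ If $n=2m\ge 2$ and $j\neq m$: $$\partial^{n}(\mathfrak a^{n}_{i,j})=\begin{cases}\mathfrak a_{i,0}v+u\,\mathfrak a_{i+1,0} & j=0\\ \mathfrak a_{i,j-1}u^{N}+\mathfrak a_{i,j}v+u\,\mathfrak a_{i+1,j}+v^{N}\mathfrak a_{i+1,j-1}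 & 1\le j\le m-1\\ \mathfrak a_{i,j-1}u+\mathfrak a_{i,j}v^{N}+u^{N}\mathfrak a_{i+1,j}+v\,\mathfrak a_{i+1,j-1} & m+1\le j\le 2m-1\\ \mathfrak a_{i,2m-1}u+v\,\mathfrak a_{i+1,2m-1} & j=2m,\end{cases}$$ and for $n=2m\geq 2$ and $j=m$: $$\begin{aligned}\partial^{n}(\mathfrak a^{n}_{i,m})={}&\sum_{s=0}^{T}u^{4s}\big(\mathfrak a_{i,m-1}u+u\,\mathfrak a_{i+1,m}\big)u^{4T-4s}+\sum_{s=0}^{T-1}u^{4s+2}\big(\mathfrak a_{i+2,m-1}u+u\,\mathfrak a_{i+3,m}\big)u^{4T-4s-2}\\&+\sum_{s=0}^{T}v^{4s}\big(\mathfrak a_{i,m}v+v\,\mathfrak a_{i+1,m-1}\big)v^{4T-4s}+\sum_{s=0}^{T-1}v^{4s+2}\big(\mathfrak a_{i+2,m}v+v\,\mathfrak a_{i+3,m-1}\big)v^{4T-4s-2}.\end{aligned}$$ **Theorem 2.1.** For every $T\ge0$, the sequence $$\cdots\longrightarrow Q^2\xrightarrow{\ \partial^2\ }Q^1\xrightarrow{\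 \partial^1\ }Q^0\xrightarrow{\ \partial^0\ }A_T\longrightarrow0$$ is a minimal projective bimodule resolution of $A_T$. That is, it is exact, every $Q^n$ is a projective $A_T$-$A_T$-bimodule, and $\partial^0:Q^0\to A_T$ and $\partial^n:Q^n\to\operatorname{Im}\partial^n$ ($n\ge1$) are projective covers (their kernels are superfluous sub-bimodules). -/

import Mathlib

noncomputable section

namespace CircBiserial

open TensorProduct

universe u v

/-! ### The path algebra of a quiver -/

section PathAlgebra

variable (K : Type u) [CommRing K] (V : Type v) [Quiver.{0} V]

/-- The set of all paths of a quiver (a source, a target, and a path from one to the other). -/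
abbrev AnyPath : Type v := Σ i : V, Σ j : V, Quiver.Path i j

/-- The path algebra `K V`: the free `K`-module on the set of all paths of the quiver `V`. -/
def PathAlgebra : Type (max u v) := AnyPath V →₀ K

instance : AddCommGroup (PathAlgebra K V) := inferInstanceAs (AddCommGroup (AnyPath V →₀ K))

instance : Module K (PathAlgebra K V) := inferInstanceAs (Module K (AnyPath V →₀ K))

variable {V}

/-- The basis element of the path algebra given by a path. -/
def pathElem {i j : V} (p : Quiver.Path i j) : PathAlgebra K V :=
  Finsupp.single (⟨i, j, p⟩ : AnyPath V) (1 : K)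

variable {K} in
theorem pathAlgebra_hom_ext {M : Type*} [AddCommGroup M] [Module K M]
    {f g : PathAlgebra K V →ₗ[K] M}
    (h : ∀ (i j : V) (p : Quiver.Path i j), f (pathElem K p) = g (pathElem K p)) : f = g :=
  Finsupp.lhom_ext' fun ⟨i, j, p⟩ => LinearMap.ext_ring (h i j p)

variable [DecidableEq V]

/-- The product of two paths, written from left to right: `p` followed by `q` if `p` ends where
`q` starts, and `0` otherwise. -/
def pathMul (p q : AnyPath V) : PathAlgebra K V :=
  if h : q.1 = p.2.1 then pathElem K (p.2.2.comp (q.2.2.cast h rfl)) else 0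

/-- The bilinear extension of the product of paths. -/
def pathAlgebraMul : PathAlgebra K V →ₗ[K] PathAlgebra K V →ₗ[K] PathAlgebra K V :=
  Finsupp.linearCombination K (fun p : AnyPath V =>
    (Finsupp.linearCombination K (pathMul K p) : (AnyPath V →₀ K) →ₗ[K] PathAlgebra K V))

theorem pathAlgebraMul_pathElem {i j k l : V} (p : Quiver.Path i j) (q : Quiver.Path k l) :
    pathAlgebraMul K (pathElem K p) (pathElem K q) = pathMul K ⟨i, j, p⟩ ⟨k, l, q⟩ := by
  unfold pathAlgebraMul pathElem
  erw [Finsupp.linearCombination_single, one_smul, Finsupp.linearCombination_single, one_smul]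

theorem pathMul_comp {i j l : V} (p : Quiver.Path i j) (q : Quiver.Path j l) :
    pathMul K ⟨i, j, p⟩ ⟨j, l, q⟩ = pathElem K (p.comp q) := by
  simp [pathMul]

theorem pathMul_ne {i j k l : V} (p : Quiver.Path i j) (q : Quiver.Path k l) (h : k ≠ j) :
    pathMul K ⟨i, j, p⟩ ⟨k, l, q⟩ = 0 := by
  simp [pathMul, h]


instance : Mul (PathAlgebra K V) := ⟨fun a b => pathAlgebraMul K a b⟩

theorem pathElem_mul_pathElem {i j k l : V} (p : Quiver.Path i j) (q : Quiver.Path k l) :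
    pathElem K p * pathElem K q = pathMul K ⟨i, j, p⟩ ⟨k, l, q⟩ :=
  pathAlgebraMul_pathElem K p q

theorem pathAlgebra_zero_mul (a : PathAlgebra K V) : 0 * a = 0 :=
  LinearMap.congr_fun (map_zero (pathAlgebraMul K)) a

theorem pathAlgebra_mul_zero (a : PathAlgebra K V) : a * 0 = 0 :=
  map_zero (pathAlgebraMul K a)

theorem pathAlgebra_mul_assoc (a b c : PathAlgebra K V) : a * b * c = a * (b * c) := by
  let m := pathAlgebraMul (V := V) K
  have h : (m.flip c) ∘ₗ (m.flip b) = m.flip (m b c) := by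
    refine pathAlgebra_hom_ext fun i j p => ?_
    have h' : (m.flip c) ∘ₗ (m (pathElem K p)) = (m (pathElem K p)) ∘ₗ (m.flip c) := by
      refine pathAlgebra_hom_ext fun k l q => ?_
      have h'' : m (m (pathElem K p) (pathElem K q)) =
          (m (pathElem K p)) ∘ₗ (m (pathElem K q)) := by
        refine pathAlgebra_hom_ext fun r s t => ?_
        change pathElem K p * pathElem K q * pathElem K t =
          pathElem K p * (pathElem K q * pathElem K t)
        rw [pathElem_mul_pathElem, pathElem_mul_pathElem]
        by_cases h1 : k = j
        · subst h1
          rw [pathMul_comp, pathElem_mul_pathElem]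
          by_cases h2 : r = l
          · subst h2
            rw [pathMul_comp, pathMul_comp, pathElem_mul_pathElem, pathMul_comp,
              Quiver.Path.comp_assoc]
          · rw [pathMul_ne K _ _ h2, pathMul_ne K _ _ h2, pathAlgebra_mul_zero]
        · rw [pathMul_ne K _ _ h1, pathAlgebra_zero_mul]
          by_cases h2 : r = l
          · subst h2
            rw [pathMul_comp, pathElem_mul_pathElem, pathMul_ne K _ _ h1]
          · rw [pathMul_ne K _ _ h2, pathAlgebra_mul_zero]
      exact LinearMap.congr_fun h'' c
    exact LinearMap.congr_fun h' b
  exact LinearMap.congr_fun h a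

variable [Fintype V]

/-- The unit of the path algebra is the sum of all trivial paths. -/
instance : One (PathAlgebra K V) := ⟨∑ i : V, pathElem K (Quiver.Path.nil : Quiver.Path i i)⟩

theorem pathAlgebra_one_mul (a : PathAlgebra K V) : 1 * a = a := by
  have h : pathAlgebraMul K (1 : PathAlgebra K V) = LinearMap.id := by
    refine pathAlgebra_hom_ext fun i j p => ?_
    change pathAlgebraMul K (∑ i : V, pathElem K (Quiver.Path.nil : Quiver.Path i i)) _ = _
    rw [map_sum, LinearMap.sum_apply, Finset.sum_eq_single i]
    · rw [pathAlgebraMul_pathElem, pathMul_comp, Quiver.Path.nil_comp]; rfl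
    · intro k _ hk
      rw [pathAlgebraMul_pathElem, pathMul_ne K _ _ hk.symm]
    · simp
  exact LinearMap.congr_fun h a

theorem pathAlgebra_mul_one (a : PathAlgebra K V) : a * 1 = a := by
  have h : (pathAlgebraMul K).flip (1 : PathAlgebra K V) = LinearMap.id := by
    refine pathAlgebra_hom_ext fun i j p => ?_
    change pathAlgebraMul K _ (∑ i : V, pathElem K (Quiver.Path.nil : Quiver.Path i i)) = _
    rw [map_sum, Finset.sum_eq_single j]
    · rw [pathAlgebraMul_pathElem, pathMul_comp, Quiver.Path.comp_nil]; rfl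
    · intro k _ hk
      rw [pathAlgebraMul_pathElem, pathMul_ne K _ _ hk]
    · simp
  exact LinearMap.congr_fun h a

instance : Ring (PathAlgebra K V) where
  left_distrib a b c := map_add (pathAlgebraMul K a) b c
  right_distrib a b c := LinearMap.congr_fun (map_add (pathAlgebraMul K) a b) c
  zero_mul := pathAlgebra_zero_mul K
  mul_zero := pathAlgebra_mul_zero K
  mul_assoc := pathAlgebra_mul_assoc K
  one_mul := pathAlgebra_one_mul K
  mul_one := pathAlgebra_mul_one K
  neg_add_cancel := neg_add_cancel
  zsmul := (· • ·)
  zsmul_zero' := SubNegMonoid.zsmul_zero'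
  zsmul_succ' := SubNegMonoid.zsmul_succ'
  zsmul_neg' := SubNegMonoid.zsmul_neg'
  nsmul := (· • ·)
  nsmul_zero := AddMonoid.nsmul_zero
  nsmul_succ := AddMonoid.nsmul_succ
  sub_eq_add_neg := sub_eq_add_neg

instance : Algebra K (PathAlgebra K V) :=
  Algebra.ofModule
    (fun r a b => LinearMap.congr_fun (map_smul (pathAlgebraMul K) r a) b)
    (fun r a b => map_smul (pathAlgebraMul K a) r b)

end PathAlgebra

/-! ### The quiver `Γ` and the algebra `A_T` -/

/-- The arrows of the quiver `Γ` with vertex set `ℤ/4`: for every vertex `i` there are exactly two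
arrows `a i` and `b i`, both from `i` to `i + 1`. -/
inductive Arrow : ZMod 4 → ZMod 4 → Type
  | a (i : ZMod 4) : Arrow i (i + 1)
  | b (i : ZMod 4) : Arrow i (i + 1)

/-- The circular quiver `Γ`. -/
instance circularQuiver : Quiver.{0} (ZMod 4) := ⟨Arrow⟩

section Algebra

variable (K : Type u) [Field K] (T : ℕ)

/-- The path algebra `K Γ`. -/
abbrev KΓ : Type u := PathAlgebra K (ZMod 4)

/-- The trivial path at the vertex `i`, in `K Γ`. -/
def pe (i : ZMod 4) : KΓ K := pathElem K (Quiver.Path.nil : Quiver.Path i i)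

/-- `x = a₀ + a₁ + a₂ + a₃` in `K Γ`. -/
def px : KΓ K := ∑ i : ZMod 4, pathElem K (Quiver.Hom.toPath (Arrow.a i : i ⟶ i + 1))

/-- `y = b₀ + b₁ + b₂ + b₃` in `K Γ`. -/
def py : KΓ K := ∑ i : ZMod 4, pathElem K (Quiver.Hom.toPath (Arrow.b i : i ⟶ i + 1))

/-- The two-sided ideal `I_T = ⟨xy, x^(4T+2) + y^(4T+2), yx⟩` of `K Γ`. -/
def idealI : TwoSidedIdeal (KΓ K) :=
  TwoSidedIdeal.span {px K * py K, px K ^ (4 * T + 2) + py K ^ (4 * T + 2), py K * px K}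

/-- The algebra `A_T = K Γ / I_T`. -/
def A : Type u := (idealI K T).ringCon.Quotient

instance : Ring (A K T) := inferInstanceAs (Ring (idealI K T).ringCon.Quotient)

instance : Algebra K (A K T) := inferInstanceAs (Algebra K (idealI K T).ringCon.Quotient)

/-- The quotient map `K Γ → A_T`. -/
def toA : KΓ K →+* A K T := (idealI K T).ringCon.mk'

/-- The image of the trivial path at `i` in `A_T`. -/
def e (i : ZMod 4) : A K T := toA K T (pe K i)

/-- The image of `x` in `A_T`. -/
def x : A K T := toA K T (px K)

/-- The image of `y` in `A_T`. -/
def y : A K T := toA K T (py K)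

theorem pe_mul_px (i : ZMod 4) : pe K i * px K = px K * pe K (i + 1) := by
  unfold pe px
  rw [Finset.mul_sum, Finset.sum_mul, Finset.sum_eq_single i, Finset.sum_eq_single i]
  · rw [pathElem_mul_pathElem, pathElem_mul_pathElem, pathMul_comp, pathMul_comp]
    rfl
  · intro k _ hk
    rw [pathElem_mul_pathElem, pathMul_ne]
    exact fun h => hk (add_right_cancel h).symm
  · simp
  · intro k _ hk
    rw [pathElem_mul_pathElem, pathMul_ne _ _ _ hk]
  · simp

theorem pe_mul_py (i : ZMod 4) : pe K i * py K = py K * pe K (i + 1) := by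
  unfold pe py
  rw [Finset.mul_sum, Finset.sum_mul, Finset.sum_eq_single i, Finset.sum_eq_single i]
  · rw [pathElem_mul_pathElem, pathElem_mul_pathElem, pathMul_comp, pathMul_comp]
    rfl
  · intro k _ hk
    rw [pathElem_mul_pathElem, pathMul_ne]
    exact fun h => hk (add_right_cancel h).symm
  · simp
  · intro k _ hk
    rw [pathElem_mul_pathElem, pathMul_ne _ _ _ hk]
  · simp

theorem pe_mul_self (i : ZMod 4) : pe K i * pe K i = pe K i := by
  unfold pe
  rw [pathElem_mul_pathElem, pathMul_comp]; rfl

theorem e_mul_self (i : ZMod 4) : e K T i * e K T i = e K T i := by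
  rw [e, ← map_mul, pe_mul_self]

theorem mul_pow_shift {R : Type*} [Ring R] (f : ZMod 4 → R) (w : R)
    (h : ∀ i, f i * w = w * f (i + 1)) (k : ℕ) (i : ZMod 4) :
    f i * w ^ k = w ^ k * f (i + k) := by
  induction k generalizing i with
  | zero => simp
  | succ k ih =>
    rw [pow_succ, ← mul_assoc, ih, mul_assoc, h, ← mul_assoc]
    push_cast
    rw [add_assoc]

theorem e_mul_x_pow (k : ℕ) (i : ZMod 4) : e K T i * x K T ^ k = x K T ^ k * e K T (i + k) :=
  mul_pow_shift _ _ (fun i => by simp only [e, x, ← map_mul, pe_mul_px]) k i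

theorem e_mul_y_pow (k : ℕ) (i : ZMod 4) : e K T i * y K T ^ k = y K T ^ k * e K T (i + k) :=
  mul_pow_shift _ _ (fun i => by simp only [e, y, ← map_mul, pe_mul_py]) k i

/-! ### The sets `G^n` -/

/-- For `i = 0, 2` the elements `g^n_{i,j}` are given by the formulas below with `(u, v) = (x, y)`,
and for `i = 1, 3` by the same formulas with `(u, v) = (y, x)`.  Here `G` is the previous stage
`j ↦ g^{n-1}_{i,j}`. -/
def gStep (u v : KΓ K) (n : ℕ) (G : ℕ → KΓ K) (j : ℕ) : KΓ K :=
  let m := n / 2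
  if n % 2 = 1 then
    -- here `n = 2 m + 1`
    if j = 0 then G 0 * u
    else if j ≤ m then G (j - 1) * v ^ (4 * T + 1) + G j * u
    else if j ≤ 2 * m then G (j - 1) * v + G j * u ^ (4 * T + 1)
    else G (2 * m) * v
  else
    -- here `n = 2 m`
    if j = 0 then G 0 * v
    else if j ≤ m - 1 then G (j - 1) * u ^ (4 * T + 1) + G j * v
    else if j = m then G (m - 1) * u ^ (4 * T + 1) + G m * v ^ (4 * T + 1)
    else if j ≤ 2 * m - 1 then G (j - 1) * u + G j * v ^ (4 * T + 1)
    else G (2 * m - 1) * u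

/-- The elements `g^n_{i,j}` of `K Γ` (meaningful for `0 ≤ j ≤ n`). -/
def g : ℕ → ZMod 4 → ℕ → KΓ K
  | 0, i, _ => pe K i
  | n + 1, i, j =>
    if i = 0 ∨ i = 2 then gStep K T (px K) (py K) (n + 1) (g n i) j
    else gStep K T (py K) (px K) (n + 1) (g n i) j

/-- The set `G^n = {g^n_{i,j} | 0 ≤ i ≤ 3, 0 ≤ j ≤ n}`. -/
def setG (n : ℕ) : Set (KΓ K) := {z | ∃ (i : ZMod 4) (j : ℕ), j ≤ n ∧ z = g K T n i j}

/-- The origin of `g^n_{i,j}` is the vertex `i`. -/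
theorem origin_g (n : ℕ) (i : ZMod 4) (j : ℕ) : pe K i * g K T n i j = g K T n i j := by
  induction n generalizing j with
  | zero => simp [g, pe_mul_self]
  | succ n ih =>
    simp only [g, gStep]
    split_ifs <;> simp only [mul_add, ← mul_assoc, ih]

/-- The terminus of `g^n_{i,j}` is the vertex `i + n`. -/
theorem terminus_g (n : ℕ) (i : ZMod 4) (j : ℕ) :
    g K T n i j * pe K (i + n) = g K T n i j := by
  induction n generalizing j with
  | zero => simp [g, pe_mul_self]
  | succ n ih =>
    have h4 : (4 : ZMod 4) = 0 := rfl
    have hx := pe_mul_px K (i + n)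
    have hy := pe_mul_py K (i + n)
    have hx' := mul_pow_shift _ _ (pe_mul_px K) (4 * T + 1) (i + n)
    have hy' := mul_pow_shift _ _ (pe_mul_py K) (4 * T + 1) (i + n)
    push_cast [h4] at hx' hy' ⊢
    rw [zero_mul, zero_add, add_assoc] at hx' hy'
    rw [add_assoc] at hx hy
    have ex (j : ℕ) : g K T n i j * px K * pe K (i + (n + 1)) = g K T n i j * px K := by
      rw [mul_assoc, ← hx, ← mul_assoc, ih]
    have ey (j : ℕ) : g K T n i j * py K * pe K (i + (n + 1)) = g K T n i j * py K := by
      rw [mul_assoc, ← hy, ← mul_assoc, ih]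
    have ex' (j : ℕ) : g K T n i j * px K ^ (4 * T + 1) * pe K (i + (n + 1)) =
        g K T n i j * px K ^ (4 * T + 1) := by
      rw [mul_assoc, ← hx', ← mul_assoc, ih]
    have ey' (j : ℕ) : g K T n i j * py K ^ (4 * T + 1) * pe K (i + (n + 1)) =
        g K T n i j * py K ^ (4 * T + 1) := by
      rw [mul_assoc, ← hy', ← mul_assoc, ih]
    simp only [g, gStep]
    split_ifs <;> simp only [add_mul, ex, ey, ex', ey']

/-! ### Bimodules and the complex `(Q^•, ∂)` -/

/-- The enveloping algebra of `A_T`. A left module over `A_T ⊗ A_Tᵐᵒᵖ` is the same as an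
`A_T`-`A_T`-bimodule on which `K` acts centrally; `a ⊗ op b` acts as `q ↦ a q b`. -/
abbrev Env : Type u := A K T ⊗[K] (A K T)ᵐᵒᵖ

/-- `A_T` as a bimodule over itself: `(a ⊗ op b) • c = a c b`. -/
instance : Module (Env K T) (A K T) := instModuleTensorProductMop K (A K T)

variable {K T} in
/-- `bi a q b` is the product `a q b` in a bimodule. -/
def bi {M : Type*} [AddCommGroup M] [Module (Env K T) M] (a : A K T) (q : M) (b : A K T) : M :=
  (a ⊗ₜ[K] MulOpposite.op b : Env K T) • q

theorem bi_self (a c b : A K T) : bi a c b = a * c * b :=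
  AlgHom.mulLeftRight_apply K (A K T) a (MulOpposite.op b) c

/-- The bimodule `A_T e_i ⊗_K e_t A_T`, realised as the sub-bimodule of the free bimodule
`A_T ⊗_K A_T` (with `a (c ⊗ d) b = ac ⊗ db`) which is generated by `e_i ⊗ e_t`. -/
abbrev Proj (i t : ZMod 4) : Submodule (Env K T) (Env K T) :=
  Submodule.span (Env K T) {(e K T i ⊗ₜ[K] MulOpposite.op (e K T t) : Env K T)}

/-- `Q^n = ⨁_{i=0}^{3} ⨁_{j=0}^{n} A_T o(g^n_{i,j}) ⊗ t(g^n_{i,j}) A_T`, where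
`o(g^n_{i,j}) = e_i` and `t(g^n_{i,j}) = e_{i+n}`. -/
abbrev Q (n : ℕ) : Type u := (p : ZMod 4 × Fin (n + 1)) → Proj K T p.1 (p.1 + n)

/-- The generator `𝔞^n_{i,j} = o(g^n_{i,j}) ⊗ t(g^n_{i,j})` of `Q^n`, for `0 ≤ j ≤ n`
(and the value `0`, never used, for other `j`). -/
def gen (n : ℕ) (i : ZMod 4) (j : ℕ) : Q K T n :=
  if h : j < n + 1 then
    Pi.single (i, ⟨j, h⟩) ⟨e K T i ⊗ₜ[K] MulOpposite.op (e K T (i + n)),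
      Submodule.subset_span rfl⟩
  else 0

variable {K T} in
/-- The bimodule homomorphism from `Q^n` which sends `𝔞^n_{i,j}` to `c i j`, where `c i j` is an
element of the bimodule `M` with `e_i (c i j) e_{i+n} = c i j`: on the summand generated by
`e_i ⊗ e_{i+n}` it sends `a ⊗ b` to `a (c i j) b`. -/
def homOfGen {M : Type*} [AddCommGroup M] [Module (Env K T) M] (n : ℕ) (c : ZMod 4 → ℕ → M) :
    Q K T n →ₗ[Env K T] M :=
  ∑ p : ZMod 4 × Fin (n + 1),
    (LinearMap.toSpanSingleton (Env K T) M (c p.1 p.2)) ∘ₗ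
      (Proj K T p.1 (p.1 + n)).subtype ∘ₗ LinearMap.proj p

variable {K T} in
theorem homOfGen_gen {M : Type*} [AddCommGroup M] [Module (Env K T) M] (n : ℕ)
    (c : ZMod 4 → ℕ → M) (i : ZMod 4) (j : ℕ) (hj : j ≤ n) :
    homOfGen n c (gen K T n i j) = bi (e K T i) (c i j) (e K T (i + n)) := by
  have h : j < n + 1 := Nat.lt_succ_of_le hj
  simp only [homOfGen, gen, dif_pos h, LinearMap.sum_apply]
  rw [Finset.sum_eq_single (i, ⟨j, h⟩)]
  · simp [bi]
  · intro p _ hp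
    simp only [LinearMap.comp_apply, LinearMap.proj_apply, Pi.single_eq_of_ne hp, map_zero]
  · simp

variable {K T} in
/-- A bimodule homomorphism from `Q^n` is determined by its values on the `𝔞^n_{i,j}`. -/
theorem hom_ext_gen {M : Type*} [AddCommGroup M] [Module (Env K T) M] (n : ℕ)
    (f f' : Q K T n →ₗ[Env K T] M)
    (h : ∀ i j, j ≤ n → f (gen K T n i j) = f' (gen K T n i j)) : f = f' := by
  refine LinearMap.pi_ext' fun p => LinearMap.ext fun ⟨z, hz⟩ => ?_
  obtain ⟨r, rfl⟩ := Submodule.mem_span_singleton.1 hz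
  obtain ⟨i, j, hj⟩ := p
  have key : (Pi.single (i, ⟨j, hj⟩) ⟨_, hz⟩ : Q K T n) = r • gen K T n i j := by
    rw [gen, dif_pos hj]
    exact Pi.single_smul (f := fun p : ZMod 4 × Fin (n + 1) => Proj K T p.1 (p.1 + n))
      (i, (⟨j, hj⟩ : Fin (n + 1))) r
      (⟨e K T i ⊗ₜ[K] MulOpposite.op (e K T (i + n)), Submodule.subset_span rfl⟩ :
        Proj K T i (i + n))
  change f (Pi.single (i, ⟨j, hj⟩) ⟨_, hz⟩) = f' (Pi.single (i, ⟨j, hj⟩) ⟨_, hz⟩)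
  rw [key, map_smul, map_smul, h i j (Nat.le_of_lt_succ hj)]

/-- The multiplication map `∂^0 : Q^0 → A_T`, given on each summand by `a ⊗ b ↦ a b`. -/
def dZero : Q K T 0 →ₗ[Env K T] A K T := homOfGen 0 fun _ _ => 1

variable {K T} in
/-- The formula for `∂^n(𝔞^n_{i,j}) ∈ Q^{n-1}` (`n ≥ 1`, `0 ≤ j ≤ n`), for `(u, v) = (x, y)` if
`i = 0, 2`, and for `(u, v) = (y, x)` if `i = 1, 3`. Here `α i j` is the generator `𝔞^{n-1}_{i,j}` of
the target, given as an element of a bimodule `M`. -/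
def dFormula {M : Type*} [AddCommGroup M] [Module (Env K T) M] (u v : A K T) (n : ℕ)
    (α : ZMod 4 → ℕ → M) (i : ZMod 4) (j : ℕ) : M :=
  let m := n / 2
  if n % 2 = 1 then
    -- here `n = 2 m + 1`
    if j = 0 then
      bi 1 (α i 0) u - bi u (α (i + 1) 0) 1
    else if j ≤ m then
      bi 1 (α i (j - 1)) (v ^ (4 * T + 1)) + bi 1 (α i j) u
        - bi u (α (i + 1) j) 1 - bi (v ^ (4 * T + 1)) (α (i + 1) (j - 1)) 1
    else if j ≤ 2 * m then
      bi 1 (α i (j - 1)) v + bi 1 (α i j) (u ^ (4 * T + 1))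
        - bi (u ^ (4 * T + 1)) (α (i + 1) j) 1 - bi v (α (i + 1) (j - 1)) 1
    else
      bi 1 (α i (2 * m)) v - bi v (α (i + 1) (2 * m)) 1
  else
    -- here `n = 2 m`
    if j = 0 then
      bi 1 (α i 0) v + bi u (α (i + 1) 0) 1
    else if j ≤ m - 1 then
      bi 1 (α i (j - 1)) (u ^ (4 * T + 1)) + bi 1 (α i j) v
        + bi u (α (i + 1) j) 1 + bi (v ^ (4 * T + 1)) (α (i + 1) (j - 1)) 1
    else if j = m then
      (∑ s ∈ Finset.range (T + 1),
        bi (u ^ (4 * s)) (bi 1 (α i (m - 1)) u + bi u (α (i + 1) m) 1)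
          (u ^ (4 * T - 4 * s)))
      + (∑ s ∈ Finset.range T,
        bi (u ^ (4 * s + 2)) (bi 1 (α (i + 2) (m - 1)) u + bi u (α (i + 3) m) 1)
          (u ^ (4 * T - 4 * s - 2)))
      + (∑ s ∈ Finset.range (T + 1),
        bi (v ^ (4 * s)) (bi 1 (α i m) v + bi v (α (i + 1) (m - 1)) 1)
          (v ^ (4 * T - 4 * s)))
      + (∑ s ∈ Finset.range T,
        bi (v ^ (4 * s + 2)) (bi 1 (α (i + 2) m) v + bi v (α (i + 3) (m - 1)) 1)
          (v ^ (4 * T - 4 * s - 2)))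
    else if j ≤ 2 * m - 1 then
      bi 1 (α i (j - 1)) u + bi 1 (α i j) (v ^ (4 * T + 1))
        + bi (u ^ (4 * T + 1)) (α (i + 1) j) 1 + bi v (α (i + 1) (j - 1)) 1
    else
      bi 1 (α i (2 * m - 1)) u + bi v (α (i + 1) (2 * m - 1)) 1

/-- The prescribed value of `∂^{n+1}` on `𝔞^{n+1}_{i,j}`. -/
def dVal (n : ℕ) (i : ZMod 4) (j : ℕ) : Q K T n :=
  if i = 0 ∨ i = 2 then dFormula (x K T) (y K T) (n + 1) (gen K T n) i j
  else dFormula (y K T) (x K T) (n + 1) (gen K T n) i j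

/-- The differential `∂^{n+1} : Q^{n+1} → Q^n`. -/
def d (n : ℕ) : Q K T (n + 1) →ₗ[Env K T] Q K T n := homOfGen (n + 1) (dVal K T n)

/-! The maps `∂^n` do take the prescribed values. -/

section Values

variable {K T}
variable {M : Type*} [AddCommGroup M] [Module (Env K T) M]

theorem bi_bi (a a' b b' : A K T) (q : M) : bi a' (bi a q b) b' = bi (a' * a) q (b * b') := by
  simp only [bi, smul_smul, Algebra.TensorProduct.tmul_mul_tmul, MulOpposite.op_mul]

/-- The condition `e_i q e_t = q`. -/
def Fixed (K : Type u) [Field K] (T : ℕ) {M : Type*} [AddCommGroup M] [Module (Env K T) M]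
    (i t : ZMod 4) (q : M) : Prop := bi (e K T i) q (e K T t) = q

theorem Fixed.add {i t : ZMod 4} {q q' : M} (h : Fixed K T i t q) (h' : Fixed K T i t q') :
    Fixed K T i t (q + q') := by
  unfold Fixed bi at *; rw [smul_add, h, h']

theorem Fixed.sub {i t : ZMod 4} {q q' : M} (h : Fixed K T i t q) (h' : Fixed K T i t q') :
    Fixed K T i t (q - q') := by
  unfold Fixed bi at *; rw [smul_sub, h, h']

theorem Fixed.sum {ι : Type*} {s : Finset ι} {i t : ZMod 4} {q : ι → M}
    (h : ∀ k ∈ s, Fixed K T i t (q k)) : Fixed K T i t (∑ k ∈ s, q k) := by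
  unfold Fixed bi at *; rw [Finset.smul_sum]; exact Finset.sum_congr rfl h

theorem Fixed.bi_mul {i t i' t' : ZMod 4} {q : M} {a b : A K T} (h : Fixed K T i' t' q)
    (ha : e K T i * a = a * e K T i') (hb : e K T t' * b = b * e K T t) :
    Fixed K T i t (bi a q b) := by
  unfold Fixed at *
  rw [bi_bi, ha, ← hb, ← bi_bi, h]

theorem fixed_gen (n : ℕ) (i : ZMod 4) (j : ℕ) : Fixed K T i (i + n) (gen K T n i j) := by
  unfold Fixed bi gen
  split_ifs with h
  · rw [← Pi.single_smul]
    congr 1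
    apply Subtype.ext
    simp only [SetLike.val_smul, smul_eq_mul, Algebra.TensorProduct.tmul_mul_tmul,
      ← MulOpposite.op_mul, e_mul_self]
  · rw [smul_zero]

theorem fixed_dFormula (u v : A K T) (hu : ∀ i, e K T i * u = u * e K T (i + 1))
    (hv : ∀ i, e K T i * v = v * e K T (i + 1)) (n : ℕ) (i : ZMod 4) (j : ℕ) :
    Fixed K T i (i + (n + 1 : ℕ)) (dFormula u v (n + 1) (gen K T n) i j) := by
  have h4 : (4 : ZMod 4) = 0 := rfl
  have P (w : A K T) (hw : ∀ i, e K T i * w = w * e K T (i + 1)) (k : ℕ) (i i' : ZMod 4)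
      (h : i' = i + k) : e K T i * w ^ k = w ^ k * e K T i' := h ▸ mul_pow_shift _ w hw k i
  have P1 (w : A K T) (hw : ∀ i, e K T i * w = w * e K T (i + 1)) (i i' : ZMod 4)
      (h : i' = i + 1) : e K T i * w = w * e K T i' := h ▸ hw i
  have P0 (i i' : ZMod 4) (h : i' = i) : e K T i * (1 : A K T) = 1 * e K T i' := by simp [h]
  -- the two kinds of terms, for the exponent `k` of the factor
  have R (w : A K T) (hw : ∀ i, e K T i * w = w * e K T (i + 1)) (i : ZMod 4) (j : ℕ) :
      Fixed K T i (i + (n + 1 : ℕ)) (bi 1 (gen K T n i j) w) :=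
    (fixed_gen n i j).bi_mul (P0 _ _ rfl) (P1 w hw _ _ (by push_cast; ring))
  have L (w : A K T) (hw : ∀ i, e K T i * w = w * e K T (i + 1)) (i : ZMod 4) (j : ℕ) :
      Fixed K T i (i + (n + 1 : ℕ)) (bi w (gen K T n (i + 1) j) 1) :=
    (fixed_gen n (i + 1) j).bi_mul (P1 w hw _ _ rfl) (P0 _ _ (by push_cast; ring))
  have L' (w : A K T) (hw : ∀ i, e K T i * w = w * e K T (i + 1)) (i : ZMod 4) (j : ℕ) :
      Fixed K T (i + 2) (i + 2 + (n + 1 : ℕ)) (bi w (gen K T n (i + 3) j) 1) := by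
    have := L w hw (i + 2) j
    rwa [show i + 2 + 1 = i + 3 by ring] at this
  have hw' (w : A K T) (hw : ∀ i, e K T i * w = w * e K T (i + 1)) (i : ZMod 4) :
      e K T i * w ^ (4 * T + 1) = w ^ (4 * T + 1) * e K T (i + 1) :=
    P w hw _ _ _ (by push_cast; rw [h4]; ring)
  have S0 (w : A K T) (hw : ∀ i, e K T i * w = w * e K T (i + 1)) (s : ℕ)
      (q : Q K T n) (hq : Fixed K T i (i + (n + 1 : ℕ)) q) :
      Fixed K T i (i + (n + 1 : ℕ)) (bi (w ^ (4 * s)) q (w ^ (4 * T - 4 * s))) :=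
    hq.bi_mul (P w hw _ _ _ (by push_cast; rw [h4]; ring))
      (P w hw _ _ _ (by rw [← Nat.mul_sub]; push_cast; rw [h4]; ring))
  have S2 (w : A K T) (hw : ∀ i, e K T i * w = w * e K T (i + 1)) (s : ℕ) (hs : s < T)
      (q : Q K T n) (hq : Fixed K T (i + 2) (i + 2 + (n + 1 : ℕ)) q) :
      Fixed K T i (i + (n + 1 : ℕ)) (bi (w ^ (4 * s + 2)) q (w ^ (4 * T - 4 * s - 2))) :=
    hq.bi_mul (P w hw _ _ _ (by push_cast; rw [h4]; ring))
      (P w hw _ _ _ (by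
        rw [show 4 * T - 4 * s - 2 = 4 * (T - s - 1) + 2 by omega]
        push_cast; rw [h4]; linear_combination (-1 : ZMod 4) * h4))
  unfold dFormula
  dsimp only
  split_ifs
  · exact (R u hu _ _).sub (L u hu _ _)
  · exact (((R _ (hw' v hv) _ _).add (R u hu _ _)).sub (L u hu _ _)).sub (L _ (hw' v hv) _ _)
  · exact (((R v hv _ _).add (R _ (hw' u hu) _ _)).sub (L _ (hw' u hu) _ _)).sub (L v hv _ _)
  · exact (R v hv _ _).sub (L v hv _ _)
  · exact (R v hv _ _).add (L u hu _ _)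
  · exact (((R _ (hw' u hu) _ _).add (R v hv _ _)).add (L u hu _ _)).add (L _ (hw' v hv) _ _)
  · refine ((Fixed.add (Fixed.sum fun s _ => ?_) (Fixed.sum fun s hs => ?_)).add
      (Fixed.sum fun s _ => ?_)).add (Fixed.sum fun s hs => ?_)
    · exact S0 u hu s _ ((R u hu _ _).add (L u hu _ _))
    · exact S2 u hu s (Finset.mem_range.1 hs) _ ((R u hu _ _).add (L' u hu _ _))
    · exact S0 v hv s _ ((R v hv _ _).add (L v hv _ _))
    · exact S2 v hv s (Finset.mem_range.1 hs) _ ((R v hv _ _).add (L' v hv _ _))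
  · exact (((R u hu _ _).add (R _ (hw' v hv) _ _)).add (L _ (hw' u hu) _ _)).add (L v hv _ _)
  · exact (R u hu _ _).add (L v hv _ _)

variable (K T)

/-- `∂^{n+1}` sends `𝔞^{n+1}_{i,j}` to the prescribed element. -/
theorem d_gen (n : ℕ) (i : ZMod 4) (j : ℕ) (hj : j ≤ n + 1) :
    d K T n (gen K T (n + 1) i j) = dVal K T n i j := by
  have hx (i : ZMod 4) : e K T i * x K T = x K T * e K T (i + 1) := by
    simpa using e_mul_x_pow K T 1 i
  have hy (i : ZMod 4) : e K T i * y K T = y K T * e K T (i + 1) := by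
    simpa using e_mul_y_pow K T 1 i
  rw [d, homOfGen_gen _ _ _ _ hj]
  unfold dVal
  split_ifs
  · exact fixed_dFormula _ _ hx hy n i j
  · exact fixed_dFormula _ _ hy hx n i j

/-- `∂^0` sends `e_i ⊗ e_i` to `e_i`, as the multiplication map does. -/
theorem dZero_gen (i : ZMod 4) : dZero K T (gen K T 0 i 0) = e K T i := by
  rw [dZero, homOfGen_gen _ _ _ _ le_rfl, bi_self, mul_one, Nat.cast_zero, add_zero, e_mul_self]

end Values

end Algebra

/-! ### Minimal projective resolutions -/

section Resolution

variable {R : Type*} [Ring R]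

/-- A submodule `N` of `M` is superfluous (small) if `N + L = M` implies `L = M`. -/
def IsSuperfluous {M : Type*} [AddCommGroup M] [Module R M] (N : Submodule R M) : Prop :=
  ∀ L : Submodule R M, N ⊔ L = ⊤ → L = ⊤

/-- The sequence `⋯ → P 2 → P 1 → P 0 → M → 0` with differentials `∂ n : P (n + 1) → P n` and
augmentation `ε : P 0 → M` is a minimal projective resolution of the `R`-module `M`: it is exact,
all `P n` are projective, and `P 0 → M` and all `P (n + 1) → im (∂ n)` are projective covers, that
is, their kernels are superfluous. -/
structure IsMinimalProjectiveResolution {M : Type*} [AddCommGroup M] [Module R M]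
    (P : ℕ → Type*) [∀ n, AddCommGroup (P n)] [∀ n, Module R (P n)]
    (del : ∀ n, P (n + 1) →ₗ[R] P n) (ε : P 0 →ₗ[R] M) : Prop where
  projective : ∀ n, Module.Projective R (P n)
  surjective : Function.Surjective ε
  exact_zero : Function.Exact (del 0) ε
  exact_succ : ∀ n, Function.Exact (del (n + 1)) (del n)
  minimal_zero : IsSuperfluous (LinearMap.ker ε)
  minimal_succ : ∀ n, IsSuperfluous (LinearMap.ker (del n))

end Resolution

end CircBiserial

end

/-!
Let `N = 4T + 1`, and let `u, v` be the two letters `x, y`, in the order which belongs to the vertex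
at hand.

**The maps form a complex.** The left and right multiplications by `x` and `y` generate a
commutative subring `LetterRing` of the enveloping algebra, because `xy = yx = 0` in `A_T`. If the
generators `𝔞^n_{i,j}` outside the range `0 ≤ j ≤ n` are taken to be zero, the differentials are
given by one formula below the middle `j = m`, one above it, and one at it (`oddDiff`, `evenDiff`).
So `∂ ∂ = 0` (`d_d`) is a family of identities between linear combinations over a commutative ring
with the relations `uv = 0`, `u^(4T+2) + v^(4T+2) = 0` on either side.

**Exactness.** Modulo the left radical `x Q + y Q`, only the terms of `∂` without a letter on the
left survive, and `Q^•` becomes a minimal complex of projective right modules resolving the simple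
modules. On the monomial basis `e_t x^l`, `e_t y^l` of `A_T`, division by a letter gives an explicit
contraction of that one-sided complex (`contraction_even`, `contraction_odd`). It lifts to additive
maps `h : Q^n → Q^(n+1)` compatible with left multiplication, and `ν = ∂h + h∂ - 1` then maps `Q^n`
to `x Q^n + y Q^n`. Since `ν` commutes with left multiplication, its powers go down the left radical
filtration, which is finite; as every cycle `z` is homologous to `-ν z`, all cycles are boundaries
(`exact_of_contraction`). That the divisions are well defined on `A_T` is seen from a representation
of `K Γ` by matrices over `K[X] × K[X]`, which detects the monomial basis
(`exists_linear_of_relationWeight`).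

**Minimality.** The summands of `Q^n` are generated by idempotents of the enveloping algebra, hence
projective. Every term of `∂` contains a letter, so the kernels, being images, are contained in the
radical `x Q + y Q + Q x + Q y`, and sub-bimodules of the radical are superfluous by Nakayama's
lemma for nilpotent radicals (`isSuperfluous_of_le_biRad`).
-/

noncomputable section

namespace CircBiserial

open TensorProduct

universe u v

/-! ### Arithmetic in `A_T` -/

section Arithmetic

variable (K : Type u) [Field K] (T : ℕ)

/-- The two letters `x` and `y`, indexed by a Boolean so that statements which are symmetric under
exchanging them can be stated once. -/
def letter (c : Bool) : A K T := if c then x K T else y K T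

theorem e_mul_letter_pow (c : Bool) (k : ℕ) (i : ZMod 4) :
    e K T i * letter K T c ^ k = letter K T c ^ k * e K T (i + k) := by
  cases c
  · exact e_mul_y_pow K T k i
  · exact e_mul_x_pow K T k i

theorem e_mul_letter (c : Bool) (i : ZMod 4) :
    e K T i * letter K T c = letter K T c * e K T (i + 1) := by
  simpa using e_mul_letter_pow K T c 1 i

theorem toA_eq_zero {a : KΓ K} (h : a ∈ idealI K T) : toA K T a = 0 := by
  have : (idealI K T).ringCon a 0 := (TwoSidedIdeal.mem_iff _ _).1 h
  exact (RingCon.eq _).2 this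

theorem letter_mul_letter_not (c : Bool) : letter K T c * letter K T (!c) = 0 := by
  cases c
  · change toA K T (py K) * toA K T (px K) = 0
    rw [← map_mul]
    exact toA_eq_zero K T (TwoSidedIdeal.subset_span (by simp))
  · change toA K T (px K) * toA K T (py K) = 0
    rw [← map_mul]
    exact toA_eq_zero K T (TwoSidedIdeal.subset_span (by simp))

theorem x_pow_add_y_pow : x K T ^ (4 * T + 2) + y K T ^ (4 * T + 2) = 0 := by
  change toA K T (px K) ^ _ + toA K T (py K) ^ _ = 0
  rw [← map_pow, ← map_pow, ← map_add]
  exact toA_eq_zero K T (TwoSidedIdeal.subset_span (by simp))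

theorem letter_pow_add_letter_pow (c : Bool) :
    letter K T c ^ (4 * T + 2) + letter K T (!c) ^ (4 * T + 2) = 0 := by
  cases c
  · rw [add_comm]; exact x_pow_add_y_pow K T
  · exact x_pow_add_y_pow K T

variable {K T} in
theorem letter_mul_letter_of_ne {c c' : Bool} (h : c ≠ c') :
    letter K T c * letter K T c' = 0 := by
  obtain rfl : c' = !c := by cases c <;> cases c' <;> simp_all
  exact letter_mul_letter_not K T c

variable {K T} in
theorem letter_pow_mul_letter_pow_of_ne {c c' : Bool} (h : c ≠ c') {k l : ℕ} (hk : k ≠ 0)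
    (hl : l ≠ 0) : letter K T c ^ k * letter K T c' ^ l = 0 := by
  obtain ⟨k, rfl⟩ := Nat.exists_eq_succ_of_ne_zero hk
  obtain ⟨l, rfl⟩ := Nat.exists_eq_succ_of_ne_zero hl
  rw [Nat.succ_eq_add_one, Nat.succ_eq_add_one, pow_succ, pow_succ', mul_assoc,
    ← mul_assoc (letter K T c), letter_mul_letter_of_ne h, zero_mul, mul_zero]

variable {K T} in
theorem letter_pow_eq_zero (c : Bool) {k : ℕ} (hk : 4 * T + 3 ≤ k) : letter K T c ^ k = 0 := by
  have h : letter K T c ^ (4 * T + 3) = 0 := by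
    rw [pow_succ, eq_neg_of_add_eq_zero_left (letter_pow_add_letter_pow K T c), neg_mul,
      ← pow_one (letter K T c), letter_pow_mul_letter_pow_of_ne (by simp) (by simp) (by simp),
      neg_zero]
  exact pow_eq_zero_of_le hk h

theorem e_mul_e_of_ne {i j : ZMod 4} (h : i ≠ j) : e K T i * e K T j = 0 := by
  rw [e, e, ← map_mul, pe, pe, pathElem_mul_pathElem, pathMul_ne K _ _ h.symm, map_zero]

theorem sum_e : ∑ i, e K T i = 1 := by
  rw [← map_one (toA K T)]
  exact (map_sum (toA K T) _ _).symm

theorem toA_surjective : Function.Surjective (toA K T) := RingCon.mk'_surjective _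

theorem toA_smul (r : K) (a : KΓ K) : toA K T (r • a) = r • toA K T a := rfl

theorem pathElem_mul_px {i j : ZMod 4} (p : Quiver.Path i j) :
    pathElem K p * px K = pathElem K (p.cons (Arrow.a j)) := by
  rw [px, Finset.mul_sum, Finset.sum_eq_single j]
  · rw [pathElem_mul_pathElem, pathMul_comp]
    rfl
  · intro k _ hk
    rw [pathElem_mul_pathElem, pathMul_ne K _ _ hk]
  · simp

theorem pathElem_mul_py {i j : ZMod 4} (p : Quiver.Path i j) :
    pathElem K p * py K = pathElem K (p.cons (Arrow.b j)) := by
  rw [py, Finset.mul_sum, Finset.sum_eq_single j]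
  · rw [pathElem_mul_pathElem, pathMul_comp]
    rfl
  · intro k _ hk
    rw [pathElem_mul_pathElem, pathMul_ne K _ _ hk]
  · simp

theorem span_e_mul_letter_pow :
    Submodule.span K {a : A K T | ∃ t c l, a = e K T t * letter K T c ^ l} = ⊤ := by
  set S := Submodule.span K {a : A K T | ∃ t c l, a = e K T t * letter K T c ^ l} with hS
  have hmul (c : Bool) (a : A K T) (ha : a ∈ S) : a * letter K T c ∈ S := by
    induction ha using Submodule.span_induction with
    | mem a h =>
      obtain ⟨t, c', l, rfl⟩ := h
      by_cases hc : c' = c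
      · subst hc
        rw [mul_assoc, ← pow_succ]
        exact Submodule.subset_span ⟨t, c', l + 1, rfl⟩
      · rcases Nat.eq_zero_or_pos l with rfl | hl
        · exact Submodule.subset_span ⟨t, c, 1, by simp⟩
        · have := letter_pow_mul_letter_pow_of_ne (K := K) (T := T) hc hl.ne' one_ne_zero
          rw [pow_one] at this
          rw [mul_assoc, this, mul_zero]
          exact S.zero_mem
    | zero => rw [zero_mul]; exact S.zero_mem
    | add a b _ _ ha hb => rw [add_mul]; exact S.add_mem ha hb
    | smul r a _ ha => rw [smul_mul_assoc]; exact S.smul_mem r ha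
  have hpath (i j : ZMod 4) (p : Quiver.Path i j) : toA K T (pathElem K p) ∈ S := by
    induction p with
    | nil => exact Submodule.subset_span ⟨i, true, 0, by rw [pow_zero, mul_one]; rfl⟩
    | cons p f ih =>
      change Arrow _ _ at f
      cases f with
      | a =>
        have := hmul true _ ih
        rwa [show letter K T true = toA K T (px K) from rfl, ← map_mul, pathElem_mul_px] at this
      | b =>
        have := hmul false _ ih
        rwa [show letter K T false = toA K T (py K) from rfl, ← map_mul, pathElem_mul_py] at this
  rw [eq_top_iff]
  rintro a -
  obtain ⟨a, rfl⟩ := toA_surjective K T a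
  change AnyPath (ZMod 4) →₀ K at a
  induction a using Finsupp.induction_linear with
  | zero => exact (map_zero (toA K T)).symm ▸ S.zero_mem
  | add a b ha hb => exact (map_add (toA K T) a b).symm ▸ S.add_mem ha hb
  | single p r =>
    have : (Finsupp.single p r : KΓ K) = r • pathElem K p.2.2 := by
      unfold pathElem
      exact (Finsupp.smul_single_one p r).symm
    rw [this, toA_smul]
    exact S.smul_mem r (hpath _ _ _)

variable {K T} in
/-- Induction along the spanning set of `A_T` formed by the elements `e_t x^l` and `e_t y^l`. -/
theorem A_induction {P : A K T → Prop} (zero : P 0) (add : ∀ a b, P a → P b → P (a + b))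
    (smul : ∀ (r : K) a, P a → P (r • a)) (word : ∀ t c l, P (e K T t * letter K T c ^ l))
    (a : A K T) : P a := by
  have ha : a ∈ Submodule.span K {a : A K T | ∃ t c l, a = e K T t * letter K T c ^ l} := by
    rw [span_e_mul_letter_pow]; trivial
  induction ha using Submodule.span_induction with
  | mem a h => obtain ⟨t, c, l, rfl⟩ := h; exact word t c l
  | zero => exact zero
  | add a b _ _ ha hb => exact add a b ha hb
  | smul r a _ ha => exact smul r a ha

/-- One half of the normality of the letters: `A_T c ⊆ c A_T`. -/
theorem exists_mul_letter_eq (c : Bool) (a : A K T) :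
    ∃ a', a * letter K T c = letter K T c * a' := by
  induction a using A_induction with
  | zero => exact ⟨0, by simp⟩
  | add a b ha hb =>
    obtain ⟨a', ha⟩ := ha
    obtain ⟨b', hb⟩ := hb
    exact ⟨a' + b', by rw [add_mul, mul_add, ha, hb]⟩
  | smul r a ha =>
    obtain ⟨a', ha⟩ := ha
    exact ⟨r • a', by rw [smul_mul_assoc, mul_smul_comm, ha]⟩
  | word t c' l =>
    by_cases hc : c' = c
    · subst hc
      exact ⟨e K T (t + 1) * letter K T c' ^ l, by
        rw [mul_assoc, ← pow_succ, pow_succ', ← mul_assoc, e_mul_letter, mul_assoc]⟩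
    · rcases Nat.eq_zero_or_pos l with rfl | hl
      · exact ⟨e K T (t + 1), by rw [pow_zero, mul_one, e_mul_letter]⟩
      · have := letter_pow_mul_letter_pow_of_ne (K := K) (T := T) hc hl.ne' one_ne_zero
        rw [pow_one] at this
        exact ⟨0, by rw [mul_assoc, this, mul_zero, mul_zero]⟩

/-- The other half of the normality of the letters: `c A_T ⊆ A_T c`. -/
theorem exists_letter_mul_eq (c : Bool) (a : A K T) :
    ∃ a', letter K T c * a = a' * letter K T c := by
  induction a using A_induction with
  | zero => exact ⟨0, by simp⟩
  | add a b ha hb =>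
    obtain ⟨a', ha⟩ := ha
    obtain ⟨b', hb⟩ := hb
    exact ⟨a' + b', by rw [add_mul, mul_add, ha, hb]⟩
  | smul r a ha =>
    obtain ⟨a', ha⟩ := ha
    exact ⟨r • a', by rw [smul_mul_assoc, mul_smul_comm, ha]⟩
  | word t c' l =>
    have ht : letter K T c * e K T t = e K T (t - 1) * letter K T c := by
      rw [e_mul_letter, sub_add_cancel]
    by_cases hc : c = c'
    · subst hc
      exact ⟨e K T (t - 1) * letter K T c ^ l, by
        rw [← mul_assoc, ht, mul_assoc, mul_assoc, ← pow_succ', pow_succ]⟩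
    · rcases Nat.eq_zero_or_pos l with rfl | hl
      · exact ⟨e K T (t - 1), by rw [pow_zero, mul_one, ht]⟩
      · have := letter_pow_mul_letter_pow_of_ne (K := K) (T := T) hc one_ne_zero hl.ne'
        rw [pow_one] at this
        exact ⟨0, by rw [← mul_assoc, ht, mul_assoc, this, mul_zero, zero_mul]⟩

end Arithmetic

/-! ### Coefficients with respect to the monomials -/

section Coefficients

open Polynomial

variable (K : Type u) [Field K] (T : ℕ)

/-- The weight `(X, 0)` of the arrows `a_i` or `(0, X)` of the arrows `b_i`. -/
def letterWeight (c : Bool) : K[X] × K[X] := if c then (X, 0) else (0, X)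

/-- The weight of an arrow of `Γ`. -/
def arrowWeight : ∀ {i j : ZMod 4}, Arrow i j → K[X] × K[X]
  | _, _, .a _ => letterWeight K true
  | _, _, .b _ => letterWeight K false

/-- The weight of a path in `K[X] × K[X]`: the product of the weights of its arrows. -/
def pathWeight {i : ZMod 4} : ∀ {j : ZMod 4}, Quiver.Path i j → K[X] × K[X]
  | _, .nil => 1
  | _, .cons p f => pathWeight p * arrowWeight K f

theorem pathWeight_comp {i j k : ZMod 4} (p : Quiver.Path i j) (q : Quiver.Path j k) :
    pathWeight K (p.comp q) = pathWeight K p * pathWeight K q := by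
  induction q with
  | nil => simp [pathWeight]
  | cons q f ih => rw [Quiver.Path.comp_cons, pathWeight, pathWeight, ih, mul_assoc]

/-- The two components of the weight of a path have the same constant term. -/
theorem coeff_zero_pathWeight {i j : ZMod 4} (p : Quiver.Path i j) :
    (pathWeight K p).1.coeff 0 = (pathWeight K p).2.coeff 0 := by
  induction p with
  | nil => simp [pathWeight]
  | cons p f ih =>
    change Arrow _ _ at f
    cases f <;> simp [pathWeight, arrowWeight, letterWeight]

/-- The representation of `K Γ` by matrices over `K[X] × K[X]` which sends a path from `i` to `j`
to its weight, placed in position `(i, j)`. -/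
def weightMatrix : KΓ K →ₗ[K] Matrix (ZMod 4) (ZMod 4) (K[X] × K[X]) :=
  Finsupp.linearCombination K fun p : AnyPath (ZMod 4) =>
    Matrix.single p.1 p.2.1 (pathWeight K p.2.2)

theorem weightMatrix_pathElem {i j : ZMod 4} (p : Quiver.Path i j) :
    weightMatrix K (pathElem K p) = Matrix.single i j (pathWeight K p) := by
  unfold weightMatrix pathElem
  erw [Finsupp.linearCombination_single]
  rw [one_smul]

theorem weightMatrix_mul (a b : KΓ K) :
    weightMatrix K (a * b) = weightMatrix K a * weightMatrix K b := by
  have h : (pathAlgebraMul K).compr₂ (weightMatrix K) =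
      (LinearMap.mul K _).compl₁₂ (weightMatrix K) (weightMatrix K) := by
    refine pathAlgebra_hom_ext fun i j p => pathAlgebra_hom_ext fun k l q => ?_
    change weightMatrix K (pathAlgebraMul K _ _) = weightMatrix K _ * weightMatrix K _
    rw [pathAlgebraMul_pathElem, weightMatrix_pathElem, weightMatrix_pathElem]
    by_cases hk : k = j
    · subst hk
      rw [pathMul_comp, weightMatrix_pathElem, pathWeight_comp, Matrix.single_mul_single_same]
    · rw [pathMul_ne K _ _ hk, map_zero, Matrix.single_mul_single_of_ne _ _ _ _ (Ne.symm hk)]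
  exact LinearMap.congr_fun₂ h a b

theorem coeff_zero_weightMatrix (a : KΓ K) (i j : ZMod 4) :
    (weightMatrix K a i j).1.coeff 0 = (weightMatrix K a i j).2.coeff 0 := by
  change AnyPath (ZMod 4) →₀ K at a
  induction a using Finsupp.induction_linear with
  | zero =>
    erw [map_zero]
    rfl
  | add a b ha hb =>
    erw [map_add]
    simpa using congrArg₂ (· + ·) ha hb
  | single p r =>
    have : (Finsupp.single p r : KΓ K) = r • pathElem K p.2.2 := by
      unfold pathElem
      exact (Finsupp.smul_single_one p r).symm
    rw [this, map_smul, weightMatrix_pathElem, Matrix.smul_apply, Matrix.single_apply]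
    split_ifs <;> simp [coeff_zero_pathWeight]

/-- The letters `x` and `y` of `K Γ`. -/
def pLetter (c : Bool) : KΓ K := if c then px K else py K

theorem toA_pLetter (c : Bool) : toA K T (pLetter K c) = letter K T c := by
  cases c <;> rfl

theorem weightMatrix_pLetter (c : Bool) :
    weightMatrix K (pLetter K c) = ∑ i, Matrix.single i (i + 1) (letterWeight K c) := by
  cases c
  · change weightMatrix K (py K) = _
    rw [py, map_sum]
    refine Finset.sum_congr rfl fun i _ => ?_
    rw [weightMatrix_pathElem, Quiver.Hom.toPath, pathWeight, pathWeight, one_mul]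
    rfl
  · change weightMatrix K (px K) = _
    rw [px, map_sum]
    refine Finset.sum_congr rfl fun i _ => ?_
    rw [weightMatrix_pathElem, Quiver.Hom.toPath, pathWeight, pathWeight, one_mul]
    rfl

theorem weightMatrix_mul_pLetter_pow (a : KΓ K) (t s : ZMod 4) (w : K[X] × K[X])
    (h : weightMatrix K a = Matrix.single t s w) (c : Bool) (l : ℕ) :
    weightMatrix K (a * pLetter K c ^ l) =
      Matrix.single t (s + l) (w * letterWeight K c ^ l) := by
  induction l with
  | zero => simp [h]
  | succ l ih =>
    rw [pow_succ, ← mul_assoc, weightMatrix_mul, ih, weightMatrix_pLetter, Finset.mul_sum,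
      Finset.sum_eq_single (s + l)]
    · rw [Matrix.single_mul_single_same, mul_assoc, ← pow_succ]
      push_cast
      rw [add_assoc]
    · intro k _ hk
      rw [Matrix.single_mul_single_of_ne _ _ _ _ hk.symm]
    · simp

theorem weightMatrix_pe (t : ZMod 4) : weightMatrix K (pe K t) = Matrix.single t t 1 := by
  rw [pe, weightMatrix_pathElem, pathWeight]

/-- The weights `(p, q)` for which `p` and `q` have no terms of degree at most `4T + 1`, and the
same coefficient in degree `4T + 2`. -/
def IsRelationWeight (w : K[X] × K[X]) : Prop :=
  (∀ k < 4 * T + 2, w.1.coeff k = 0 ∧ w.2.coeff k = 0) ∧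
    w.1.coeff (4 * T + 2) = w.2.coeff (4 * T + 2)

variable {K T}

theorem IsRelationWeight.zero : IsRelationWeight K T 0 := by simp [IsRelationWeight]

theorem IsRelationWeight.add {w w' : K[X] × K[X]} (h : IsRelationWeight K T w)
    (h' : IsRelationWeight K T w') : IsRelationWeight K T (w + w') := by
  refine ⟨fun k hk => ?_, ?_⟩
  · simp [h.1 k hk, h'.1 k hk]
  · simp [h.2, h'.2]

theorem IsRelationWeight.neg {w : K[X] × K[X]} (h : IsRelationWeight K T w) :
    IsRelationWeight K T (-w) := by
  refine ⟨fun k hk => ?_, ?_⟩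
  · simp [h.1 k hk]
  · simp [h.2]

theorem IsRelationWeight.sum {ι : Type*} {s : Finset ι} {w : ι → K[X] × K[X]}
    (h : ∀ k ∈ s, IsRelationWeight K T (w k)) : IsRelationWeight K T (∑ k ∈ s, w k) :=
  Finset.sum_induction _ _ (fun _ _ => IsRelationWeight.add) IsRelationWeight.zero h

/-- Multiplication by `p` scales the lowest coefficient of `q` by the constant term of `p`. -/
theorem coeff_mul_of_forall_lt {p q : K[X]} {n : ℕ} (h : ∀ k < n, q.coeff k = 0) :
    (∀ k < n, (p * q).coeff k = 0) ∧ (p * q).coeff n = p.coeff 0 * q.coeff n := by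
  refine ⟨fun k hk => ?_, ?_⟩
  · rw [coeff_mul]
    refine Finset.sum_eq_zero fun ab hab => ?_
    have hab' := Finset.HasAntidiagonal.mem_antidiagonal.1 hab
    rw [h _ (by omega), mul_zero]
  · rw [coeff_mul, Finset.sum_eq_single (0, n)]
    · rintro ⟨a, b⟩ hab hne
      have hab' := Finset.HasAntidiagonal.mem_antidiagonal.1 hab
      dsimp only at hab' ⊢
      have : b < n := by
        rcases Nat.eq_zero_or_pos a with rfl | ha
        · exact absurd (by simpa using hab') hne
        · omega
      rw [h _ this, mul_zero]
    · simp

theorem IsRelationWeight.mul {w w' : K[X] × K[X]} (hw : w.1.coeff 0 = w.2.coeff 0)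
    (h : IsRelationWeight K T w') : IsRelationWeight K T (w * w') := by
  have h1 := coeff_mul_of_forall_lt (p := w.1) fun k hk => (h.1 k hk).1
  have h2 := coeff_mul_of_forall_lt (p := w.2) fun k hk => (h.1 k hk).2
  exact ⟨fun k hk => ⟨h1.1 k hk, h2.1 k hk⟩, by
    rw [Prod.fst_mul, Prod.snd_mul, h1.2, h2.2, hw, h.2]⟩

variable (K T)

/-- The elements of `K Γ` all of whose weights are those of relations form a two-sided ideal. -/
def relationIdeal : TwoSidedIdeal (KΓ K) :=
  TwoSidedIdeal.mk' {a | ∀ i j, IsRelationWeight K T (weightMatrix K a i j)}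
    (fun i j => by rw [map_zero]; exact IsRelationWeight.zero)
    (fun {a b} ha hb i j => by rw [map_add]; exact (ha i j).add (hb i j))
    (fun {a} ha i j => by rw [map_neg]; exact (ha i j).neg)
    (fun {a b} hb i j => by
      rw [weightMatrix_mul, Matrix.mul_apply]
      exact IsRelationWeight.sum fun k _ => (hb k j).mul (coeff_zero_weightMatrix K a i k))
    (fun {a b} ha i j => by
      rw [weightMatrix_mul, Matrix.mul_apply]
      refine IsRelationWeight.sum fun k _ => ?_
      rw [mul_comm]
      exact (ha i k).mul (coeff_zero_weightMatrix K b k j))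

theorem mem_relationIdeal {a : KΓ K} :
    a ∈ relationIdeal K T ↔ ∀ i j, IsRelationWeight K T (weightMatrix K a i j) := by
  unfold relationIdeal
  rw [TwoSidedIdeal.mem_mk']
  rfl

theorem sum_pe : ∑ i, pe K i = 1 := rfl

theorem weightMatrix_pLetter_pow_mul (c c' : Bool) (k l : ℕ) :
    weightMatrix K (pLetter K c ^ k * pLetter K c' ^ l) =
      ∑ t : ZMod 4, Matrix.single t (t + k + l) (letterWeight K c ^ k * letterWeight K c' ^ l) := by
  rw [← one_mul (pLetter K c ^ k * _), ← sum_pe, Finset.sum_mul, map_sum]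
  refine Finset.sum_congr rfl fun t _ => ?_
  rw [← mul_assoc]
  refine weightMatrix_mul_pLetter_pow K _ _ _ _ ?_ _ _
  simpa using weightMatrix_mul_pLetter_pow K (pe K t) t t 1 (weightMatrix_pe K t) c k

/-- The relations of `A_T` have weights `0` and `(X^(4T+2), X^(4T+2))`. -/
theorem idealI_le_relationIdeal : idealI K T ≤ relationIdeal K T := by
  unfold idealI
  rw [TwoSidedIdeal.span_le]
  have hmul (c : Bool) : pLetter K c * pLetter K (!c) ∈ relationIdeal K T := by
    rw [mem_relationIdeal]
    intro i j
    have h := weightMatrix_pLetter_pow_mul K c (!c) 1 1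
    have h0 : letterWeight K c * letterWeight K (!c) = 0 := by
      cases c <;> simp [letterWeight]
    simp only [pow_one, h0, Matrix.single_zero, Finset.sum_const_zero] at h
    rw [h]
    exact IsRelationWeight.zero
  have hadd : px K ^ (4 * T + 2) + py K ^ (4 * T + 2) ∈ relationIdeal K T := by
    rw [mem_relationIdeal]
    intro i j
    have hx := weightMatrix_pLetter_pow_mul K true true (4 * T + 2) 0
    have hy := weightMatrix_pLetter_pow_mul K false false (4 * T + 2) 0
    simp only [pow_zero, mul_one] at hx hy
    change IsRelationWeight K T
      (weightMatrix K (pLetter K true ^ (4 * T + 2) + pLetter K false ^ (4 * T + 2)) i j)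
    rw [map_add, hx, hy, ← Finset.sum_add_distrib, Matrix.sum_apply]
    refine IsRelationWeight.sum fun t _ => ?_
    rw [← Matrix.single_add, Matrix.single_apply]
    split_ifs
    · refine ⟨fun k hk => ?_, ?_⟩
      · simp [letterWeight, coeff_X_pow, hk.ne]
      · simp [letterWeight, coeff_X_pow]
    · exact IsRelationWeight.zero
  rintro a (rfl | rfl | rfl)
  · exact hmul true
  · exact hadd
  · exact hmul false

/-- The sum of all entries of the matrix of weights. -/
def totalWeight : KΓ K →ₗ[K] K[X] × K[X] where
  toFun a := ∑ i, ∑ j, weightMatrix K a i j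
  map_add' a b := by simp [Finset.sum_add_distrib]
  map_smul' r a := by simp [Finset.smul_sum]

theorem totalWeight_pe_mul_pow (t : ZMod 4) (c : Bool) (l : ℕ) :
    totalWeight K (pe K t * pLetter K c ^ l) = letterWeight K c ^ l := by
  have h := weightMatrix_mul_pLetter_pow K (pe K t) t t 1 (weightMatrix_pe K t) c l
  rw [one_mul] at h
  change ∑ i, ∑ j, weightMatrix K _ i j = _
  rw [h, Finset.sum_eq_single t, Finset.sum_eq_single (t + l)]
  · simp
  · intro j _ hj
    exact Matrix.single_apply_of_col_ne _ _ hj.symm _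
  · simp
  · intro i _ hi
    exact Finset.sum_eq_zero fun j _ => Matrix.single_apply_of_row_ne hi.symm _ _ _
  · simp

variable {K T} in
/-- A linear form on `K[X] × K[X]` which vanishes on the weights of relations descends to a linear
form on `A_T`. -/
theorem exists_linear_of_relationWeight (f : K[X] × K[X] →ₗ[K] K)
    (hf : ∀ w, IsRelationWeight K T w → f w = 0) :
    ∃ F : A K T →ₗ[K] K, ∀ t c l, F (e K T t * letter K T c ^ l) = f (letterWeight K c ^ l) := by
  let p : KΓ K →ₗ[K] A K T :=
    { toFun := toA K T, map_add' := map_add (toA K T), map_smul' := toA_smul K T }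
  have hp : Function.Surjective p := toA_surjective K T
  have hker : LinearMap.ker p ≤ LinearMap.ker (f ∘ₗ totalWeight K) := by
    intro a ha
    have ha' : (idealI K T).ringCon a 0 := (RingCon.eq _).1 (ha : toA K T a = toA K T 0)
    have hmem := (mem_relationIdeal K T).1
      (idealI_le_relationIdeal K T ((TwoSidedIdeal.mem_iff _ _).2 ha'))
    exact hf _ (IsRelationWeight.sum fun i _ => IsRelationWeight.sum fun j _ => hmem i j)
  refine ⟨(LinearMap.ker p).liftQ (f ∘ₗ totalWeight K) hker ∘ₗ
    (p.quotKerEquivOfSurjective hp).symm.toLinearMap, fun t c l => ?_⟩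
  have h : e K T t * letter K T c ^ l = p (pe K t * pLetter K c ^ l) := by
    change _ = toA K T _
    rw [map_mul, map_pow, toA_pLetter]
    rfl
  have h2 : (p.quotKerEquivOfSurjective hp).symm (p (pe K t * pLetter K c ^ l)) =
      Submodule.Quotient.mk (pe K t * pLetter K c ^ l) := by
    rw [LinearEquiv.symm_apply_eq]
    rfl
  rw [h, LinearMap.comp_apply, LinearEquiv.coe_coe, h2, Submodule.liftQ_apply,
    LinearMap.comp_apply, totalWeight_pe_mul_pow]

/-- The component of a weight in which the letter `c` is visible. -/
def component (c : Bool) : K[X] × K[X] →ₗ[K] K[X] :=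
  if c then LinearMap.fst K _ _ else LinearMap.snd K _ _

theorem coeff_component_self (c : Bool) (k l : ℕ) :
    (component K c (letterWeight K c ^ l)).coeff k = if k = l then 1 else 0 := by
  cases c <;> simp [component, letterWeight, coeff_X_pow]

theorem coeff_component_not (c : Bool) {k : ℕ} (hk : k ≠ 0) (l : ℕ) :
    (component K c (letterWeight K (!c) ^ l)).coeff k = 0 := by
  rcases Nat.eq_zero_or_pos l with rfl | hl
  · cases c <;> simp [component, coeff_one, hk]
  · cases c <;> simp [component, letterWeight, hl.ne']

/-- Below the socle, the coefficient at `c^k` is a well-defined linear form on `A_T`. -/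
theorem exists_coeff (c : Bool) {k : ℕ} (hk : k ≠ 0) (hk' : k < 4 * T + 2) :
    ∃ F : A K T →ₗ[K] K, (∀ t l, F (e K T t * letter K T c ^ l) = if k = l then 1 else 0) ∧
      ∀ t l, F (e K T t * letter K T (!c) ^ l) = 0 := by
  obtain ⟨F, hF⟩ := exists_linear_of_relationWeight (K := K) (T := T)
    (lcoeff K k ∘ₗ component K c) (fun w hw => by
      cases c
      · exact (hw.1 k hk').2
      · exact (hw.1 k hk').1)
  refine ⟨F, fun t l => ?_, fun t l => ?_⟩
  · rw [hF]; exact coeff_component_self K c k l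
  · rw [hF]; exact coeff_component_not K c hk l

/-- The coefficient at the socle element `c^(4T+2) = -(!c)^(4T+2)` is a well-defined linear form. -/
theorem exists_socle_coeff (c : Bool) :
    ∃ F : A K T →ₗ[K] K,
      (∀ t l, F (e K T t * letter K T c ^ l) = if 4 * T + 2 = l then 1 else 0) ∧
      ∀ t l, F (e K T t * letter K T (!c) ^ l) = if 4 * T + 2 = l then -1 else 0 := by
  obtain ⟨F, hF⟩ := exists_linear_of_relationWeight (K := K) (T := T)
    (lcoeff K (4 * T + 2) ∘ₗ component K c - lcoeff K (4 * T + 2) ∘ₗ component K (!c))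
    (fun w hw => by
      cases c
      · exact sub_eq_zero.2 hw.2.symm
      · exact sub_eq_zero.2 hw.2)
  refine ⟨F, fun t l => ?_, fun t l => ?_⟩
  · rw [hF]
    have h1 := coeff_component_self K c (4 * T + 2) l
    have h2 := coeff_component_not K (!c) (k := 4 * T + 2) (by omega) l
    rw [Bool.not_not] at h2
    rw [LinearMap.sub_apply, LinearMap.comp_apply, LinearMap.comp_apply, lcoeff_apply,
      lcoeff_apply, h1, h2, sub_zero]
  · rw [hF]
    have h1 := coeff_component_not K c (k := 4 * T + 2) (by omega) l
    have h2 := coeff_component_self K (!c) (4 * T + 2) l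
    rw [LinearMap.sub_apply, LinearMap.comp_apply, LinearMap.comp_apply, lcoeff_apply,
      lcoeff_apply, h1, h2]
    split_ifs <;> simp

theorem exists_truncDiv (c : Bool) :
    ∃ δ : A K T →ₗ[K] A K T,
      (∀ t l, l < 4 * T + 1 → δ (e K T t * letter K T c ^ (l + 1)) = letter K T c ^ l) ∧
      (∀ t l, 4 * T + 1 ≤ l → δ (e K T t * letter K T c ^ (l + 1)) = 0) ∧
      (∀ t, δ (e K T t) = 0) ∧
      ∀ t l, δ (e K T t * letter K T (!c) ^ l) = 0 := by
  have hex (k : Fin (4 * T + 1)) := exists_coeff K T c (Nat.succ_ne_zero k)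
    (show (k : ℕ) + 1 < 4 * T + 2 by omega)
  choose F hF hF' using hex
  have hval (t : ZMod 4) (l : ℕ) :
      (∑ k : Fin (4 * T + 1), (F k).smulRight (letter K T c ^ (k : ℕ)))
        (e K T t * letter K T c ^ l) =
      ∑ k : Fin (4 * T + 1), (if (k : ℕ) + 1 = l then (1 : K) else 0) • letter K T c ^ (k : ℕ) := by
    rw [LinearMap.sum_apply]
    exact Finset.sum_congr rfl fun k _ => by rw [LinearMap.smulRight_apply, hF]
  refine ⟨∑ k, (F k).smulRight (letter K T c ^ (k : ℕ)), fun t l hl => ?_, fun t l hl => ?_,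
    fun t => ?_, fun t l => ?_⟩
  · rw [hval, Finset.sum_eq_single ⟨l, hl⟩]
    · simp
    · intro k _ hk
      rw [if_neg, zero_smul]
      exact fun h => hk (Fin.ext (Nat.succ_injective h))
    · simp
  · rw [hval]
    refine Finset.sum_eq_zero fun k _ => ?_
    rw [if_neg (by omega), zero_smul]
  · have := hval t 0
    rw [pow_zero, mul_one] at this
    rw [this]
    simp
  · rw [LinearMap.sum_apply]
    exact Finset.sum_eq_zero fun k _ => by rw [LinearMap.smulRight_apply, hF', zero_smul]

/-- Division by the letter `c`, truncated below the socle: the linear map with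
`e_t c^(l+1) ↦ c^l` for `l < 4T + 1`, which kills `e_t`, the socle element `e_t c^(4T+2)`, and all
powers of the other letter. -/
def truncDiv (c : Bool) : A K T →ₗ[K] A K T := (exists_truncDiv K T c).choose

variable {K T}

theorem truncDiv_self (c : Bool) (t : ZMod 4) {l : ℕ} (hl : l < 4 * T + 1) :
    truncDiv K T c (e K T t * letter K T c ^ (l + 1)) = letter K T c ^ l :=
  (exists_truncDiv K T c).choose_spec.1 t l hl

theorem truncDiv_self_of_le (c : Bool) (t : ZMod 4) {l : ℕ} (hl : 4 * T + 2 ≤ l) :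
    truncDiv K T c (e K T t * letter K T c ^ l) = 0 := by
  obtain ⟨l, rfl⟩ : ∃ k, l = k + 1 := ⟨l - 1, by omega⟩
  exact (exists_truncDiv K T c).choose_spec.2.1 t _ (by omega)

theorem truncDiv_e (c : Bool) (t : ZMod 4) : truncDiv K T c (e K T t) = 0 :=
  (exists_truncDiv K T c).choose_spec.2.2.1 t

theorem truncDiv_not (c : Bool) (t : ZMod 4) (l : ℕ) :
    truncDiv K T c (e K T t * letter K T (!c) ^ l) = 0 :=
  (exists_truncDiv K T c).choose_spec.2.2.2 t l

variable (K T)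

/-- Division by the letter `c`: the linear map with `e_t c^(l+1) ↦ c^l` for `l ≤ 4T + 1`, which
kills `e_t` and the powers of the other letter outside the socle. -/
def letterDiv (c : Bool) : A K T →ₗ[K] A K T :=
  truncDiv K T c + (exists_socle_coeff K T c).choose.smulRight (letter K T c ^ (4 * T + 1))

/-- The linear map with `e_t c^(4T+1) ↦ 1` which kills all other `e_t c^l` and the powers of the
other letter. -/
def topCoeff (c : Bool) : A K T →ₗ[K] A K T :=
  (exists_coeff K T c (k := 4 * T + 1) (by omega) (by omega)).choose.smulRight 1

variable {K T}

theorem letterDiv_self (c : Bool) (t : ZMod 4) {l : ℕ} (hl : l ≤ 4 * T + 1) :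
    letterDiv K T c (e K T t * letter K T c ^ (l + 1)) = letter K T c ^ l := by
  rw [letterDiv, LinearMap.add_apply, LinearMap.smulRight_apply,
    (exists_socle_coeff K T c).choose_spec.1]
  rcases hl.lt_or_eq with hl | rfl
  · rw [truncDiv_self c t hl, if_neg (by omega), zero_smul, add_zero]
  · rw [truncDiv_self_of_le c t (by omega), if_pos rfl, one_smul, zero_add]

theorem letterDiv_not (c : Bool) (t : ZMod 4) {l : ℕ} (hl : l ≤ 4 * T + 1) :
    letterDiv K T c (e K T t * letter K T (!c) ^ l) = 0 := by
  rw [letterDiv, LinearMap.add_apply, LinearMap.smulRight_apply,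
    (exists_socle_coeff K T c).choose_spec.2, truncDiv_not, if_neg (by omega), zero_smul, add_zero]

theorem letterDiv_e (c : Bool) (t : ZMod 4) : letterDiv K T c (e K T t) = 0 := by
  simpa using letterDiv_not c t (Nat.zero_le _)

theorem letterDiv_not_socle (c : Bool) (t : ZMod 4) :
    letterDiv K T c (e K T t * letter K T (!c) ^ (4 * T + 2)) = -letter K T c ^ (4 * T + 1) := by
  have h := letter_pow_add_letter_pow K T c
  rw [eq_neg_of_add_eq_zero_right h, mul_neg, map_neg, letterDiv_self c t le_rfl]

theorem topCoeff_self (c : Bool) (t : ZMod 4) (l : ℕ) :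
    topCoeff K T c (e K T t * letter K T c ^ l) = if 4 * T + 1 = l then 1 else 0 := by
  rw [topCoeff, LinearMap.smulRight_apply, (exists_coeff K T c (by omega) (by omega)).choose_spec.1]
  split_ifs <;> simp

theorem topCoeff_not (c : Bool) (t : ZMod 4) (l : ℕ) :
    topCoeff K T c (e K T t * letter K T (!c) ^ l) = 0 := by
  rw [topCoeff, LinearMap.smulRight_apply,
    (exists_coeff K T c (by omega) (by omega)).choose_spec.2, zero_smul]

theorem topCoeff_e (c : Bool) (t : ZMod 4) : topCoeff K T c (e K T t) = 0 := by
  simpa using topCoeff_not (K := K) (T := T) c t 0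

end Coefficients

/-! ### Generalities on bimodules -/

section Bimodules

variable {K : Type u} [Field K] {T : ℕ} {M : Type*} [AddCommGroup M] [Module (Env K T) M]

theorem bi_add (a b : A K T) (q q' : M) : bi a (q + q') b = bi a q b + bi a q' b :=
  smul_add _ _ _

theorem bi_sub (a b : A K T) (q q' : M) : bi a (q - q') b = bi a q b - bi a q' b :=
  smul_sub _ _ _

theorem bi_zero (a b : A K T) : bi a (0 : M) b = 0 := smul_zero _

theorem add_bi (a a' b : A K T) (q : M) : bi (a + a') q b = bi a q b + bi a' q b := by
  unfold bi; rw [add_tmul, add_smul]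

theorem bi_add_right (a b b' : A K T) (q : M) : bi a q (b + b') = bi a q b + bi a q b' := by
  unfold bi; rw [MulOpposite.op_add, tmul_add, add_smul]

theorem zero_bi (b : A K T) (q : M) : bi 0 q b = 0 := by
  unfold bi; rw [zero_tmul]; exact zero_smul (Env K T) q

theorem bi_zero_right (a : A K T) (q : M) : bi a q 0 = 0 := by
  unfold bi; rw [MulOpposite.op_zero, tmul_zero]; exact zero_smul (Env K T) q

theorem smul_bi (r : K) (a b : A K T) (q : M) : bi (r • a) q b = bi a q (r • b) := by
  unfold bi; rw [MulOpposite.op_smul, smul_tmul]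

theorem one_bi_one (q : M) : bi (1 : A K T) q 1 = q := one_smul (Env K T) q

theorem map_bi {M' : Type*} [AddCommGroup M'] [Module (Env K T) M'] (f : M →ₗ[Env K T] M')
    (a b : A K T) (q : M) : f (bi a q b) = bi a (f q) b := map_smul f _ q

/-- Left multiplication by an element of `A_T` on a bimodule. -/
def lact (M : Type*) [AddCommGroup M] [Module (Env K T) M] : A K T →* AddMonoid.End M where
  toFun a := { toFun := fun q => bi a q 1, map_zero' := bi_zero a 1, map_add' := bi_add a 1 }
  map_one' := by ext q; exact one_bi_one q
  map_mul' a b := by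
    ext q
    change bi (a * b) q 1 = bi a (bi b q 1) 1
    rw [bi_bi, mul_one]

/-- Right multiplication by an element of `A_T` on a bimodule. -/
def ract (M : Type*) [AddCommGroup M] [Module (Env K T) M] (b : A K T) : AddMonoid.End M :=
  { toFun := fun q => bi 1 q b, map_zero' := bi_zero 1 b, map_add' := bi_add 1 b }

theorem lact_apply (a : A K T) (q : M) : lact M a q = bi a q 1 := rfl

theorem ract_apply (b : A K T) (q : M) : ract M b q = bi 1 q b := rfl

theorem ract_pow_apply (b : A K T) (k : ℕ) (q : M) : (ract M b ^ k) q = bi 1 q (b ^ k) := by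
  induction k generalizing q with
  | zero => rw [pow_zero, pow_zero]; exact (one_bi_one q).symm
  | succ k ih =>
    rw [pow_succ']
    change ract M b ((ract M b ^ k) q) = _
    rw [ih, ract_apply, bi_bi, mul_one, ← pow_succ]

variable (K T) in
/-- The subgroup `x^k M + y^k M` of a bimodule `M`. -/
def leftRad (M : Type*) [AddCommGroup M] [Module (Env K T) M] (k : ℕ) : AddSubgroup M :=
  (lact M (letter K T true ^ k)).range ⊔ (lact M (letter K T false ^ k)).range

theorem bi_letter_pow_mem_leftRad (c : Bool) (k : ℕ) (q : M) :
    bi (letter K T c ^ k) q 1 ∈ leftRad K T M k := by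
  cases c
  · exact AddSubgroup.mem_sup_right ⟨q, rfl⟩
  · exact AddSubgroup.mem_sup_left ⟨q, rfl⟩

theorem bi_letter_pow_mem_leftRad_of_le (c : Bool) {k l : ℕ} (h : k ≤ l) (q : M) (b : A K T) :
    bi (letter K T c ^ l) q b ∈ leftRad K T M k := by
  have := bi_letter_pow_mem_leftRad (K := K) (T := T) c k (bi (letter K T c ^ (l - k)) q b)
  rwa [bi_bi, mul_one, ← pow_add, Nat.add_sub_cancel' h] at this

theorem leftRad_induction {k : ℕ} {P : M → Prop}
    (add : ∀ z z', P z → P z' → P (z + z'))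
    (word : ∀ c q, P (bi (letter K T c ^ k) q 1)) {z : M} (hz : z ∈ leftRad K T M k) : P z := by
  obtain ⟨_, ⟨q, rfl⟩, _, ⟨q', rfl⟩, rfl⟩ := AddSubgroup.mem_sup.1 hz
  exact add _ _ (word true q) (word false q')

theorem leftRad_zero : leftRad K T M 0 = ⊤ := by
  rw [eq_top_iff]
  rintro z -
  have := bi_letter_pow_mem_leftRad (K := K) (T := T) true 0 z
  rwa [pow_zero, one_bi_one] at this

theorem leftRad_eq_bot : leftRad K T M (4 * T + 3) = ⊥ := by
  rw [eq_bot_iff]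
  intro z hz
  refine leftRad_induction (P := fun z => z ∈ (⊥ : AddSubgroup M))
    (fun z z' h h' => ?_) (fun c' q => ?_) hz
  · exact add_mem h h'
  · rw [letter_pow_eq_zero c' le_rfl, zero_bi]
    exact zero_mem _

/-- The radical filtration on the left is compatible with the products in `A_T`. -/
theorem bi_letter_pow_mem_leftRad_succ (c : Bool) (k : ℕ) {z : M} (hz : z ∈ leftRad K T M 1) :
    bi (letter K T c ^ k) z 1 ∈ leftRad K T M (k + 1) := by
  refine leftRad_induction (P := fun z => bi (letter K T c ^ k) z 1 ∈ leftRad K T M (k + 1))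
    (fun z z' h h' => ?_) (fun c' q => ?_) hz
  · rw [bi_add]; exact add_mem h h'
  · rw [bi_bi, mul_one]
    rcases Nat.eq_zero_or_pos k with rfl | hk
    · rw [pow_zero, one_mul]; exact bi_letter_pow_mem_leftRad _ _ _
    · by_cases hc : c = c'
      · subst hc
        rw [← pow_add]
        exact bi_letter_pow_mem_leftRad _ _ _
      · rw [letter_pow_mul_letter_pow_of_ne hc hk.ne' one_ne_zero, zero_bi]
        exact zero_mem _

/-- As the letters are normal elements, the left radical `x M + y M` is a sub-bimodule. -/
theorem bi_mem_leftRad (a b : A K T) {z : M} (hz : z ∈ leftRad K T M 1) :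
    bi a z b ∈ leftRad K T M 1 := by
  refine leftRad_induction (P := fun z => bi a z b ∈ leftRad K T M 1)
    (fun z z' h h' => ?_) (fun c' q => ?_) hz
  · rw [bi_add]; exact add_mem h h'
  · obtain ⟨a', ha⟩ := exists_mul_letter_eq K T c' a
    rw [bi_bi, pow_one, ha, one_mul]
    have := bi_letter_pow_mem_leftRad (K := K) (T := T) c' 1 (bi a' q b)
    rwa [bi_bi, pow_one, mul_one] at this

theorem e_mul_letter_pow_bi_mem_leftRad (t : ZMod 4) (c : Bool) {l : ℕ} (hl : l ≠ 0) (q : M)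
    (b : A K T) : bi (e K T t * letter K T c ^ l) q b ∈ leftRad K T M 1 := by
  rw [e_mul_letter_pow]
  have := bi_letter_pow_mem_leftRad_of_le c (Nat.one_le_iff_ne_zero.2 hl)
    (bi (e K T (t + l)) q b) (1 : A K T)
  rwa [bi_bi, mul_one] at this

/-! ### Nakayama's lemma for nilpotent radicals -/

/-- If `f` and `g` are nilpotent with `f g = g f = 0`, then a subgroup stable under `f` and `g`
which together with the images of `f` and `g` generates everything is everything. -/
theorem eq_top_of_nilpotent {M : Type*} [AddCommGroup M] (f g : AddMonoid.End M) (k : ℕ)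
    (hf : f ^ k = 0) (hg : g ^ k = 0) (hfg : f * g = 0) (hgf : g * f = 0) (L : AddSubgroup M)
    (hLf : ∀ z ∈ L, f z ∈ L) (hLg : ∀ z ∈ L, g z ∈ L)
    (h : ∀ z, ∃ p q, ∃ l ∈ L, z = f p + g q + l) : L = ⊤ := by
  have key (r : ℕ) : ∀ z, ∃ p q, ∃ l ∈ L, z = (f ^ (r + 1)) p + (g ^ (r + 1)) q + l := by
    induction r with
    | zero => simpa using h
    | succ r ih =>
      intro z
      obtain ⟨p, q, l, hl, rfl⟩ := h z
      obtain ⟨p1, p2, p3, hp3, rfl⟩ := ih p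
      obtain ⟨q1, q2, q3, hq3, rfl⟩ := ih q
      refine ⟨p1, q2, f p3 + g q3 + l, add_mem (add_mem (hLf _ hp3) (hLg _ hq3)) hl, ?_⟩
      have h1 : f ((g ^ (r + 1)) p2) = 0 := by
        rw [← Function.comp_apply (f := f), ← AddMonoid.End.coe_mul, pow_succ', ← mul_assoc, hfg,
          zero_mul]
        rfl
      have h2 : g ((f ^ (r + 1)) q1) = 0 := by
        rw [← Function.comp_apply (f := g), ← AddMonoid.End.coe_mul, pow_succ', ← mul_assoc, hgf,
          zero_mul]
        rfl
      rw [map_add, map_add, map_add, map_add, h1, h2, pow_succ' f (r + 1), pow_succ' g (r + 1),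
        AddMonoid.End.coe_mul, AddMonoid.End.coe_mul, Function.comp_apply, Function.comp_apply]
      abel
  rw [eq_top_iff]
  rintro z -
  obtain ⟨p, q, l, hl, rfl⟩ := key k z
  rw [pow_succ, pow_succ, hf, hg, zero_mul, zero_mul]
  simpa using hl

variable (K T) in
/-- The subgroup `xM + yM + Mx + My`, the radical of the bimodule `M`. -/
def biRad (M : Type*) [AddCommGroup M] [Module (Env K T) M] : AddSubgroup M :=
  leftRad K T M 1 ⊔
    ((ract M (letter K T true)).range ⊔ (ract M (letter K T false)).range)

theorem leftRad_le_biRad : leftRad K T M 1 ≤ biRad K T M := le_sup_left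

theorem bi_left_letter_mem_biRad (c : Bool) (q : M) (b : A K T) :
    bi (letter K T c) q b ∈ biRad K T M :=
  leftRad_le_biRad (by simpa using bi_letter_pow_mem_leftRad_of_le c (le_refl 1) q b)

theorem bi_right_letter_mem_biRad (c : Bool) (q : M) (a : A K T) :
    bi a q (letter K T c) ∈ biRad K T M := by
  have h : bi a q (letter K T c) = ract M (letter K T c) (bi a q 1) := by
    rw [ract_apply, bi_bi, one_mul, one_mul]
  rw [h]
  cases c
  · exact AddSubgroup.mem_sup_right (AddSubgroup.mem_sup_right ⟨_, rfl⟩)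
  · exact AddSubgroup.mem_sup_right (AddSubgroup.mem_sup_left ⟨_, rfl⟩)

theorem bi_mem_biRad (a b : A K T) {z : M} (hz : z ∈ biRad K T M) : bi a z b ∈ biRad K T M := by
  obtain ⟨z1, h1, z2, h2, rfl⟩ := AddSubgroup.mem_sup.1 hz
  obtain ⟨_, ⟨q, rfl⟩, _, ⟨q', rfl⟩, rfl⟩ := AddSubgroup.mem_sup.1 h2
  have hr (c : Bool) (q : M) : bi a (ract M (letter K T c) q) b ∈ biRad K T M := by
    obtain ⟨b', hb⟩ := exists_letter_mul_eq K T c b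
    have h : bi a (ract M (letter K T c) q) b = bi 1 (bi a q b') (letter K T c) := by
      rw [ract_apply, bi_bi, bi_bi, hb, mul_one, one_mul]
    rw [h]
    exact bi_right_letter_mem_biRad _ _ _
  rw [bi_add, bi_add]
  exact add_mem (leftRad_le_biRad (bi_mem_leftRad a b h1)) (add_mem (hr _ _) (hr _ _))

/-- Sub-bimodules of the radical are superfluous: Nakayama's lemma is applied to right
multiplication by the letters, which reduces `M` to `L + (x M + y M)`, and then to left
multiplication. -/
theorem isSuperfluous_of_le_biRad (N : Submodule (Env K T) M) (hN : ∀ z ∈ N, z ∈ biRad K T M) :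
    IsSuperfluous N := by
  intro L hL
  have hLbi (a b : A K T) (z : M) (hz : z ∈ L) : bi a z b ∈ L := L.smul_mem _ hz
  have hx0 (c : Bool) : letter K T c * letter K T (!c) = 0 := letter_mul_letter_not K T c
  have h1 : L.toAddSubgroup ⊔ leftRad K T M 1 = ⊤ := by
    have hst (c : Bool) : ∀ z ∈ L.toAddSubgroup ⊔ leftRad K T M 1,
        ract M (letter K T c) z ∈ L.toAddSubgroup ⊔ leftRad K T M 1 := by
      intro z hz
      obtain ⟨l, hl, z', hz', rfl⟩ := AddSubgroup.mem_sup.1 hz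
      rw [map_add]
      exact add_mem (AddSubgroup.mem_sup_left (hLbi _ _ _ hl))
        (AddSubgroup.mem_sup_right (bi_mem_leftRad _ _ hz'))
    have hnil (c : Bool) : ract M (letter K T c) ^ (4 * T + 3) = 0 := by
      ext q
      rw [ract_pow_apply, letter_pow_eq_zero c le_rfl, bi_zero_right]
      rfl
    have hmul (c : Bool) :
        ract M (letter K T c) * ract M (letter K T (!c)) = 0 := by
      ext q
      have := hx0 (!c)
      rw [Bool.not_not] at this
      rw [AddMonoid.End.coe_mul, Function.comp_apply, ract_apply, ract_apply, bi_bi, this,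
        bi_zero_right]
      rfl
    refine eq_top_of_nilpotent (ract M (letter K T true)) (ract M (letter K T false)) (4 * T + 3)
      (hnil _) (hnil _) (hmul true) (hmul false) _ (hst _) (hst _) fun z => ?_
    obtain ⟨n, hn, l, hl, hz⟩ := Submodule.mem_sup.1 (hL ▸ Submodule.mem_top : z ∈ N ⊔ L)
    obtain ⟨z1, hz1, z2, hz2, h12⟩ := AddSubgroup.mem_sup.1 (hN n hn)
    obtain ⟨_, ⟨q, rfl⟩, _, ⟨q', rfl⟩, rfl⟩ := AddSubgroup.mem_sup.1 hz2
    exact ⟨q, q', l + z1, add_mem (AddSubgroup.mem_sup_left hl) (AddSubgroup.mem_sup_right hz1),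
      by
        rw [← hz, ← h12]
        change z1 + (ract M _ q + ract M _ q') + l = ract M _ q + ract M _ q' + (l + z1)
        abel⟩
  have h2 : L.toAddSubgroup = ⊤ := by
    have hnil (c : Bool) : lact M (letter K T c) ^ (4 * T + 3) = 0 := by
      ext q
      rw [← map_pow, letter_pow_eq_zero c le_rfl, lact_apply, zero_bi]
      rfl
    have hmul (c : Bool) : lact M (letter K T c) * lact M (letter K T (!c)) = 0 := by
      ext q
      rw [← map_mul, hx0, lact_apply, zero_bi]
      rfl
    refine eq_top_of_nilpotent (lact M (letter K T true)) (lact M (letter K T false)) (4 * T + 3)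
      (hnil _) (hnil _) (hmul true) (hmul false) _ (fun z hz => hLbi _ _ _ hz)
      (fun z hz => hLbi _ _ _ hz) fun z => ?_
    obtain ⟨l, hl, z', hz', rfl⟩ :=
      AddSubgroup.mem_sup.1 (h1 ▸ AddSubgroup.mem_top z : z ∈ L.toAddSubgroup ⊔ leftRad K T M 1)
    obtain ⟨_, ⟨q, rfl⟩, _, ⟨q', rfl⟩, rfl⟩ := AddSubgroup.mem_sup.1 hz'
    exact ⟨q, q', l, hl, by rw [pow_one, pow_one]; abel⟩
  exact (Submodule.toAddSubgroup_injective (h2.trans rfl) : L = ⊤)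

end Bimodules

/-! ### The bimodules `Q^n` -/

section ProjectiveBimodules

variable {K : Type u} [Field K] {T : ℕ}

instance projective_Proj (i t : ZMod 4) : Module.Projective (Env K T) (Proj K T i t) := by
  have hε : (e K T i ⊗ₜ[K] MulOpposite.op (e K T t) : Env K T) *
      (e K T i ⊗ₜ[K] MulOpposite.op (e K T t)) = e K T i ⊗ₜ[K] MulOpposite.op (e K T t) := by
    rw [Algebra.TensorProduct.tmul_mul_tmul, ← MulOpposite.op_mul, e_mul_self, e_mul_self]
  refine Module.Projective.of_split (Proj K T i t).subtype
    (LinearMap.toSpanSingleton (Env K T) (Proj K T i t)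
      ⟨e K T i ⊗ₜ[K] MulOpposite.op (e K T t), Submodule.subset_span rfl⟩) ?_
  ext ⟨z, hz⟩
  obtain ⟨r, rfl⟩ := Submodule.mem_span_singleton.1 hz
  change (r * _) * _ = r * _
  rw [mul_assoc, hε]

theorem projective_Q (n : ℕ) : Module.Projective (Env K T) (Q K T n) := by
  exact Module.Projective.of_equiv
    (DFinsupp.linearEquivFunOnFintype (R := Env K T)
      (M := fun p : ZMod 4 × Fin (n + 1) => Proj K T p.1 (p.1 + n)))

/-- A set generates `M` if homomorphisms from `M` are determined by their values on it: apply this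
to the quotient map and the zero map. -/
theorem span_eq_top_of_hom_ext {R M : Type*} [Ring R] [AddCommGroup M] [Module R M] (s : Set M)
    (h : ∀ f f' : M →ₗ[R] M ⧸ Submodule.span R s, (∀ z ∈ s, f z = f' z) → f = f') :
    Submodule.span R s = ⊤ := by
  rw [← Submodule.ker_mkQ (Submodule.span R s), h (Submodule.mkQ _) 0, LinearMap.ker_zero]
  intro z hz
  rw [LinearMap.zero_apply, Submodule.mkQ_apply, Submodule.Quotient.mk_eq_zero]
  exact Submodule.subset_span hz

theorem span_gen (n : ℕ) :
    Submodule.span (Env K T) {z | ∃ i j, j ≤ n ∧ z = gen K T n i j} = ⊤ :=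
  span_eq_top_of_hom_ext (R := Env K T) (M := Q K T n) {z | ∃ i j, j ≤ n ∧ z = gen K T n i j}
    fun f f' h => hom_ext_gen n f f' fun i j hj => h _ ⟨i, j, hj, rfl⟩

theorem Q_induction {n : ℕ} {P : Q K T n → Prop} (zero : P 0)
    (add : ∀ z z', P z → P z' → P (z + z'))
    (bi_gen : ∀ (a b : A K T) i j, j ≤ n → P (bi a (gen K T n i j : Q K T n) b)) (z : Q K T n) :
    P z := by
  have hz : z ∈ Submodule.span (Env K T) {z | ∃ i j, j ≤ n ∧ z = gen K T n i j} := by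
    rw [span_gen]; trivial
  have key : ∀ r : Env K T, P (r • z) := by
    induction hz using Submodule.span_induction with
    | mem z h =>
      obtain ⟨i, j, hj, rfl⟩ := h
      intro r
      induction r using TensorProduct.induction_on with
      | zero => exact (congrArg P (zero_smul (Env K T) (gen K T n i j))).mpr zero
      | tmul a b => exact bi_gen a b.unop i j hj
      | add r r' hr hr' => rw [add_smul]; exact add _ _ hr hr'
    | zero => intro r; rw [smul_zero]; exact zero
    | add z z' _ _ h h' => intro r; rw [smul_add]; exact add _ _ (h r) (h' r)
    | smul s z _ h => intro r; rw [smul_smul]; exact h _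
  rw [← one_smul (Env K T) z]
  exact key 1

theorem e_bi_gen (n : ℕ) (i : ZMod 4) (j : ℕ) (a b : A K T) :
    bi (a * e K T i) (gen K T n i j) (e K T (i + n) * b) = bi a (gen K T n i j) b := by
  rw [← bi_bi, show bi (e K T i) (gen K T n i j) (e K T (i + n)) = gen K T n i j from
    fixed_gen n i j]

/-- The additive map `a ⊗ b ↦ a q δ(b)` on `A_T ⊗ A_T`. -/
def leftTerm {M : Type*} [AddCommGroup M] [Module (Env K T) M] (q : M)
    (δ : A K T →ₗ[K] A K T) : Env K T →+ M :=
  TensorProduct.liftAddHom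
    { toFun := fun a =>
        { toFun := fun b => bi a q (δ b.unop)
          map_zero' := by rw [MulOpposite.unop_zero, map_zero, bi_zero_right]
          map_add' := fun b b' => by rw [MulOpposite.unop_add, map_add, bi_add_right] }
      map_zero' := by ext b; exact zero_bi _ q
      map_add' := fun a a' => by ext b; exact add_bi a a' _ q }
    (fun r a b => by
      change bi (r • a) q (δ b.unop) = bi a q (δ (r • b).unop)
      rw [MulOpposite.unop_smul, map_smul, smul_bi])

theorem leftTerm_tmul {M : Type*} [AddCommGroup M] [Module (Env K T) M] (q : M)
    (δ : A K T →ₗ[K] A K T) (a b : A K T) :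
    leftTerm q δ (a ⊗ₜ MulOpposite.op b) = bi a q (δ b) := rfl

/-- The additive map on `Q^n` (in general not a homomorphism of bimodules) which on the summand
generated by `𝔞^n_{i,j}` is the restriction of the map `ψ i j` on `A_T ⊗ A_T`. -/
def leftHom {M : Type*} [AddCommGroup M] (n : ℕ) (ψ : ZMod 4 → ℕ → Env K T →+ M) :
    Q K T n →+ M :=
  ∑ p : ZMod 4 × Fin (n + 1), (ψ p.1 p.2).comp
    ((Proj K T p.1 (p.1 + n)).subtype ∘ₗ LinearMap.proj p).toAddMonoidHom

theorem leftHom_bi_gen {M : Type*} [AddCommGroup M] (n : ℕ) (ψ : ZMod 4 → ℕ → Env K T →+ M)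
    (a b : A K T) (i : ZMod 4) {j : ℕ} (hj : j ≤ n) :
    leftHom n ψ (bi a (gen K T n i j) b) =
      ψ i j ((a * e K T i) ⊗ₜ MulOpposite.op (e K T (i + n) * b)) := by
  have h : j < n + 1 := Nat.lt_succ_of_le hj
  simp only [leftHom, gen, dif_pos h, bi, ← Pi.single_smul]
  rw [AddMonoidHom.finsetSum_apply, Finset.sum_eq_single (i, ⟨j, h⟩)]
  · simp
  · intro p _ hp
    simp [Pi.single_eq_of_ne hp]
  · simp

theorem leftHom_bi {M : Type*} [AddCommGroup M] [Module (Env K T) M] (n : ℕ)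
    (ψ : ZMod 4 → ℕ → Env K T →+ M)
    (hψ : ∀ i j a r, ψ i j ((a ⊗ₜ 1) * r) = bi a (ψ i j r) 1) (a : A K T) (z : Q K T n) :
    leftHom n ψ (bi a z 1) = bi a (leftHom n ψ z) 1 := by
  simp only [leftHom, AddMonoidHom.finsetSum_apply, bi, Finset.smul_sum]
  exact Finset.sum_congr rfl fun p _ => hψ _ _ a _

theorem leftTerm_mul {M : Type*} [AddCommGroup M] [Module (Env K T) M] (q : M)
    (δ : A K T →ₗ[K] A K T) (a : A K T) (r : Env K T) :
    leftTerm q δ ((a ⊗ₜ 1) * r) = bi a (leftTerm q δ r) 1 := by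
  induction r using TensorProduct.induction_on with
  | zero => rw [mul_zero, map_zero, bi_zero]
  | tmul b c =>
    rw [Algebra.TensorProduct.tmul_mul_tmul, one_mul, ← MulOpposite.op_unop c, leftTerm_tmul,
      leftTerm_tmul, bi_bi, mul_one]
  | add r r' hr hr' => rw [mul_add, map_add, map_add, bi_add, hr, hr']

end ProjectiveBimodules

/-! ### Contractions modulo the left radical -/

section Contraction

variable {K : Type u} [Field K] {T : ℕ}

/-- A complex `M₂ → M → M₀` of bimodules is exact at `M` if there are additive maps `h₁ : M → M₂`
and `h₀ : M₀ → M`, compatible with left multiplication, such that `ν = d₁ h₁ + h₀ d₀ - 1` maps `M`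
into the left radical `x M + y M`. Indeed `ν` then maps `x^k M + y^k M` into
`x^(k+1) M + y^(k+1) M`, and every cycle `z` is homologous to `-ν z`. -/
theorem exact_of_contraction {M₀ M M₂ : Type*} [AddCommGroup M₀] [Module (Env K T) M₀]
    [AddCommGroup M] [Module (Env K T) M]
    [AddCommGroup M₂] [Module (Env K T) M₂] (d₁ : M₂ →ₗ[Env K T] M)
    (d₀ : M →ₗ[Env K T] M₀) (hd : ∀ z, d₀ (d₁ z) = 0) (h₁ : M →+ M₂) (h₀ : M₀ →+ M)
    (hh₁ : ∀ (a : A K T) z, h₁ (bi a z 1) = bi a (h₁ z) 1)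
    (hh₀ : ∀ (a : A K T) z, h₀ (bi a z 1) = bi a (h₀ z) 1)
    (hν : ∀ z, d₁ (h₁ z) + h₀ (d₀ z) - z ∈ leftRad K T M 1) : Function.Exact d₁ d₀ := by
  have hadd (z z' : M) : d₁ (h₁ (z + z')) + h₀ (d₀ (z + z')) - (z + z') =
      (d₁ (h₁ z) + h₀ (d₀ z) - z) + (d₁ (h₁ z') + h₀ (d₀ z') - z') := by
    simp only [map_add]; abel
  have hbi (a : A K T) (z : M) : d₁ (h₁ (bi a z 1)) + h₀ (d₀ (bi a z 1)) - bi a z 1 =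
      bi a (d₁ (h₁ z) + h₀ (d₀ z) - z) 1 := by
    rw [hh₁, map_bi d₁, map_bi d₀, hh₀, bi_sub, bi_add]
  have hstep (k : ℕ) (z : M) (hz : z ∈ leftRad K T M k) :
      d₁ (h₁ z) + h₀ (d₀ z) - z ∈ leftRad K T M (k + 1) := by
    refine leftRad_induction (P := fun z => d₁ (h₁ z) + h₀ (d₀ z) - z ∈ leftRad K T _ (k + 1))
      (fun z z' hz hz' => ?_) (fun c q => ?_) hz
    · rw [hadd]; exact add_mem hz hz'
    · rw [hbi]; exact bi_letter_pow_mem_leftRad_succ c k (hν q)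
  have hcycle (k : ℕ) (hk : k ≤ 4 * T + 3) :
      ∀ z ∈ leftRad K T M k, d₀ z = 0 → z ∈ LinearMap.range d₁ := by
    induction hk using Nat.decreasingInduction with
    | self =>
      intro z hz _
      rw [leftRad_eq_bot, AddSubgroup.mem_bot] at hz
      exact hz ▸ zero_mem _
    | of_succ k hk ih =>
      intro z hz hdz
      have h := hstep k z hz
      rw [hdz, map_zero, add_zero] at h
      have h2 := ih _ h (by rw [map_sub, hdz, sub_zero, hd])
      simpa using sub_mem (LinearMap.mem_range_self d₁ (h₁ z)) h2
  intro z
  constructor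
  · intro hz
    exact hcycle 0 (Nat.zero_le _) z (by rw [leftRad_zero]; trivial) hz
  · rintro ⟨z, rfl⟩
    exact hd z

/-- An additive map on `Q^n` which commutes with left multiplication has values in the
left radical if it sends `𝔞 w` into the left radical for all generators `𝔞` and all powers `w` of a
letter. -/
theorem mem_leftRad_of_gen {n : ℕ} {M : Type*} [AddCommGroup M] [Module (Env K T) M]
    (ν : Q K T n → M) (hadd : ∀ z z', ν (z + z') = ν z + ν z')
    (hbi : ∀ (a : A K T) z, ν (bi a z 1) = bi a (ν z) 1)
    (hgen : ∀ i j c l, j ≤ n →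
      ν (bi (1 : A K T) (gen K T n i j) (letter K T c ^ l)) ∈ leftRad K T M 1) (z : Q K T n) :
    ν z ∈ leftRad K T M 1 := by
  have hzero : ν 0 = 0 := by
    have := hadd 0 0
    rw [add_zero] at this
    exact left_eq_add.1 this
  have hgen' (i : ZMod 4) (j : ℕ) (hj : j ≤ n) (b : A K T) :
      ν (bi 1 (gen K T n i j) b) ∈ leftRad K T M 1 := by
    induction b using A_induction with
    | zero => rw [bi_zero_right, hzero]; exact zero_mem _
    | add b b' hb hb' => rw [bi_add_right, hadd]; exact add_mem hb hb'
    | smul r b hb =>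
      have : bi 1 (gen K T n i j) (r • b) = bi (r • (1 : A K T)) (bi 1 (gen K T n i j) b) 1 := by
        rw [bi_bi, mul_one, mul_one, smul_bi]
      rw [this, hbi]
      exact bi_mem_leftRad _ _ hb
    | word t c l =>
      by_cases ht : i + n = t
      · subst ht
        have := e_bi_gen n i j 1 (e K T (i + n) * letter K T c ^ l)
        rw [← mul_assoc, e_mul_self, e_bi_gen] at this
        rw [← this]
        exact hgen i j c l hj
      · have : bi 1 (gen K T n i j) (e K T t * letter K T c ^ l) = 0 := by
          rw [← e_bi_gen, ← mul_assoc, e_mul_e_of_ne K T ht, zero_mul, bi_zero_right]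
        rw [this, hzero]; exact zero_mem _
  induction z using Q_induction with
  | zero => rw [hzero]; exact zero_mem _
  | add z z' hz hz' => rw [hadd]; exact add_mem hz hz'
  | bi_gen a b i j hj =>
    have : bi a (gen K T n i j) b = bi a (bi 1 (gen K T n i j) b) 1 := by
      rw [bi_bi, mul_one, mul_one]
    rw [this, hbi]
    exact bi_mem_leftRad _ _ (hgen' i j hj b)

end Contraction

/-! ### The formulas for the differential over a commutative ring of scalars -/

section Scalars

variable {R : Type*} [CommRing R] {M : Type*} [AddCommGroup M] [Module R M]

/-- The sum of the `u^(4s) w^(4T-4s)` for `0 ≤ s ≤ T`. -/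
def evenSum (T : ℕ) (u w : R) : R :=
  ∑ s ∈ Finset.range (T + 1), u ^ (4 * s) * w ^ (4 * T - 4 * s)

/-- The sum of the `u^(4s+2) w^(4T-4s-2)` for `0 ≤ s < T`. -/
def oddSum (T : ℕ) (u w : R) : R :=
  ∑ s ∈ Finset.range T, u ^ (4 * s + 2) * w ^ (4 * T - 4 * s - 2)

theorem sq_mul_evenSum_sub_right (T : ℕ) (u w : R) :
    w ^ 2 * evenSum T u w - u ^ 2 * oddSum T u w = w ^ (4 * T + 2) := by
  rw [evenSum, oddSum, Finset.sum_range_succ', mul_add, Finset.mul_sum, Finset.mul_sum,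
    add_sub_right_comm, ← Finset.sum_sub_distrib, Finset.sum_eq_zero]
  · rw [mul_zero, pow_zero, Nat.sub_zero, one_mul, zero_add, ← pow_add, add_comm]
  · intro s hs
    have hs := Finset.mem_range.1 hs
    obtain ⟨r, rfl⟩ := Nat.exists_eq_add_of_lt hs
    rw [show 4 * (s + r + 1) - 4 * (s + 1) = 4 * r by omega,
      show 4 * (s + r + 1) - 4 * s - 2 = 4 * r + 2 by omega]
    ring

theorem sq_mul_evenSum_sub_left (T : ℕ) (u w : R) :
    u ^ 2 * evenSum T u w - w ^ 2 * oddSum T u w = u ^ (4 * T + 2) := by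
  rw [evenSum, oddSum, Finset.sum_range_succ, mul_add, Finset.mul_sum, Finset.mul_sum,
    add_sub_right_comm, ← Finset.sum_sub_distrib, Finset.sum_eq_zero]
  · rw [Nat.sub_self, pow_zero, mul_one, zero_add, ← pow_add, add_comm]
  · intro s hs
    have hs := Finset.mem_range.1 hs
    obtain ⟨r, rfl⟩ := Nat.exists_eq_add_of_lt hs
    rw [show 4 * (s + r + 1) - 4 * s = 4 * r + 4 by omega,
      show 4 * r + 4 - 2 = 4 * r + 2 by omega]
    ring

theorem mul_evenSum_of_mul_eq_zero_left (T : ℕ) {u v : R} (w : R) (h : u * v = 0) :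
    v * evenSum T u w = v * w ^ (4 * T) := by
  rw [evenSum, Finset.sum_range_succ', mul_add, Finset.mul_sum, Finset.sum_eq_zero]
  · simp
  · intro s _
    rw [show 4 * (s + 1) = 4 * s + 3 + 1 by omega, pow_succ]
    linear_combination u ^ (4 * s + 3) * w ^ (4 * T - (4 * s + 3 + 1)) * h

theorem mul_evenSum_of_mul_eq_zero_right (T : ℕ) (u : R) {w v : R} (h : w * v = 0) :
    v * evenSum T u w = v * u ^ (4 * T) := by
  rw [evenSum, Finset.sum_range_succ, mul_add, Finset.mul_sum, Finset.sum_eq_zero]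
  · simp
  · intro s hs
    have hs := Finset.mem_range.1 hs
    rw [show 4 * T - 4 * s = 4 * T - 4 * s - 1 + 1 by omega, pow_succ]
    linear_combination u ^ (4 * s) * w ^ (4 * T - 4 * s - 1) * h

theorem mul_oddSum_of_mul_eq_zero_left (T : ℕ) {u v : R} (w : R) (h : u * v = 0) :
    v * oddSum T u w = 0 := by
  rw [oddSum, Finset.mul_sum]
  refine Finset.sum_eq_zero fun s _ => ?_
  rw [pow_succ]
  linear_combination u ^ (4 * s + 1) * w ^ (4 * T - 4 * s - 2) * h

theorem mul_oddSum_of_mul_eq_zero_right (T : ℕ) (u : R) {w v : R} (h : w * v = 0) :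
    v * oddSum T u w = 0 := by
  rw [oddSum, Finset.mul_sum]
  refine Finset.sum_eq_zero fun s hs => ?_
  have hs := Finset.mem_range.1 hs
  rw [show 4 * T - 4 * s - 2 = 4 * T - 4 * s - 3 + 1 by omega, pow_succ]
  linear_combination u ^ (4 * s + 2) * w ^ (4 * T - 4 * s - 3) * h

/-- The relations between the left letters `u, v` and the right letters `u', v'` acting on a
bimodule over `A_T`. -/
structure LetterRelations (T : ℕ) (u v u' v' : R) : Prop where
  left : u * v = 0
  right : u' * v' = 0
  left_pow : u ^ (4 * T + 2) + v ^ (4 * T + 2) = 0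
  right_pow : u' ^ (4 * T + 2) + v' ^ (4 * T + 2) = 0

/-- The formula for `∂^(2m+1)` in the range `j ≤ m`, with `a = 𝔞_i` and `b = 𝔞_{i+1}`. -/
def oddLow (T : ℕ) (u v u' v' : R) (a b : ℤ → M) (j : ℤ) : M :=
  v' ^ (4 * T + 1) • a (j - 1) + u' • a j - u • b j - v ^ (4 * T + 1) • b (j - 1)

/-- The formula for `∂^(2m+1)` in the range `m < j`. -/
def oddHigh (T : ℕ) (u v u' v' : R) (a b : ℤ → M) (j : ℤ) : M :=
  v' • a (j - 1) + u' ^ (4 * T + 1) • a j - u ^ (4 * T + 1) • b j - v • b (j - 1)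

/-- The formula for `∂^(2m)` in the range `j < m`. -/
def evenLow (T : ℕ) (u v u' v' : R) (a b : ℤ → M) (j : ℤ) : M :=
  u' ^ (4 * T + 1) • a (j - 1) + v' • a j + u • b j + v ^ (4 * T + 1) • b (j - 1)

/-- The formula for `∂^(2m)` in the range `m < j`. -/
def evenHigh (T : ℕ) (u v u' v' : R) (a b : ℤ → M) (j : ℤ) : M :=
  u' • a (j - 1) + v' ^ (4 * T + 1) • a j + u ^ (4 * T + 1) • b j + v • b (j - 1)

/-- The formula for `∂^(2m)` at `j = m`, with `a, b, c, d = 𝔞_i, 𝔞_{i+1}, 𝔞_{i+2}, 𝔞_{i+3}`. -/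
def evenMid (T : ℕ) (u v u' v' : R) (a b c d : ℤ → M) (j : ℤ) : M :=
  evenSum T u u' • (u' • a (j - 1) + u • b j) + oddSum T u u' • (u' • c (j - 1) + u • d j) +
    evenSum T v v' • (v' • a j + v • b (j - 1)) + oddSum T v v' • (v' • c j + v • d (j - 1))

variable {T : ℕ} {u v u' v' : R}

/-! Two consecutive formulas compose to zero, for each position of `j` relative to the middle. The
coefficient of every generator in the composite is a multiple of one of the relations between the
letters, or of an identity for `evenSum` and `oddSum`, and the coefficients of the linear
combinations below are these multiples. -/

theorem odd_comp_low (h : LetterRelations T u v u' v') (a b c : ℤ → M) (j : ℤ) :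
    v' ^ (4 * T + 1) • evenLow T u v u' v' a b (j - 1) + u' • evenLow T u v u' v' a b j
      - u • evenLow T v u v' u' b c j - v ^ (4 * T + 1) • evenLow T v u v' u' b c (j - 1) = 0 := by
  unfold evenLow
  linear_combination (norm := module) (u' ^ (4 * T) * v' ^ (4 * T) * h.right) • a (j - 1 - 1) +
    h.right_pow • a (j - 1) + h.right • a j - h.left • c j - h.left_pow • c (j - 1) -
    (u ^ (4 * T) * v ^ (4 * T) * h.left) • c (j - 1 - 1)

theorem odd_comp_mid (h : LetterRelations T u v u' v') (a b c d : ℤ → M) (j : ℤ) :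
    v' ^ (4 * T + 1) • evenLow T u v u' v' a b (j - 1) + u' • evenMid T u v u' v' a b c d j
      - u • evenMid T v u v' u' b c d a j
      - v ^ (4 * T + 1) • evenLow T v u v' u' b c (j - 1) = 0 := by
  have hr := mul_comm v' u' ▸ h.right
  have hl := mul_comm v u ▸ h.left
  have p1 := sq_mul_evenSum_sub_right T u u'
  have p2 := sq_mul_evenSum_sub_left T u u'
  have r1 := mul_evenSum_of_mul_eq_zero_right T v (w := v') (v := u') (mul_comm u' v' ▸ h.right)
  have r2 := mul_evenSum_of_mul_eq_zero_left T (u := v) (v := u) v' (mul_comm u v ▸ h.left)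
  have s1 := mul_oddSum_of_mul_eq_zero_right T v (w := v') (v := u') (mul_comm u' v' ▸ h.right)
  have s2 := mul_oddSum_of_mul_eq_zero_left T (u := v) (v := u) v' (mul_comm u v ▸ h.left)
  unfold evenLow evenMid
  linear_combination (norm := module) (u' ^ (4 * T) * v' ^ (4 * T) * h.right) • a (j - 1 - 1) +
    (h.right_pow + p1) • a (j - 1) +
    (evenSum T v v' * h.right - oddSum T v v' * h.left) • a j +
    (v * r1 - v' * r2) • b (j - 1) - (p2 + h.left_pow) • c (j - 1) +
    (oddSum T v v' * h.right - evenSum T v v' * h.left) • c j +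
    (v * s1 - v' * s2) • d (j - 1) - (u ^ (4 * T) * v ^ (4 * T) * h.left) • c (j - 1 - 1)

theorem odd_comp_mid_succ (h : LetterRelations T u v u' v') (a b c d : ℤ → M) (j : ℤ) :
    v' • evenMid T u v u' v' a b c d (j - 1) + u' ^ (4 * T + 1) • evenHigh T u v u' v' a b j
      - u ^ (4 * T + 1) • evenHigh T v u v' u' b c j
      - v • evenMid T v u v' u' b c d a (j - 1) = 0 := by
  have p1 := sq_mul_evenSum_sub_right T v v'
  have p2 := sq_mul_evenSum_sub_left T v v'
  have r1 := mul_evenSum_of_mul_eq_zero_right T u h.right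
  have r2 := mul_evenSum_of_mul_eq_zero_left T u' h.left
  have s1 := mul_oddSum_of_mul_eq_zero_right T u h.right
  have s2 := mul_oddSum_of_mul_eq_zero_left T u' h.left
  unfold evenHigh evenMid
  linear_combination (norm := module)
    (evenSum T u u' * h.right - oddSum T u u' * h.left) • a (j - 1 - 1) +
    (h.right_pow + p1) • a (j - 1) + (u' ^ (4 * T) * v' ^ (4 * T) * h.right) • a j +
    (u * r1 - u' * r2) • b (j - 1) - (p2 + h.left_pow) • c (j - 1) +
    (oddSum T u u' * h.right - evenSum T u u' * h.left) • c (j - 1 - 1) +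
    (u * s1 - u' * s2) • d (j - 1) - (u ^ (4 * T) * v ^ (4 * T) * h.left) • c j

theorem odd_comp_high (h : LetterRelations T u v u' v') (a b c : ℤ → M) (j : ℤ) :
    v' • evenHigh T u v u' v' a b (j - 1) + u' ^ (4 * T + 1) • evenHigh T u v u' v' a b j
      - u ^ (4 * T + 1) • evenHigh T v u v' u' b c j
      - v • evenHigh T v u v' u' b c (j - 1) = 0 := by
  unfold evenHigh
  linear_combination (norm := module) (u' ^ (4 * T) * v' ^ (4 * T) * h.right) • a j +
    h.right_pow • a (j - 1) + h.right • a (j - 1 - 1) - h.left • c (j - 1 - 1) -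
    h.left_pow • c (j - 1) - (u ^ (4 * T) * v ^ (4 * T) * h.left) • c j

theorem even_comp_low (h : LetterRelations T u v u' v') (a b c : ℤ → M) (j : ℤ) :
    u' ^ (4 * T + 1) • oddLow T u v u' v' a b (j - 1) + v' • oddLow T u v u' v' a b j
      + u • oddLow T v u v' u' b c j + v ^ (4 * T + 1) • oddLow T v u v' u' b c (j - 1) = 0 := by
  unfold oddLow
  linear_combination (norm := module) (u' ^ (4 * T) * v' ^ (4 * T) * h.right) • a (j - 1 - 1) +
    h.right_pow • a (j - 1) + h.right • a j - h.left • c j - h.left_pow • c (j - 1) -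
    (u ^ (4 * T) * v ^ (4 * T) * h.left) • c (j - 1 - 1)

theorem even_comp_high (h : LetterRelations T u v u' v') (a b c : ℤ → M) (j : ℤ) :
    u' • oddHigh T u v u' v' a b (j - 1) + v' ^ (4 * T + 1) • oddHigh T u v u' v' a b j
      + u ^ (4 * T + 1) • oddHigh T v u v' u' b c j
      + v • oddHigh T v u v' u' b c (j - 1) = 0 := by
  unfold oddHigh
  linear_combination (norm := module) (u' ^ (4 * T) * v' ^ (4 * T) * h.right) • a j +
    h.right_pow • a (j - 1) + h.right • a (j - 1 - 1) - h.left • c (j - 1 - 1) -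
    h.left_pow • c (j - 1) - (u ^ (4 * T) * v ^ (4 * T) * h.left) • c j

theorem even_comp_mid (h : LetterRelations T u v u' v') (a b c d : ℤ → M) (j : ℤ) :
    evenSum T u u' • (u' • oddLow T u v u' v' a b (j - 1) + u • oddHigh T v u v' u' b c j) +
      oddSum T u u' • (u' • oddLow T u v u' v' c d (j - 1) + u • oddHigh T v u v' u' d a j) +
      evenSum T v v' • (v' • oddHigh T u v u' v' a b j + v • oddLow T v u v' u' b c (j - 1)) +
      oddSum T v v' • (v' • oddHigh T u v u' v' c d j + v • oddLow T v u v' u' d a (j - 1)) =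
      0 := by
  have hr : v' * u' = 0 := by rw [mul_comm, h.right]
  have hl : v * u = 0 := by rw [mul_comm, h.left]
  have pu1 := sq_mul_evenSum_sub_right T u u'
  have pu2 := sq_mul_evenSum_sub_left T u u'
  have pv1 := sq_mul_evenSum_sub_right T v v'
  have pv2 := sq_mul_evenSum_sub_left T v v'
  have ru1 := mul_evenSum_of_mul_eq_zero_right T u h.right
  have ru2 := mul_evenSum_of_mul_eq_zero_left T u' h.left
  have su1 := mul_oddSum_of_mul_eq_zero_right T u h.right
  have su2 := mul_oddSum_of_mul_eq_zero_left T u' h.left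
  have rv1 := mul_evenSum_of_mul_eq_zero_right T v hr
  have rv2 := mul_evenSum_of_mul_eq_zero_left T v' hl
  have sv1 := mul_oddSum_of_mul_eq_zero_right T v hr
  have sv2 := mul_oddSum_of_mul_eq_zero_left T v' hl
  unfold oddLow oddHigh
  linear_combination (norm := module) (pu1 + pv1 + h.right_pow) • a (j - 1) -
    (pu2 + pv2 + h.left_pow) • c (j - 1) +
    (evenSum T u u' * v' ^ (4 * T) * h.right - oddSum T v v' * u ^ (4 * T) * h.left) •
      a (j - 1 - 1) +
    (evenSum T v v' * u' ^ (4 * T) * h.right - oddSum T u u' * v ^ (4 * T) * h.left) • a j +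
    (-u' * v ^ (4 * T) * ru2 + v * u' ^ (4 * T) * rv1) • b (j - 1 - 1) +
    (u * v' ^ (4 * T) * ru1 - v' * u ^ (4 * T) * rv2) • b j +
    (oddSum T v v' * u' ^ (4 * T) * h.right - evenSum T u u' * v ^ (4 * T) * h.left) • c j +
    (oddSum T u u' * v' ^ (4 * T) * h.right - evenSum T v v' * u ^ (4 * T) * h.left) •
      c (j - 1 - 1) +
    (-u' * v ^ (4 * T) * su2 + v * u' ^ (4 * T) * sv1) • d (j - 1 - 1) +
    (u * v' ^ (4 * T) * su1 - v' * u ^ (4 * T) * sv2) • d j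

end Scalars

/-! ### The commutative ring of letters acting on bimodules -/

section LetterRing

variable (K : Type u) [Field K] (T : ℕ)

/-- The elements `x ⊗ 1`, `y ⊗ 1`, `1 ⊗ x`, `1 ⊗ y` of the enveloping algebra. -/
def envLetters : Set (Env K T) :=
  {z | (∃ c, z = letter K T c ⊗ₜ 1) ∨ ∃ c, z = 1 ⊗ₜ MulOpposite.op (letter K T c)}

theorem letter_mul_comm (c c' : Bool) :
    letter K T c * letter K T c' = letter K T c' * letter K T c := by
  by_cases h : c = c'
  · rw [h]
  · rw [letter_mul_letter_of_ne h, letter_mul_letter_of_ne (Ne.symm h)]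

theorem envLetters_comm : ∀ a ∈ envLetters K T, ∀ b ∈ envLetters K T, a * b = b * a := by
  rintro _ (⟨c, rfl⟩ | ⟨c, rfl⟩) _ (⟨c', rfl⟩ | ⟨c', rfl⟩) <;>
    simp only [Algebra.TensorProduct.tmul_mul_tmul, ← MulOpposite.op_mul, one_mul, mul_one,
      letter_mul_comm K T c c']

/-- The subring of the enveloping algebra generated by the left and the right letters. It is
commutative because `xy = yx = 0` in `A_T`. -/
def LetterRing : Type u := Algebra.adjoin K (envLetters K T)

open scoped IsMulCommutative in
instance : CommRing (LetterRing K T) :=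
  have := Algebra.isMulCommutative_adjoin K (envLetters_comm K T)
  inferInstanceAs (CommRing (Algebra.adjoin K (envLetters K T)))

/-- The inclusion of the commutative ring of letters into the enveloping algebra. -/
def LetterRing.toEnv : LetterRing K T →+* Env K T :=
  (Algebra.adjoin K (envLetters K T)).subtype

theorem LetterRing.toEnv_injective : Function.Injective (LetterRing.toEnv K T) :=
  Subtype.val_injective

instance {M : Type*} [AddCommGroup M] [Module (Env K T) M] : Module (LetterRing K T) M :=
  Module.compHom M (LetterRing.toEnv K T)

/-- Left multiplication by a letter. -/
def leftLetter (c : Bool) : LetterRing K T :=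
  ⟨letter K T c ⊗ₜ 1, Algebra.subset_adjoin (Or.inl ⟨c, rfl⟩)⟩

/-- Right multiplication by a letter. -/
def rightLetter (c : Bool) : LetterRing K T :=
  ⟨1 ⊗ₜ MulOpposite.op (letter K T c), Algebra.subset_adjoin (Or.inr ⟨c, rfl⟩)⟩

theorem toEnv_leftLetter_pow (c : Bool) (k : ℕ) :
    LetterRing.toEnv K T (leftLetter K T c ^ k) = (letter K T c ^ k) ⊗ₜ 1 := by
  rw [map_pow]
  change (letter K T c ⊗ₜ 1 : Env K T) ^ k = _
  rw [Algebra.TensorProduct.tmul_pow, one_pow]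

theorem toEnv_rightLetter_pow (c : Bool) (k : ℕ) :
    LetterRing.toEnv K T (rightLetter K T c ^ k) = 1 ⊗ₜ MulOpposite.op (letter K T c ^ k) := by
  rw [map_pow]
  change (1 ⊗ₜ MulOpposite.op (letter K T c) : Env K T) ^ k = _
  rw [Algebra.TensorProduct.tmul_pow, one_pow, MulOpposite.op_pow]

theorem letterRelations (c : Bool) :
    LetterRelations T (leftLetter K T c) (leftLetter K T (!c)) (rightLetter K T c)
      (rightLetter K T (!c)) where
  left := by
    apply LetterRing.toEnv_injective
    rw [map_mul, map_zero, ← pow_one (leftLetter K T c), ← pow_one (leftLetter K T (!c)),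
      toEnv_leftLetter_pow, toEnv_leftLetter_pow, Algebra.TensorProduct.tmul_mul_tmul, pow_one,
      pow_one, letter_mul_letter_not, zero_tmul]
  right := by
    apply LetterRing.toEnv_injective
    rw [map_mul, map_zero, ← pow_one (rightLetter K T c), ← pow_one (rightLetter K T (!c)),
      toEnv_rightLetter_pow, toEnv_rightLetter_pow, Algebra.TensorProduct.tmul_mul_tmul, pow_one,
      pow_one, ← MulOpposite.op_mul, letter_mul_comm, letter_mul_letter_not, MulOpposite.op_zero,
      tmul_zero]
  left_pow := by
    apply LetterRing.toEnv_injective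
    rw [map_add, map_zero, toEnv_leftLetter_pow, toEnv_leftLetter_pow, ← add_tmul,
      letter_pow_add_letter_pow, zero_tmul]
  right_pow := by
    apply LetterRing.toEnv_injective
    rw [map_add, map_zero, toEnv_rightLetter_pow, toEnv_rightLetter_pow, ← tmul_add,
      ← MulOpposite.op_add, letter_pow_add_letter_pow, MulOpposite.op_zero, tmul_zero]

variable {K T} {M : Type*} [AddCommGroup M] [Module (Env K T) M]

theorem letterRing_smul_def (r : LetterRing K T) (z : M) :
    r • z = LetterRing.toEnv K T r • z := rfl

theorem bi_letter_pow (c c' : Bool) (k l : ℕ) (z : M) :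
    bi (letter K T c ^ k) z (letter K T c' ^ l) =
      (leftLetter K T c ^ k * rightLetter K T c' ^ l) • z := by
  rw [letterRing_smul_def, map_mul, toEnv_leftLetter_pow, toEnv_rightLetter_pow,
    Algebra.TensorProduct.tmul_mul_tmul, one_mul, mul_one]
  rfl

theorem bi_one_letter_pow (c : Bool) (k : ℕ) (z : M) :
    bi 1 z (letter K T c ^ k) = rightLetter K T c ^ k • z := by
  simpa using bi_letter_pow c c 0 k z

theorem bi_letter_pow_one (c : Bool) (k : ℕ) (z : M) :
    bi (letter K T c ^ k) z 1 = leftLetter K T c ^ k • z := by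
  simpa using bi_letter_pow c c k 0 z

theorem bi_one_letter (c : Bool) (z : M) : bi 1 z (letter K T c) = rightLetter K T c • z := by
  simpa using bi_one_letter_pow c 1 z

theorem bi_letter_one (c : Bool) (z : M) : bi (letter K T c) z 1 = leftLetter K T c • z := by
  simpa using bi_letter_pow_one c 1 z

theorem map_letterRing_smul {M' : Type*} [AddCommGroup M'] [Module (Env K T) M']
    (f : M →ₗ[Env K T] M') (r : LetterRing K T) (z : M) : f (r • z) = r • f z :=
  map_smul f (LetterRing.toEnv K T r) z

end LetterRing

/-! ### The differentials in terms of the letters -/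

section Differential

variable {K : Type u} [Field K] {T : ℕ}

/-- Whether `u = x` at the vertex `i`. -/
def parity (i : ZMod 4) : Bool := decide (i = 0 ∨ i = 2)

theorem parity_add_one (i : ZMod 4) : parity (i + 1) = !parity i := by
  revert i; decide

/-- The extension by zero of a family indexed by natural numbers to the integers. -/
def extendZero {M : Type*} [AddCommGroup M] (α : ℕ → M) (j : ℤ) : M :=
  if 0 ≤ j then α j.toNat else 0

theorem extendZero_natCast {M : Type*} [AddCommGroup M] (α : ℕ → M) (j : ℕ) :
    extendZero α j = α j := by
  rw [extendZero, if_pos (by omega), Int.toNat_natCast]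

theorem extendZero_of_neg {M : Type*} [AddCommGroup M] (α : ℕ → M) {j : ℤ} (hj : j < 0) :
    extendZero α j = 0 := by
  rw [extendZero, if_neg (by omega)]

theorem extendZero_of_notMem {M : Type*} [AddCommGroup M] {α : ℕ → M} {n : ℕ}
    (hα : ∀ j, n < j → α j = 0) {j : ℤ} (hj : j < 0 ∨ n < j) : extendZero α j = 0 := by
  rcases hj with hj | hj
  · exact extendZero_of_neg _ hj
  · obtain ⟨j, rfl⟩ := Int.eq_ofNat_of_zero_le (by omega : 0 ≤ j)
    rw [extendZero_natCast, hα j (by omega)]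

variable {M : Type*} [AddCommGroup M] [Module (Env K T) M]

variable (K T) in
/-- The value of `∂^(2m+1)` on `𝔞_{i,j}`, for all integers `j`, in terms of the generators `α` of
`Q^(2m)`, which are taken to be zero for `j < 0` and for `j > 2m`. -/
def oddDiff (m : ℕ) (α : ZMod 4 → ℤ → M) (i : ZMod 4) (j : ℤ) : M :=
  if j ≤ m then
    oddLow T (leftLetter K T (parity i)) (leftLetter K T (!parity i))
      (rightLetter K T (parity i)) (rightLetter K T (!parity i)) (α i) (α (i + 1)) j
  else
    oddHigh T (leftLetter K T (parity i)) (leftLetter K T (!parity i))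
      (rightLetter K T (parity i)) (rightLetter K T (!parity i)) (α i) (α (i + 1)) j

variable (K T) in
/-- The value of `∂^(2m)` on `𝔞_{i,j}`, for all integers `j`, in terms of the generators `α` of
`Q^(2m-1)`, which are taken to be zero for `j < 0` and for `j > 2m - 1`. -/
def evenDiff (m : ℕ) (α : ZMod 4 → ℤ → M) (i : ZMod 4) (j : ℤ) : M :=
  if j < m then
    evenLow T (leftLetter K T (parity i)) (leftLetter K T (!parity i))
      (rightLetter K T (parity i)) (rightLetter K T (!parity i)) (α i) (α (i + 1)) j
  else if j = m then
    evenMid T (leftLetter K T (parity i)) (leftLetter K T (!parity i))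
      (rightLetter K T (parity i)) (rightLetter K T (!parity i))
      (α i) (α (i + 1)) (α (i + 2)) (α (i + 3)) j
  else
    evenHigh T (leftLetter K T (parity i)) (leftLetter K T (!parity i))
      (rightLetter K T (parity i)) (rightLetter K T (!parity i)) (α i) (α (i + 1)) j

/-- With generators outside the range set to zero, the boundary cases `j = 0` and `j = 2m + 1` of
the formula for `∂^(2m+1)` are instances of the generic ones. -/
theorem dFormula_odd (m : ℕ) (α : ZMod 4 → ℕ → M) (hα : ∀ i j, 2 * m < j → α i j = 0)
    (i : ZMod 4) (j : ℕ) (hj : j ≤ 2 * m + 1) :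
    dFormula (letter K T (parity i)) (letter K T (!parity i)) (2 * m + 1) α i j =
      oddDiff K T m (fun i => extendZero (α i)) i j := by
  unfold dFormula
  have h2 : (2 * m + 1) / 2 = m := by omega
  have h3 : (2 * m + 1) % 2 = 1 := by omega
  simp only [h2, h3, if_true, bi_one_letter_pow, bi_letter_pow_one, bi_one_letter, bi_letter_one]
  rcases Nat.eq_zero_or_pos j with rfl | hj0
  · rw [if_pos rfl, oddDiff, if_pos (by omega), oddLow,
      extendZero_of_neg (α i) (j := ((0 : ℕ) : ℤ) - 1) (by simp),
      extendZero_of_neg (α (i + 1)) (j := ((0 : ℕ) : ℤ) - 1) (by simp),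
      extendZero_natCast, extendZero_natCast]
    simp only [smul_zero, zero_add, sub_zero]
  have hpred : ((j : ℤ) - 1) = ((j - 1 : ℕ) : ℤ) := by omega
  rw [if_neg (by omega), oddDiff, oddLow, oddHigh, hpred]
  simp only [extendZero_natCast, Nat.cast_le]
  split_ifs with h4 h5
  · rfl
  · rfl
  · obtain rfl : j = 2 * m + 1 := by omega
    rw [hα i (2 * m + 1) (by omega), hα (i + 1) (2 * m + 1) (by omega)]
    simp only [Nat.add_sub_cancel, smul_zero, add_zero, sub_zero]

/-- With generators outside the range set to zero, the boundary cases `j = 0` and `j = 2m` of the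
formula for `∂^(2m)` are instances of the generic ones. -/
theorem dFormula_even (m : ℕ) (hm : 1 ≤ m) (α : ZMod 4 → ℕ → M)
    (hα : ∀ i j, 2 * m ≤ j → α i j = 0) (i : ZMod 4) (j : ℕ) (hj : j ≤ 2 * m) :
    dFormula (letter K T (parity i)) (letter K T (!parity i)) (2 * m) α i j =
      evenDiff K T m (fun i => extendZero (α i)) i j := by
  unfold dFormula
  have h2 : (2 * m) / 2 = m := by omega
  have h3 : (2 * m) % 2 ≠ 1 := by omega
  simp only [h2, if_neg h3, bi_one_letter_pow, bi_letter_pow_one, bi_one_letter, bi_letter_one,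
    bi_letter_pow]
  rcases Nat.eq_zero_or_pos j with rfl | hj0
  · rw [if_pos rfl, evenDiff, if_pos (by omega), evenLow,
      extendZero_of_neg (α i) (j := ((0 : ℕ) : ℤ) - 1) (by simp),
      extendZero_of_neg (α (i + 1)) (j := ((0 : ℕ) : ℤ) - 1) (by simp),
      extendZero_natCast, extendZero_natCast]
    simp only [smul_zero, zero_add, add_zero]
  have hpred : ((j : ℤ) - 1) = ((j - 1 : ℕ) : ℤ) := by omega
  rw [if_neg (by omega), evenDiff, evenLow, evenMid, evenHigh, hpred]
  simp only [extendZero_natCast, Nat.cast_lt, Nat.cast_inj]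
  by_cases h4 : j ≤ m - 1
  · rw [if_pos h4, if_pos (by omega)]
  rw [if_neg h4, if_neg (by omega : ¬ j < m)]
  by_cases h5 : j = m
  · subst h5
    rw [if_pos rfl, if_pos rfl]
    simp only [evenSum, oddSum, Finset.sum_smul]
  rw [if_neg h5, if_neg h5]
  split_ifs with h6
  · rfl
  · obtain rfl : j = 2 * m := by omega
    rw [hα i (2 * m) (by omega), hα (i + 1) (2 * m) (by omega)]
    simp only [smul_zero, add_zero]

theorem oddDiff_of_notMem {m : ℕ} {α : ZMod 4 → ℤ → M}
    (hα : ∀ i (j : ℤ), j < 0 ∨ 2 * m < j → α i j = 0) (i : ZMod 4) {j : ℤ}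
    (hj : j < 0 ∨ 2 * m + 1 < j) : oddDiff K T m α i j = 0 := by
  unfold oddDiff oddLow oddHigh
  rw [hα i j (by omega), hα i (j - 1) (by omega), hα (i + 1) j (by omega),
    hα (i + 1) (j - 1) (by omega)]
  simp only [smul_zero, add_zero, sub_zero, ite_self]

theorem evenDiff_of_notMem {m : ℕ} {α : ZMod 4 → ℤ → M}
    (hα : ∀ i (j : ℤ), j < 0 ∨ 2 * m ≤ j → α i j = 0) (i : ZMod 4) {j : ℤ}
    (hj : j < 0 ∨ 2 * m < j) : evenDiff K T m α i j = 0 := by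
  unfold evenDiff evenLow evenMid evenHigh
  rw [hα i j (by omega), hα i (j - 1) (by omega), hα (i + 1) j (by omega),
    hα (i + 1) (j - 1) (by omega), hα (i + 2) j (by omega), hα (i + 2) (j - 1) (by omega),
    hα (i + 3) j (by omega), hα (i + 3) (j - 1) (by omega)]
  simp only [smul_zero, add_zero, ite_self]

variable (K T) in
/-- The generator `𝔞^n_{i,j}`, with the convention that it is zero for `j < 0` and `j > n`. -/
def genZ (n : ℕ) (i : ZMod 4) : ℤ → Q K T n := extendZero (gen K T n i)

theorem genZ_natCast (n : ℕ) (i : ZMod 4) (j : ℕ) : genZ K T n i j = gen K T n i j :=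
  extendZero_natCast _ _

theorem gen_of_lt {n : ℕ} (i : ZMod 4) {j : ℕ} (hj : n < j) : gen K T n i j = 0 := by
  rw [gen, dif_neg (by omega)]

theorem dVal_eq (n : ℕ) (i : ZMod 4) (j : ℕ) :
    dVal K T n i j =
      dFormula (letter K T (parity i)) (letter K T (!parity i)) (n + 1) (gen K T n) i j := by
  unfold dVal parity
  split_ifs with h <;> simp [h, letter]

theorem map_extendZero_odd {M' : Type*} [AddCommGroup M'] [Module (Env K T) M']
    (f : M →ₗ[Env K T] M') (m : ℕ) (γ : ZMod 4 → ℕ → M) (α : ZMod 4 → ℕ → M')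
    (hγ : ∀ i j, 2 * m + 1 < j → γ i j = 0) (hα : ∀ i j, 2 * m < j → α i j = 0)
    (hf : ∀ i j, j ≤ 2 * m + 1 → f (γ i j) =
      dFormula (letter K T (parity i)) (letter K T (!parity i)) (2 * m + 1) α i j)
    (i : ZMod 4) (j : ℤ) :
    f (extendZero (γ i) j) = oddDiff K T m (fun i => extendZero (α i)) i j := by
  rcases lt_or_ge j 0 with hj | hj
  · rw [oddDiff_of_notMem (fun i j hj => extendZero_of_notMem (hα i) (by push_cast; omega)) i
      (Or.inl hj), extendZero_of_neg _ hj, map_zero]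
  obtain ⟨j, rfl⟩ := Int.eq_ofNat_of_zero_le hj
  rw [extendZero_natCast]
  rcases le_or_gt j (2 * m + 1) with hj | hj
  · rw [hf i j hj, dFormula_odd m α hα i j hj]
  · rw [oddDiff_of_notMem (fun i j hj => extendZero_of_notMem (hα i) (by push_cast; omega)) i
      (by omega), hγ i j hj, map_zero]

theorem map_extendZero_even {M' : Type*} [AddCommGroup M'] [Module (Env K T) M']
    (f : M →ₗ[Env K T] M') (m : ℕ) (hm : 1 ≤ m) (γ : ZMod 4 → ℕ → M) (α : ZMod 4 → ℕ → M')
    (hγ : ∀ i j, 2 * m < j → γ i j = 0) (hα : ∀ i j, 2 * m - 1 < j → α i j = 0)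
    (hf : ∀ i j, j ≤ 2 * m → f (γ i j) =
      dFormula (letter K T (parity i)) (letter K T (!parity i)) (2 * m) α i j)
    (i : ZMod 4) (j : ℤ) :
    f (extendZero (γ i) j) = evenDiff K T m (fun i => extendZero (α i)) i j := by
  rcases lt_or_ge j 0 with hj | hj
  · rw [evenDiff_of_notMem (fun i j hj => extendZero_of_notMem (hα i) (by omega)) i
      (Or.inl hj), extendZero_of_neg _ hj, map_zero]
  obtain ⟨j, rfl⟩ := Int.eq_ofNat_of_zero_le hj
  rw [extendZero_natCast]
  rcases le_or_gt j (2 * m) with hj | hj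
  · rw [hf i j hj, dFormula_even m hm α (fun i j hj => hα i j (by omega)) i j hj]
  · rw [evenDiff_of_notMem (fun i j hj => extendZero_of_notMem (hα i) (by omega)) i
      (by omega), hγ i j hj, map_zero]

theorem d_genZ_odd (m : ℕ) (i : ZMod 4) (j : ℤ) :
    d K T (2 * m) (genZ K T (2 * m + 1) i j) = oddDiff K T m (genZ K T (2 * m)) i j :=
  map_extendZero_odd (M := Q K T (2 * m + 1)) (M' := Q K T (2 * m)) (d K T (2 * m)) m
    (gen K T (2 * m + 1)) (gen K T (2 * m)) (fun i _ hj => gen_of_lt i hj)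
    (fun i _ hj => gen_of_lt i hj)
    (fun i j hj => (d_gen K T (2 * m) i j hj).trans (dVal_eq (2 * m) i j)) i j

theorem d_genZ_even (m : ℕ) (i : ZMod 4) (j : ℤ) :
    d K T (2 * m + 1) (genZ K T (2 * m + 2) i j) =
      evenDiff K T (m + 1) (genZ K T (2 * m + 1)) i j :=
  map_extendZero_even (M := Q K T (2 * m + 2)) (M' := Q K T (2 * m + 1)) (d K T (2 * m + 1))
    (m + 1) (by omega) (gen K T (2 * m + 2)) (gen K T (2 * m + 1))
    (fun i _ hj => gen_of_lt i (by omega)) (fun i _ hj => gen_of_lt i (by omega))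
    (fun i j hj => (d_gen K T (2 * m + 1) i j hj).trans (dVal_eq (2 * m + 1) i j)) i j

/-! ### The composition of two differentials -/

theorem parity_add_two (i : ZMod 4) : parity (i + 2) = parity i := by
  revert i; decide

theorem parity_add_three (i : ZMod 4) : parity (i + 3) = !parity i := by
  revert i; decide

theorem map_oddDiff {M' : Type*} [AddCommGroup M'] [Module (Env K T) M'] (f : M →ₗ[Env K T] M')
    (m : ℕ) (α : ZMod 4 → ℤ → M) (i : ZMod 4) (j : ℤ) :
    f (oddDiff K T m α i j) = oddDiff K T m (fun i j => f (α i j)) i j := by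
  unfold oddDiff oddLow oddHigh
  split_ifs <;> simp only [map_add, map_sub, map_letterRing_smul]

theorem map_evenDiff {M' : Type*} [AddCommGroup M'] [Module (Env K T) M'] (f : M →ₗ[Env K T] M')
    (m : ℕ) (α : ZMod 4 → ℤ → M) (i : ZMod 4) (j : ℤ) :
    f (evenDiff K T m α i j) = evenDiff K T m (fun i j => f (α i j)) i j := by
  unfold evenDiff evenLow evenMid evenHigh
  split_ifs <;> simp only [map_add, map_letterRing_smul]

theorem oddDiff_evenDiff (m : ℕ) (α : ZMod 4 → ℤ → M) (i : ZMod 4) (j : ℤ) :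
    oddDiff K T m (evenDiff K T m α) i j = 0 := by
  have h4 : (4 : ZMod 4) = 0 := rfl
  have e2 : i + 1 + 1 = i + 2 := by ring
  have e3 : i + 1 + 2 = i + 3 := by ring
  have e4 : i + 1 + 3 = i := by rw [add_assoc, show (1 : ZMod 4) + 3 = 0 from rfl, add_zero]
  have h := letterRelations K T (parity i)
  unfold oddDiff oddLow oddHigh evenDiff
  simp only [parity_add_one, Bool.not_not, e2, e3, e4]
  rcases lt_trichotomy j m with hj | rfl | hj
  · rw [if_pos hj.le, if_pos hj, if_pos hj, if_pos (by omega), if_pos (by omega)]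
    exact odd_comp_low h _ _ _ _
  · rw [if_pos le_rfl, if_neg (lt_irrefl _), if_pos rfl, if_neg (lt_irrefl _), if_pos rfl,
      if_pos (by omega), if_pos (by omega)]
    exact odd_comp_mid h _ _ _ _ _
  · by_cases hj' : j - 1 = m
    · simp only [hj.not_ge, hj.not_gt, hj.ne', hj', lt_irrefl, if_true, if_false]
      rw [← hj']
      exact odd_comp_mid_succ h _ _ _ _ _
    · simp only [hj.not_ge, hj.not_gt, hj.ne', hj', show ¬ j - 1 < m by omega, if_false]
      exact odd_comp_high h _ _ _ _

theorem evenDiff_oddDiff (m : ℕ) (α : ZMod 4 → ℤ → M) (i : ZMod 4) (j : ℤ) :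
    evenDiff K T (m + 1) (oddDiff K T m α) i j = 0 := by
  have e2 : i + 1 + 1 = i + 2 := by ring
  have e3 : i + 2 + 1 = i + 3 := by ring
  have e4 : i + 3 + 1 = i := by rw [add_assoc, show (3 : ZMod 4) + 1 = 0 from rfl, add_zero]
  have h := letterRelations K T (parity i)
  unfold evenDiff evenLow evenMid evenHigh oddDiff
  simp only [parity_add_one, parity_add_two, parity_add_three, Bool.not_not, e2, e3, e4]
  push_cast
  rcases lt_trichotomy j (m + 1) with hj | rfl | hj
  · rw [if_pos hj, if_pos (by omega), if_pos (by omega), if_pos (by omega), if_pos (by omega)]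
    exact even_comp_low h _ _ _ _
  · rw [if_neg (lt_irrefl _), if_pos rfl]
    simp only [add_sub_cancel_right, le_refl, if_true, show ¬ (m : ℤ) + 1 ≤ m by omega, if_false]
    have := even_comp_mid h (α i) (α (i + 1)) (α (i + 2)) (α (i + 3)) (m + 1)
    simpa only [add_sub_cancel_right] using this
  · rw [if_neg (by omega), if_neg (by omega), if_neg (by omega), if_neg (by omega),
      if_neg (by omega), if_neg (by omega)]
    exact even_comp_high h _ _ _ _

theorem map_evenDiff_eq_zero {M' : Type*} [AddCommGroup M'] [Module (Env K T) M']
    (f : M →ₗ[Env K T] M') (m : ℕ) (α : ZMod 4 → ℤ → M) (β : ZMod 4 → ℤ → M')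
    (hf : ∀ i j, f (α i j) = oddDiff K T m β i j) (i : ZMod 4) (j : ℤ) :
    f (evenDiff K T (m + 1) α i j) = 0 := by
  rw [map_evenDiff]
  simp only [hf]
  exact evenDiff_oddDiff m β i j

theorem map_oddDiff_eq_zero {M' : Type*} [AddCommGroup M'] [Module (Env K T) M']
    (f : M →ₗ[Env K T] M') (m : ℕ) (α : ZMod 4 → ℤ → M) (β : ZMod 4 → ℤ → M')
    (hf : ∀ i j, f (α i j) = evenDiff K T m β i j) (i : ZMod 4) (j : ℤ) :
    f (oddDiff K T m α i j) = 0 := by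
  rw [map_oddDiff]
  simp only [hf]
  exact oddDiff_evenDiff m β i j

theorem d_d_genZ (n : ℕ) (i : ZMod 4) (j : ℤ) :
    d K T n (d K T (n + 1) (genZ K T (n + 2) i j)) = 0 := by
  rcases Nat.even_or_odd' n with ⟨m, rfl | rfl⟩
  · exact (congrArg (d K T (2 * m)) (d_genZ_even m i j)).trans
      (map_evenDiff_eq_zero (M := Q K T (2 * m + 1)) (M' := Q K T (2 * m)) (d K T (2 * m)) m
        (genZ K T (2 * m + 1)) (genZ K T (2 * m)) (d_genZ_odd m) i j)
  · exact (congrArg (d K T (2 * m + 1)) (d_genZ_odd (m + 1) i j)).trans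
      (map_oddDiff_eq_zero (M := Q K T (2 * m + 2)) (M' := Q K T (2 * m + 1)) (d K T (2 * m + 1))
        (m + 1) (genZ K T (2 * m + 2)) (genZ K T (2 * m + 1)) (d_genZ_even m) i j)

theorem d_d (n : ℕ) (z : Q K T (n + 2)) : d K T n (d K T (n + 1) z) = 0 := by
  have hcomp : d K T n ∘ₗ d K T (n + 1) = 0 :=
    hom_ext_gen (K := K) (T := T) (M := Q K T n) (n + 2) (d K T n ∘ₗ d K T (n + 1)) 0
      fun i j _ => (congrArg (fun z => d K T n (d K T (n + 1) z))
        (genZ_natCast (n + 2) i j).symm).trans (d_d_genZ n i j)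
  exact LinearMap.congr_fun hcomp z

end Differential

/-! ### The contraction of the one-sided complex -/

section OneSided

variable {K : Type u} [Field K] {T : ℕ}

theorem letterDiv_of_ne {c c' : Bool} (h : c ≠ c') (t : ZMod 4) {l : ℕ} (hl : l ≤ 4 * T + 1) :
    letterDiv K T c (e K T t * letter K T c' ^ l) = 0 := by
  obtain rfl : c' = !c := by cases c <;> cases c' <;> simp_all
  exact letterDiv_not c t hl

theorem letterDiv_socle_of_ne {c c' : Bool} (h : c ≠ c') (t : ZMod 4) :
    letterDiv K T c (e K T t * letter K T c' ^ (4 * T + 2)) = -letter K T c ^ (4 * T + 1) := by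
  obtain rfl : c' = !c := by cases c <;> cases c' <;> simp_all
  exact letterDiv_not_socle c t

theorem truncDiv_of_ne {c c' : Bool} (h : c ≠ c') (t : ZMod 4) (l : ℕ) :
    truncDiv K T c (e K T t * letter K T c' ^ l) = 0 := by
  obtain rfl : c' = !c := by cases c <;> cases c' <;> simp_all
  exact truncDiv_not c t l

theorem topCoeff_of_ne {c c' : Bool} (h : c ≠ c') (t : ZMod 4) (l : ℕ) :
    topCoeff K T c (e K T t * letter K T c' ^ l) = 0 := by
  obtain rfl : c' = !c := by cases c <;> cases c' <;> simp_all
  exact topCoeff_not c t l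

/-- The two contributions of the word `c^(l+1)` at the index next to the expected one cancel. -/
theorem pow_mul_pow_add_letterDiv {c c' : Bool} (h : c ≠ c') (t : ZMod 4) (l : ℕ) :
    letter K T c' ^ (4 * T + 1) * letter K T c ^ l +
      letterDiv K T c' (e K T t * (letter K T c ^ (4 * T + 1) * letter K T c ^ (l + 1))) = 0 := by
  rw [← pow_add]
  rcases Nat.eq_zero_or_pos l with rfl | hl
  · rw [pow_zero, mul_one, zero_add, letterDiv_socle_of_ne h.symm, add_neg_cancel]
  · rw [letter_pow_mul_letter_pow_of_ne h.symm (by omega) hl.ne', letter_pow_eq_zero c (by omega),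
      mul_zero, map_zero, add_zero]

/-- A property of elements of `A_T` which holds for the monomial basis of the local algebra
generated by `x` and `y` holds for all powers of `x` and `y`. -/
@[elab_as_elim]
theorem letter_pow_induction {P : A K T → Prop} (c c' : Bool) (h : c ≠ c') (one : P 1)
    (left : ∀ l ≤ 4 * T + 1, P (letter K T c ^ (l + 1)))
    (right : ∀ l < 4 * T + 1, P (letter K T c' ^ (l + 1)))
    (zero : P 0) (neg : ∀ a, P a → P (-a)) (w : A K T) (hw : ∃ c'' l, letter K T c'' ^ l = w) :
    P w := by
  obtain ⟨c'', l, rfl⟩ := hw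
  obtain rfl : c' = !c := by cases c <;> cases c' <;> simp_all
  rcases Nat.eq_zero_or_pos l with rfl | hl
  · rwa [pow_zero]
  obtain ⟨l, rfl⟩ := Nat.exists_eq_add_of_le' hl
  rcases le_or_gt l (4 * T + 1) with hl' | hl'
  · by_cases hc : c'' = c
    · exact hc ▸ left l hl'
    obtain rfl : c'' = !c := by cases c <;> cases c'' <;> simp_all
    rcases hl'.lt_or_eq with hl' | rfl
    · exact right l hl'
    · rw [eq_neg_of_add_eq_zero_right (letter_pow_add_letter_pow K T c)]
      exact neg _ (left _ le_rfl)
  · rwa [letter_pow_eq_zero c'' (by omega)]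

variable {M : Type*} [AddCommGroup M]

variable (K T) in
/-- The one-sided differential in degree `2m + 1`: the part of `∂^(2m+1)` in which the letters act
from the right. Here `φ j b` stands for `𝔞_j b`, and `c` is the letter `u`. -/
def rightOdd (c : Bool) (m : ℤ) (φ : ℤ → A K T → M) (j : ℤ) (b : A K T) : M :=
  if j ≤ m then
    φ (j - 1) (letter K T (!c) ^ (4 * T + 1) * b) + φ j (letter K T c * b)
  else
    φ (j - 1) (letter K T (!c) * b) + φ j (letter K T c ^ (4 * T + 1) * b)

variable (K T) in
/-- The one-sided differential in degree `2m`. In the middle term `j = m` of `∂^(2m)`, only the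
summands `𝔞_{j-1} u^(4T+1)` and `𝔞_j v^(4T+1)` have no letter on the left. -/
def rightEven (c : Bool) (m : ℤ) (φ : ℤ → A K T → M) (j : ℤ) (b : A K T) : M :=
  if j < m then
    φ (j - 1) (letter K T c ^ (4 * T + 1) * b) + φ j (letter K T (!c) * b)
  else if j = m then
    φ (j - 1) (letter K T c ^ (4 * T + 1) * b) + φ j (letter K T (!c) ^ (4 * T + 1) * b)
  else
    φ (j - 1) (letter K T c * b) + φ j (letter K T (!c) ^ (4 * T + 1) * b)

variable (K T) in
/-- The contraction of the one-sided complex in degree `2m`, on the elements `𝔞_j b` with `b`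
starting at the vertex `t`. It divides `b` by the letter `u` or `v` which occurs to the first power
in the differential; at `j = m` both do, and the second division is truncated because the socle of
`A_T` must be divided only once. -/
def contrEven (c : Bool) (m : ℤ) (t : ZMod 4) (φ : ℤ → A K T → M) (j : ℤ) (b : A K T) : M :=
  if j < m then φ j (letterDiv K T c (e K T t * b))
  else if j = m then
    φ j (letterDiv K T c (e K T t * b)) + φ (j + 1) (truncDiv K T (!c) (e K T t * b))
  else φ (j + 1) (letterDiv K T (!c) (e K T t * b))

variable (K T) in
/-- The contraction of the one-sided complex in degree `2m - 1`. At `j = m` the extra term accounts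
for the summand `𝔞_m v^(4T+1)` of the middle term of the differential in degree `2m`. -/
def contrOdd (c : Bool) (m : ℤ) (t : ZMod 4) (φ : ℤ → A K T → M) (j : ℤ) (b : A K T) : M :=
  if j < m then φ j (letterDiv K T (!c) (e K T t * b))
  else if j = m then
    φ (j + 1) (letterDiv K T c (e K T t * b)) + φ j (topCoeff K T (!c) (e K T t * b))
  else φ (j + 1) (letterDiv K T c (e K T t * b))

theorem letter_mul_letter_pow_succ_of_ne {c c' : Bool} (h : c ≠ c') (l : ℕ) :
    letter K T c * letter K T c' ^ (l + 1) = 0 := by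
  simpa using letter_pow_mul_letter_pow_of_ne (K := K) (T := T) h one_ne_zero l.succ_ne_zero

theorem letter_pow_succ_mul_letter_pow_succ_of_ne {c c' : Bool} (h : c ≠ c') (k l : ℕ) :
    letter K T c ^ (k + 1) * letter K T c' ^ (l + 1) = 0 :=
  letter_pow_mul_letter_pow_of_ne h k.succ_ne_zero l.succ_ne_zero

/-- The one-sided contraction, in degree `2m`, on the powers of the letters. The vertices `t` and
`t'` play no role, because division by a letter does not depend on the starting vertex. -/
theorem contraction_even (c : Bool) (m : ℤ) (t t' : ZMod 4) (φ : ℤ → A K T →+ M) (j : ℤ)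
    (c' : Bool) (l : ℕ) :
    contrEven K T c m t (rightOdd K T c m fun j b => φ j b) j (letter K T c' ^ l) +
      rightEven K T c m (contrOdd K T c m t' fun j b => φ j b) j (letter K T c' ^ l) =
      φ j (letter K T c' ^ l) := by
  have hw : ∃ c'' l', letter K T c'' ^ l' = letter K T c' ^ l := ⟨c', l, rfl⟩
  generalize letter K T c' ^ l = w at hw ⊢
  have hc : c ≠ !c := by simp
  have hc' : (!c) ≠ c := by simp
  have hcancel (i : ℤ) {c c' : Bool} (h : c ≠ c') (l : ℕ) :
      φ i (letterDiv K T c' (e K T t' * (letter K T c ^ (4 * T + 1) * letter K T c ^ (l + 1)))) =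
        -φ i (letter K T c' ^ (4 * T + 1) * letter K T c ^ l) := by
    rw [eq_neg_iff_add_eq_zero, add_comm, ← map_add, pow_mul_pow_add_letterDiv h, map_zero]
  have hD1 (c : Bool) (t : ZMod 4) : letterDiv K T c (e K T t * letter K T c) = 1 := by
    simpa using letterDiv_self (K := K) (T := T) c t (l := 0) (by omega)
  rcases lt_trichotomy j m with hj | rfl | hj
  · unfold contrEven rightEven rightOdd contrOdd
    simp only [hj, hj.le, show j - 1 < m by omega, if_true]
    refine letter_pow_induction c (!c) hc ?_ (fun l hl => ?_) (fun l hl => ?_) ?_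
      (fun a ha => ?_) w hw
    · simp only [mul_one, letterDiv_e, mul_zero, map_zero, letterDiv_of_ne hc' t' le_rfl, hD1,
        zero_add]
    · simp only [letterDiv_self c t hl, hcancel _ hc, ← pow_succ',
        letter_mul_letter_pow_succ_of_ne hc', mul_zero, map_zero]
      abel
    · simp only [letterDiv_of_ne hc t (show l + 1 ≤ 4 * T + 1 by omega),
        letter_pow_succ_mul_letter_pow_succ_of_ne hc, mul_zero, map_zero, ← pow_succ', zero_add,
        letterDiv_self (!c) t' (show l + 1 ≤ 4 * T + 1 by omega)]
    · simp only [mul_zero, map_zero, add_zero]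
    · simp only [mul_neg, map_neg, ← ha]
      abel
  · unfold contrEven rightEven rightOdd contrOdd
    simp only [lt_irrefl, le_refl, if_true, if_false, show j - 1 < j by omega,
      show ¬ j + 1 ≤ j by omega, add_sub_cancel_right]
    refine letter_pow_induction c (!c) hc ?_ (fun l hl => ?_) (fun l hl => ?_) ?_
      (fun a ha => ?_) w hw
    · simp only [mul_one, letterDiv_e, truncDiv_e, mul_zero, map_zero,
        letterDiv_of_ne hc' t' le_rfl, letterDiv_of_ne hc t' le_rfl, topCoeff_self, if_true,
        zero_add]
    · simp only [letterDiv_self c t hl, hcancel _ hc, ← pow_succ', truncDiv_of_ne hc',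
        letter_pow_succ_mul_letter_pow_succ_of_ne hc', mul_zero, map_zero]
      abel
    · have htop : topCoeff K T (!c)
          (e K T t' * (letter K T (!c) ^ (4 * T + 1) * letter K T (!c) ^ (l + 1))) = 0 := by
        rw [← pow_add, topCoeff_self, if_neg (by omega)]
      simp only [letterDiv_of_ne hc t (show l + 1 ≤ 4 * T + 1 by omega), truncDiv_self (!c) t hl,
        hcancel _ hc', letter_pow_succ_mul_letter_pow_succ_of_ne hc, mul_zero, map_zero,
        ← pow_succ', htop]
      abel
    · simp only [mul_zero, map_zero, add_zero]
    · simp only [mul_neg, map_neg, ← ha]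
      abel
  · unfold contrEven rightEven rightOdd contrOdd
    -- the index `j - 1` may be the middle one, which adds a term that vanishes
    have htop (w : A K T) : (if j - 1 = m then
        φ (j - 1 + 1) (letterDiv K T c (e K T t' * (letter K T c * w))) +
          φ (j - 1) (topCoeff K T (!c) (e K T t' * (letter K T c * w)))
        else φ (j - 1 + 1) (letterDiv K T c (e K T t' * (letter K T c * w)))) =
        φ j (letterDiv K T c (e K T t' * (letter K T c * w))) +
          if j - 1 = m then φ (j - 1) (topCoeff K T (!c) (e K T t' * (letter K T c * w)))
          else 0 := by
      rw [sub_add_cancel]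
      split_ifs <;> simp
    simp only [hj.not_gt, hj.ne', if_false, show ¬ j - 1 < m by omega,
      show ¬ j + 1 ≤ m by omega, add_sub_cancel_right, htop]
    refine letter_pow_induction (!c) c hc' ?_ (fun l hl => ?_) (fun l hl => ?_) ?_
      (fun a ha => ?_) w hw
    · simp only [mul_one, letterDiv_e, mul_zero, map_zero, hD1,
        letterDiv_of_ne hc t' le_rfl, zero_add, add_zero]
      have := topCoeff_of_ne (K := K) (T := T) hc' t' 1
      rw [pow_one] at this
      simp only [this, map_zero, ite_self, add_zero]
    · simp only [letterDiv_self (!c) t hl, hcancel _ hc', ← pow_succ',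
        letter_mul_letter_pow_succ_of_ne hc, mul_zero, map_zero, ite_self]
      abel
    · simp only [letterDiv_of_ne hc' t (show l + 1 ≤ 4 * T + 1 by omega), topCoeff_of_ne hc',
        letter_pow_succ_mul_letter_pow_succ_of_ne hc', mul_zero, map_zero, ← pow_succ', zero_add,
        letterDiv_self c t' (show l + 1 ≤ 4 * T + 1 by omega), ite_self, add_zero]
    · simp only [mul_zero, map_zero, add_zero, ite_self]
    · rw [map_neg, ← ha]
      split_ifs <;> simp only [mul_neg, map_neg] <;> abel

/-- The one-sided contraction, in degree `2m + 1`, on the powers of the letters. -/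
theorem contraction_odd (c : Bool) (m : ℤ) (t t' : ZMod 4) (φ : ℤ → A K T →+ M) (j : ℤ)
    (c' : Bool) (l : ℕ) :
    contrOdd K T c (m + 1) t (rightEven K T c (m + 1) fun j b => φ j b) j (letter K T c' ^ l) +
      rightOdd K T c m (contrEven K T c m t' fun j b => φ j b) j (letter K T c' ^ l) =
      φ j (letter K T c' ^ l) := by
  have hw : ∃ c'' l', letter K T c'' ^ l' = letter K T c' ^ l := ⟨c', l, rfl⟩
  generalize letter K T c' ^ l = w at hw ⊢
  have hc : c ≠ !c := by simp
  have hc' : (!c) ≠ c := by simp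
  have hcancel (i : ℤ) {c c' : Bool} (h : c ≠ c') (l : ℕ) :
      φ i (letterDiv K T c' (e K T t' * (letter K T c ^ (4 * T + 1) * letter K T c ^ (l + 1)))) =
        -φ i (letter K T c' ^ (4 * T + 1) * letter K T c ^ l) := by
    rw [eq_neg_iff_add_eq_zero, add_comm, ← map_add, pow_mul_pow_add_letterDiv h, map_zero]
  have hD1 (c : Bool) (t : ZMod 4) : letterDiv K T c (e K T t * letter K T c) = 1 := by
    simpa using letterDiv_self (K := K) (T := T) c t (l := 0) (by omega)
  have hD0 {c c' : Bool} (h : c ≠ c') (t : ZMod 4) :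
      letterDiv K T c (e K T t * letter K T c') = 0 := by
    simpa using letterDiv_of_ne (K := K) (T := T) h t (l := 1) (by omega)
  rcases lt_trichotomy j (m + 1) with hj | rfl | hj
  · unfold contrOdd rightEven rightOdd contrEven
    -- the index `j` may be the middle one, which adds a term that vanishes
    have htrunc (w : A K T) : (if j < m then
        φ j (letterDiv K T c (e K T t' * (letter K T c * w)))
        else if j = m then φ j (letterDiv K T c (e K T t' * (letter K T c * w))) +
          φ (j + 1) (truncDiv K T (!c) (e K T t' * (letter K T c * w)))
        else φ (j + 1) (letterDiv K T (!c) (e K T t' * (letter K T c * w)))) =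
        φ j (letterDiv K T c (e K T t' * (letter K T c * w))) +
          if j = m then φ (j + 1) (truncDiv K T (!c) (e K T t' * (letter K T c * w)))
          else 0 := by
      rcases (show j ≤ m by omega).lt_or_eq with h | h
      · rw [if_pos h, if_neg h.ne, add_zero]
      · rw [if_neg (by omega), if_pos h, if_pos h]
    simp only [hj, show j ≤ m by omega, show j - 1 < m by omega, if_true, htrunc]
    refine letter_pow_induction (!c) c hc' ?_ (fun l hl => ?_) (fun l hl => ?_) ?_
      (fun a ha => ?_) w hw
    · have := truncDiv_of_ne (K := K) (T := T) hc' t' 1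
      rw [pow_one] at this
      simp only [mul_one, letterDiv_e, mul_zero, map_zero, letterDiv_of_ne hc t' le_rfl, hD1,
        zero_add, this, ite_self, add_zero]
    · simp only [letterDiv_self (!c) t hl, hcancel _ hc', ← pow_succ',
        letter_mul_letter_pow_succ_of_ne hc, mul_zero, map_zero, ite_self]
      abel
    · simp only [letterDiv_of_ne hc' t (show l + 1 ≤ 4 * T + 1 by omega), truncDiv_of_ne hc',
        letter_pow_succ_mul_letter_pow_succ_of_ne hc', mul_zero, map_zero, ← pow_succ', zero_add,
        letterDiv_self c t' (show l + 1 ≤ 4 * T + 1 by omega), ite_self, add_zero]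
    · simp only [mul_zero, map_zero, add_zero, ite_self]
    · rw [map_neg, ← ha]
      split_ifs <;> simp only [mul_neg, map_neg] <;> abel
  · unfold contrOdd rightEven rightOdd contrEven
    simp only [lt_irrefl, if_true, if_false, show ¬ m + 1 ≤ m by omega,
      show ¬ m + 1 < m by omega, show ¬ m + 1 = m by omega, show ¬ m + 1 + 1 < m + 1 by omega,
      show ¬ m + 1 + 1 = m + 1 by omega, add_sub_cancel_right]
    refine letter_pow_induction c (!c) hc ?_ (fun l hl => ?_) (fun l hl => ?_) ?_
      (fun a ha => ?_) w hw
    · have := truncDiv_self (K := K) (T := T) (!c) t' (l := 0) (by omega)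
      rw [zero_add, pow_one, pow_zero] at this
      simp only [mul_one, letterDiv_e, topCoeff_e, mul_zero, map_zero, hD0 hc, this,
        letterDiv_of_ne hc' t' le_rfl, zero_add, add_zero]
    · simp only [letterDiv_self c t hl, hcancel _ hc, ← pow_succ', topCoeff_of_ne hc',
        letter_mul_letter_pow_succ_of_ne hc', mul_zero, map_zero]
      abel
    · simp only [letterDiv_of_ne hc t (show l + 1 ≤ 4 * T + 1 by omega), topCoeff_self,
        letter_pow_succ_mul_letter_pow_succ_of_ne hc, mul_zero, map_zero, ← pow_succ', zero_add,
        add_zero]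
      -- the word `(!c)^(4T+1)` is seen by `topCoeff`, and its product with `!c` is in the socle
      by_cases h : 4 * T + 1 = l + 1
      · obtain rfl : l = 4 * T := by omega
        simp only [if_true, mul_one, truncDiv_self_of_le (!c) t' (le_refl (4 * T + 2)),
          letterDiv_socle_of_ne hc t', map_neg, map_zero]
        abel
      · simp only [if_neg h, mul_zero, map_zero,
          letterDiv_of_ne hc t' (show l + 1 + 1 ≤ 4 * T + 1 by omega),
          truncDiv_self (!c) t' (show l + 1 < 4 * T + 1 by omega), zero_add]
    · simp only [mul_zero, map_zero, add_zero]
    · simp only [mul_neg, map_neg, ← ha]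
      abel
  · unfold contrOdd rightEven rightOdd contrEven
    simp only [hj.not_gt, hj.ne', if_false, show ¬ j ≤ m by omega, show ¬ j < m by omega,
      show ¬ j = m by omega, show ¬ j - 1 < m by omega, show ¬ j - 1 = m by omega,
      show ¬ j + 1 < m + 1 by omega, show ¬ j + 1 = m + 1 by omega, add_sub_cancel_right,
      sub_add_cancel]
    refine letter_pow_induction c (!c) hc ?_ (fun l hl => ?_) (fun l hl => ?_) ?_
      (fun a ha => ?_) w hw
    · simp only [mul_one, letterDiv_e, mul_zero, map_zero, letterDiv_of_ne hc' t' le_rfl, hD1,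
        zero_add, add_zero]
    · simp only [letterDiv_self c t hl, hcancel _ hc, ← pow_succ',
        letter_mul_letter_pow_succ_of_ne hc', mul_zero, map_zero]
      abel
    · simp only [letterDiv_of_ne hc t (show l + 1 ≤ 4 * T + 1 by omega),
        letter_pow_succ_mul_letter_pow_succ_of_ne hc, mul_zero, map_zero, ← pow_succ', zero_add,
        letterDiv_self (!c) t' (show l + 1 ≤ 4 * T + 1 by omega), add_zero]
    · simp only [mul_zero, map_zero, add_zero]
    · simp only [mul_neg, map_neg, ← ha]
      abel

end OneSided

/-! ### The contraction of the bimodule complex modulo the left radical -/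

section RightPart

variable {K : Type u} [Field K] {T : ℕ} {M : Type*} [AddCommGroup M] [Module (Env K T) M]

theorem dvd_oddSum {R : Type*} [CommRing R] (T : ℕ) (u w : R) : u ∣ oddSum T u w :=
  Finset.dvd_sum fun s _ => (dvd_pow_self u (by omega)).mul_right _

theorem dvd_evenSum_sub {R : Type*} [CommRing R] (T : ℕ) (u w : R) :
    u ∣ evenSum T u w - w ^ (4 * T) := by
  rw [evenSum, Finset.sum_range_succ', mul_zero, pow_zero, one_mul, Nat.sub_zero,
    add_sub_cancel_right]
  exact Finset.dvd_sum fun s _ => (dvd_pow_self u (by omega)).mul_right _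

/-- The class of `q b` modulo the left radical. -/
def rightMod (q : M) : A K T →+ M ⧸ leftRad K T M 1 where
  toFun b := QuotientAddGroup.mk' _ (bi 1 q b)
  map_zero' := by rw [bi_zero_right, map_zero]
  map_add' b b' := by rw [bi_add_right, map_add]

theorem rightMod_apply (q : M) (b : A K T) :
    rightMod q b = QuotientAddGroup.mk' (leftRad K T M 1) (bi 1 q b) := rfl

theorem rightMod_add (q q' : M) (b : A K T) :
    rightMod (q + q') b = rightMod q b + rightMod q' b := by
  rw [rightMod_apply, bi_add, map_add]; rfl

theorem rightMod_sub (q q' : M) (b : A K T) :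
    rightMod (q - q') b = rightMod q b - rightMod q' b := by
  rw [rightMod_apply, bi_sub, map_sub]; rfl

theorem rightMod_zero (b : A K T) : rightMod (0 : M) b = 0 := by
  rw [rightMod_apply, bi_zero, map_zero]

theorem rightMod_leftLetter_mul (c : Bool) (r : LetterRing K T) (q : M) (b : A K T) :
    rightMod ((leftLetter K T c * r) • q) b = 0 := by
  rw [rightMod_apply, QuotientAddGroup.mk'_apply, QuotientAddGroup.eq_zero_iff, mul_smul,
    ← bi_letter_one]
  refine bi_mem_leftRad _ _ ?_
  simpa using bi_letter_pow_mem_leftRad (K := K) (T := T) c 1 (r • q)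

theorem rightMod_of_dvd {c : Bool} {r : LetterRing K T} (h : leftLetter K T c ∣ r) (q : M)
    (b : A K T) : rightMod (r • q) b = 0 := by
  obtain ⟨r, rfl⟩ := h
  exact rightMod_leftLetter_mul c r q b

theorem rightMod_leftLetter_pow (c : Bool) (k : ℕ) (q : M) (b : A K T) :
    rightMod (leftLetter K T c ^ (k + 1) • q) b = 0 :=
  rightMod_of_dvd (dvd_pow_self _ k.succ_ne_zero) q b

theorem rightMod_leftLetter (c : Bool) (q : M) (b : A K T) :
    rightMod (leftLetter K T c • q) b = 0 :=
  rightMod_of_dvd dvd_rfl q b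

theorem rightMod_rightLetter_pow (c : Bool) (k : ℕ) (q : M) (b : A K T) :
    rightMod (rightLetter K T c ^ k • q) b = rightMod q (letter K T c ^ k * b) := by
  rw [rightMod_apply, ← bi_one_letter_pow, bi_bi, mul_one]; rfl

theorem rightMod_rightLetter (c : Bool) (q : M) (b : A K T) :
    rightMod (rightLetter K T c • q) b = rightMod q (letter K T c * b) := by
  simpa using rightMod_rightLetter_pow c 1 q b

theorem rightMod_oddSum (c : Bool) (q : M) (b : A K T) :
    rightMod (oddSum T (leftLetter K T c) (rightLetter K T c) • q) b = 0 :=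
  rightMod_of_dvd (dvd_oddSum _ _ _) q b

theorem rightMod_evenSum (c : Bool) (q : M) (b : A K T) :
    rightMod (evenSum T (leftLetter K T c) (rightLetter K T c) • q) b =
      rightMod q (letter K T c ^ (4 * T) * b) := by
  rw [← sub_add_cancel (evenSum T (leftLetter K T c) (rightLetter K T c))
    (rightLetter K T c ^ (4 * T)), add_smul, rightMod_add,
    rightMod_of_dvd (dvd_evenSum_sub _ _ _), zero_add, rightMod_rightLetter_pow]

/-- Modulo the left radical, the differential in odd degrees is the one-sided one. -/
theorem rightMod_oddDiff (m : ℕ) (α : ZMod 4 → ℤ → M) (i : ZMod 4) (j : ℤ) (b : A K T) :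
    rightMod (oddDiff K T m α i j) b =
      rightOdd K T (parity i) m (fun j b => rightMod (α i j) b) j b := by
  unfold oddDiff rightOdd oddLow oddHigh
  split_ifs <;> simp only [rightMod_sub, rightMod_add, rightMod_leftLetter,
    rightMod_leftLetter_pow, rightMod_rightLetter, rightMod_rightLetter_pow, sub_zero]

/-- Modulo the left radical, the differential in even degrees is the one-sided one. -/
theorem rightMod_evenDiff (m : ℕ) (α : ZMod 4 → ℤ → M) (i : ZMod 4) (j : ℤ) (b : A K T) :
    rightMod (evenDiff K T m α i j) b =
      rightEven K T (parity i) m (fun j b => rightMod (α i j) b) j b := by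
  unfold evenDiff rightEven evenLow evenMid evenHigh
  split_ifs <;> simp only [rightMod_add, rightMod_leftLetter, rightMod_evenSum, rightMod_oddSum,
    rightMod_leftLetter_pow, rightMod_rightLetter, rightMod_rightLetter_pow, add_zero,
    ← mul_assoc, ← pow_succ']

/-! Additive maps which commute with left multiplication preserve the left radical. -/

variable {M' : Type*} [AddCommGroup M'] [Module (Env K T) M']

theorem map_mem_leftRad (h : M →+ M') (hh : ∀ (a : A K T) z, h (bi a z 1) = bi a (h z) 1) {z : M}
    (hz : z ∈ leftRad K T M 1) : h z ∈ leftRad K T M' 1 := by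
  refine leftRad_induction (P := fun z => h z ∈ leftRad K T M' 1)
    (fun z z' hz hz' => ?_) (fun c q => ?_) hz
  · rw [map_add]; exact add_mem hz hz'
  · rw [hh]; exact bi_letter_pow_mem_leftRad c 1 _

/-- The map induced modulo the left radicals. -/
def mapMod (h : M →+ M') (hh : ∀ (a : A K T) z, h (bi a z 1) = bi a (h z) 1) :
    M ⧸ leftRad K T M 1 →+ M' ⧸ leftRad K T M' 1 :=
  QuotientAddGroup.map _ _ h fun _ hz => map_mem_leftRad h hh hz

theorem mapMod_rightMod (h : M →+ M') (hh : ∀ (a : A K T) z, h (bi a z 1) = bi a (h z) 1) (q : M)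
    (b : A K T) : mapMod h hh (rightMod q b) = QuotientAddGroup.mk' _ (h (bi 1 q b)) := rfl

section Compare

variable {M₀ M₂ : Type*} [AddCommGroup M₀] [Module (Env K T) M₀]
  [AddCommGroup M₂] [Module (Env K T) M₂]

/-- The class of `d₁ h₁` is the one-sided differential after the one-sided contraction, in even
degrees. -/
theorem mk_map_contrEven (d₁ : M₂ →ₗ[Env K T] M) (m : ℕ) (γ : ZMod 4 → ℤ → M₂)
    (β : ZMod 4 → ℤ → M) (hd : ∀ i j, d₁ (γ i j) = oddDiff K T m β i j) (t i : ZMod 4) (j : ℤ)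
    (b : A K T) :
    QuotientAddGroup.mk' (leftRad K T M 1)
        (d₁ (contrEven K T (parity i) m t (fun j b => bi 1 (γ i j) b) j b)) =
      contrEven K T (parity i) m t
        (rightOdd K T (parity i) m fun j b => rightMod (β i j) b) j b := by
  unfold contrEven
  simp only [← rightMod_oddDiff]
  split_ifs <;> simp only [map_add, map_bi, hd] <;> rfl

/-- The class of `d₁ h₁` is the one-sided differential after the one-sided contraction, in odd
degrees. -/
theorem mk_map_contrOdd (d₁ : M₂ →ₗ[Env K T] M) (m : ℕ) (γ : ZMod 4 → ℤ → M₂)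
    (β : ZMod 4 → ℤ → M) (hd : ∀ i j, d₁ (γ i j) = evenDiff K T (m + 1) β i j) (t i : ZMod 4)
    (j : ℤ) (b : A K T) :
    QuotientAddGroup.mk' (leftRad K T M 1)
        (d₁ (contrOdd K T (parity i) (m + 1) t (fun j b => bi 1 (γ i j) b) j b)) =
      contrOdd K T (parity i) (m + 1) t
        (rightEven K T (parity i) (m + 1) fun j b => rightMod (β i j) b) j b := by
  have h := fun j b => rightMod_evenDiff (K := K) (T := T) (m + 1) β i j b
  push_cast at h
  unfold contrOdd
  simp only [← h]
  split_ifs <;> simp only [map_add, map_bi, hd] <;> rfl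

/-- The class of `h₀ d₀` is the one-sided contraction after the one-sided differential, in even
degrees. -/
theorem mk_contrOdd_evenDiff (h₀ : M₀ →+ M)
    (hh₀ : ∀ (a : A K T) z, h₀ (bi a z 1) = bi a (h₀ z) 1) (m : ℕ) (α : ZMod 4 → ℤ → M₀)
    (β : ZMod 4 → ℤ → M) (t : ZMod 4 → ZMod 4)
    (h : ∀ i j b, h₀ (bi 1 (α i j) b) =
      contrOdd K T (parity i) m (t i) (fun j b => bi 1 (β i j) b) j b)
    (i : ZMod 4) (j : ℤ) (b : A K T) :
    QuotientAddGroup.mk' (leftRad K T M 1) (h₀ (bi 1 (evenDiff K T m α i j) b)) =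
      rightEven K T (parity i) m
        (contrOdd K T (parity i) m (t i) fun j b => rightMod (β i j) b) j b := by
  have key (j : ℤ) (b : A K T) : mapMod h₀ hh₀ (rightMod (α i j) b) =
      contrOdd K T (parity i) m (t i) (fun j b => rightMod (β i j) b) j b := by
    rw [mapMod_rightMod, h]
    unfold contrOdd
    split_ifs <;> simp only [map_add] <;> rfl
  rw [← mapMod_rightMod h₀ hh₀, rightMod_evenDiff]
  unfold rightEven
  split_ifs <;> rw [map_add, key, key]

/-- The class of `h₀ d₀` is the one-sided contraction after the one-sided differential, in odd
degrees. -/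
theorem mk_contrEven_oddDiff (h₀ : M₀ →+ M)
    (hh₀ : ∀ (a : A K T) z, h₀ (bi a z 1) = bi a (h₀ z) 1) (m : ℕ) (α : ZMod 4 → ℤ → M₀)
    (β : ZMod 4 → ℤ → M) (t : ZMod 4 → ZMod 4)
    (h : ∀ i j b, h₀ (bi 1 (α i j) b) =
      contrEven K T (parity i) m (t i) (fun j b => bi 1 (β i j) b) j b)
    (i : ZMod 4) (j : ℤ) (b : A K T) :
    QuotientAddGroup.mk' (leftRad K T M 1) (h₀ (bi 1 (oddDiff K T m α i j) b)) =
      rightOdd K T (parity i) m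
        (contrEven K T (parity i) m (t i) fun j b => rightMod (β i j) b) j b := by
  have key (j : ℤ) (b : A K T) : mapMod h₀ hh₀ (rightMod (α i j) b) =
      contrEven K T (parity i) m (t i) (fun j b => rightMod (β i j) b) j b := by
    rw [mapMod_rightMod, h]
    unfold contrEven
    split_ifs <;> simp only [map_add] <;> rfl
  rw [← mapMod_rightMod h₀ hh₀, rightMod_oddDiff]
  unfold rightOdd
  split_ifs <;> rw [map_add, key, key]

/-- In even degrees, `d₁ h₁ + h₀ d₀ - 1` has values in the left radical on the elements `β w`, where
`w` is a power of a letter. -/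
theorem contraction_mem_leftRad_even (d₁ : M₂ →ₗ[Env K T] M) (d₀ : M →ₗ[Env K T] M₀)
    (h₁ : M →+ M₂) (h₀ : M₀ →+ M) (hh₀ : ∀ (a : A K T) z, h₀ (bi a z 1) = bi a (h₀ z) 1) (m : ℕ)
    (α : ZMod 4 → ℤ → M₀) (β : ZMod 4 → ℤ → M) (γ : ZMod 4 → ℤ → M₂)
    (hd₁ : ∀ i j, d₁ (γ i j) = oddDiff K T m β i j)
    (hd₀ : ∀ i j, d₀ (β i j) = evenDiff K T m α i j) (s t : ZMod 4 → ZMod 4)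
    (hβ : ∀ i j b, h₁ (bi 1 (β i j) b) =
      contrEven K T (parity i) m (s i) (fun j b => bi 1 (γ i j) b) j b)
    (hα : ∀ i j b, h₀ (bi 1 (α i j) b) =
      contrOdd K T (parity i) m (t i) (fun j b => bi 1 (β i j) b) j b)
    (i : ZMod 4) (j : ℤ) (c : Bool) (l : ℕ) :
    d₁ (h₁ (bi 1 (β i j) (letter K T c ^ l))) + h₀ (d₀ (bi 1 (β i j) (letter K T c ^ l))) -
      bi 1 (β i j) (letter K T c ^ l) ∈ leftRad K T M 1 := by
  rw [← QuotientAddGroup.eq_zero_iff, ← QuotientAddGroup.mk'_apply, map_sub, map_add, hβ,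
    mk_map_contrEven d₁ m γ β hd₁, map_bi, hd₀, mk_contrOdd_evenDiff h₀ hh₀ m α β t hα,
    contraction_even (parity i) m (s i) (t i) (fun j => rightMod (β i j))]
  exact sub_self _

/-- In odd degrees, `d₁ h₁ + h₀ d₀ - 1` has values in the left radical on the elements `β w`, where
`w` is a power of a letter. -/
theorem contraction_mem_leftRad_odd (d₁ : M₂ →ₗ[Env K T] M) (d₀ : M →ₗ[Env K T] M₀)
    (h₁ : M →+ M₂) (h₀ : M₀ →+ M) (hh₀ : ∀ (a : A K T) z, h₀ (bi a z 1) = bi a (h₀ z) 1) (m : ℕ)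
    (α : ZMod 4 → ℤ → M₀) (β : ZMod 4 → ℤ → M) (γ : ZMod 4 → ℤ → M₂)
    (hd₁ : ∀ i j, d₁ (γ i j) = evenDiff K T (m + 1) β i j)
    (hd₀ : ∀ i j, d₀ (β i j) = oddDiff K T m α i j) (s t : ZMod 4 → ZMod 4)
    (hβ : ∀ i j b, h₁ (bi 1 (β i j) b) =
      contrOdd K T (parity i) (m + 1) (s i) (fun j b => bi 1 (γ i j) b) j b)
    (hα : ∀ i j b, h₀ (bi 1 (α i j) b) =
      contrEven K T (parity i) m (t i) (fun j b => bi 1 (β i j) b) j b)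
    (i : ZMod 4) (j : ℤ) (c : Bool) (l : ℕ) :
    d₁ (h₁ (bi 1 (β i j) (letter K T c ^ l))) + h₀ (d₀ (bi 1 (β i j) (letter K T c ^ l))) -
      bi 1 (β i j) (letter K T c ^ l) ∈ leftRad K T M 1 := by
  rw [← QuotientAddGroup.eq_zero_iff, ← QuotientAddGroup.mk'_apply, map_sub, map_add, hβ,
    mk_map_contrOdd d₁ m γ β hd₁, map_bi, hd₀, mk_contrEven_oddDiff h₀ hh₀ m α β t hα,
    contraction_odd (parity i) m (s i) (t i) (fun j => rightMod (β i j))]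
  exact sub_self _

/-- At the end of the complex, where `β i j = 0` for `j ≠ 0` and the last map `h₀ : A_T → M` takes
`e_i` to `β i 0`. -/
theorem contraction_mem_leftRad_zero (d₁ : M₂ →ₗ[Env K T] M) (d₀ : M →ₗ[Env K T] A K T)
    (h₁ : M →+ M₂) (h₀ : A K T →+ M) (hh₀ : ∀ (a : A K T) z, h₀ (bi a z 1) = bi a (h₀ z) 1)
    (β : ZMod 4 → ℤ → M) (γ : ZMod 4 → ℤ → M₂)
    (hβ0 : ∀ i j, j ≠ 0 → β i j = 0)
    (hd₁ : ∀ i j, d₁ (γ i j) = oddDiff K T 0 β i j)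
    (hd₀ : ∀ i, d₀ (β i 0) = e K T i) (s : ZMod 4 → ZMod 4)
    (hβ : ∀ i j b, h₁ (bi 1 (β i j) b) =
      contrEven K T (parity i) 0 (s i) (fun j b => bi 1 (γ i j) b) j b)
    (hα : ∀ i, h₀ (e K T i) = β i 0)
    (i : ZMod 4) (c : Bool) (l : ℕ) :
    d₁ (h₁ (bi 1 (β i 0) (letter K T c ^ l))) + h₀ (d₀ (bi 1 (β i 0) (letter K T c ^ l))) -
      bi 1 (β i 0) (letter K T c ^ l) ∈ leftRad K T M 1 := by
  have h := contraction_even (K := K) (T := T) (parity i) 0 (s i) 0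
    (fun j => rightMod (β i j)) 0 c l
  have hneg : rightMod (K := K) (T := T) (β i (0 - 1)) = 0 := by
    rw [hβ0 i _ (by omega)]; ext b; exact rightMod_zero b
  have hpos : rightMod (K := K) (T := T) (β i 1) = 0 := by
    rw [hβ0 i _ (by omega)]; ext b; exact rightMod_zero b
  have htop : topCoeff K T (!parity i)
      (e K T 0 * (letter K T (!parity i) ^ (4 * T + 1) * letter K T c ^ l)) =
        if l = 0 then 1 else 0 := by
    by_cases hl : l = 0
    · rw [hl, pow_zero, mul_one, topCoeff_self, if_pos rfl, if_pos rfl]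
    rw [if_neg hl]
    by_cases hc : (!parity i) = c
    · rw [hc, ← pow_add, topCoeff_self, if_neg (by omega)]
    · rw [letter_pow_mul_letter_pow_of_ne hc (by omega) hl, mul_zero, map_zero]
  have hR : rightEven K T (parity i) 0
      (contrOdd K T (parity i) 0 0 fun j b => rightMod (β i j) b) 0 (letter K T c ^ l) =
        if l = 0 then rightMod (β i 0) 1 else 0 := by
    unfold rightEven contrOdd
    simp only [lt_irrefl, if_true, if_false, show (0 : ℤ) - 1 < 0 by omega, hneg, hpos, htop,
      AddMonoidHom.zero_apply, zero_add]
    split_ifs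
    · rfl
    · exact map_zero _
  have h' : QuotientAddGroup.mk' (leftRad K T M 1)
      (h₀ (d₀ (bi 1 (β i 0) (letter K T c ^ l)))) =
        if l = 0 then rightMod (β i 0) (1 : A K T) else 0 := by
    rw [map_bi, hd₀, bi_self, one_mul]
    split_ifs with hl
    · rw [hl, pow_zero, mul_one, hα, rightMod_apply, one_bi_one]
    · rw [QuotientAddGroup.mk'_apply, QuotientAddGroup.eq_zero_iff]
      have : e K T i * letter K T c ^ l = bi (e K T i * letter K T c ^ l) (1 : A K T) 1 := by
        rw [bi_self, mul_one, mul_one]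
      rw [this, hh₀]
      exact e_mul_letter_pow_bi_mem_leftRad i c hl _ _
  have h1 := mk_map_contrEven d₁ 0 γ β hd₁ (s i) i 0 (letter K T c ^ l)
  rw [Nat.cast_zero] at h1
  rw [← QuotientAddGroup.eq_zero_iff, ← QuotientAddGroup.mk'_apply, map_sub, map_add, hβ,
    h1, h', ← hR, h]
  exact sub_self _

end Compare

end RightPart

/-! ### Exactness -/

section Exactness

variable {K : Type u} [Field K] {T : ℕ} {M : Type*} [AddCommGroup M] [Module (Env K T) M]

/-- The contraction `Q^n → Q^(n+1)` for `n = 2m`, where `γ i j` stands for the generator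
`𝔞^(n+1)_{i,j}`. -/
def homotopyEven (n m : ℕ) (γ : ZMod 4 → ℤ → M) : Q K T n →+ M :=
  leftHom n fun i j =>
    if (j : ℤ) < m then leftTerm (γ i j) (letterDiv K T (parity i))
    else if (j : ℤ) = m then
      leftTerm (γ i j) (letterDiv K T (parity i)) +
        leftTerm (γ i (j + 1)) (truncDiv K T (!parity i))
    else leftTerm (γ i (j + 1)) (letterDiv K T (!parity i))

/-- The contraction `Q^n → Q^(n+1)` for `n = 2m + 1`, where `γ i j` stands for the generator
`𝔞^(n+1)_{i,j}`. -/
def homotopyOdd (n m : ℕ) (γ : ZMod 4 → ℤ → M) : Q K T n →+ M :=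
  leftHom n fun i j =>
    if (j : ℤ) < m + 1 then leftTerm (γ i j) (letterDiv K T (!parity i))
    else if (j : ℤ) = m + 1 then
      leftTerm (γ i (j + 1)) (letterDiv K T (parity i)) +
        leftTerm (γ i j) (topCoeff K T (!parity i))
    else leftTerm (γ i (j + 1)) (letterDiv K T (parity i))

theorem homotopyEven_bi (n m : ℕ) (γ : ZMod 4 → ℤ → M) (a : A K T) (z : Q K T n) :
    homotopyEven n m γ (bi a z 1) = bi a (homotopyEven n m γ z) 1 := by
  refine leftHom_bi _ _ (fun i j a r => ?_) a z
  split_ifs <;> simp only [AddMonoidHom.add_apply, leftTerm_mul, bi_add]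

theorem homotopyOdd_bi (n m : ℕ) (γ : ZMod 4 → ℤ → M) (a : A K T) (z : Q K T n) :
    homotopyOdd n m γ (bi a z 1) = bi a (homotopyOdd n m γ z) 1 := by
  refine leftHom_bi _ _ (fun i j a r => ?_) a z
  split_ifs <;> simp only [AddMonoidHom.add_apply, leftTerm_mul, bi_add]

theorem bi_of_fixed_left {i : ZMod 4} {q : M} (h : bi (e K T i) q (1 : A K T) = q) (b : A K T) :
    bi (1 * e K T i) q b = bi 1 q b := by
  nth_rw 2 [← h]
  rw [bi_bi, one_mul, one_mul]

theorem homotopyEven_gen (n m : ℕ) (γ : ZMod 4 → ℤ → M)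
    (hγ : ∀ i j, bi (e K T i) (γ i j) (1 : A K T) = γ i j) (i : ZMod 4) {j : ℕ} (hj : j ≤ n)
    (b : A K T) :
    homotopyEven n m γ (bi 1 (gen K T n i j) b) =
      contrEven K T (parity i) m (i + n) (fun j b => bi 1 (γ i j) b) j b := by
  rw [homotopyEven, leftHom_bi_gen _ _ _ _ _ hj]
  unfold contrEven
  split_ifs <;> simp only [AddMonoidHom.add_apply, leftTerm_tmul, bi_of_fixed_left (hγ _ _)]

theorem homotopyOdd_gen (n m : ℕ) (γ : ZMod 4 → ℤ → M)
    (hγ : ∀ i j, bi (e K T i) (γ i j) (1 : A K T) = γ i j) (i : ZMod 4) {j : ℕ}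
    (hj : j ≤ n) (b : A K T) :
    homotopyOdd n m γ (bi 1 (gen K T n i j) b) =
      contrOdd K T (parity i) (m + 1) (i + n) (fun j b => bi 1 (γ i j) b) j b := by
  rw [homotopyOdd, leftHom_bi_gen _ _ _ _ _ hj]
  unfold contrOdd
  split_ifs <;> simp only [AddMonoidHom.add_apply, leftTerm_tmul, bi_of_fixed_left (hγ _ _)]

theorem genZ_of_notMem {n : ℕ} (i : ZMod 4) {j : ℤ} (hj : j < 0 ∨ n < j) : genZ K T n i j = 0 :=
  extendZero_of_notMem (fun _ => gen_of_lt i) hj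

/-- Identities between additive functions of the generators hold for all integral indices if they
hold for the actual generators and both sides vanish for the remaining indices. -/
theorem map_genZ {M : Type*} [AddCommGroup M] {n : ℕ} (h : Q K T n →+ M) (i : ZMod 4)
    (b : A K T) (F : ℤ → M)
    (hF : ∀ j : ℤ, j < 0 ∨ n < j → F j = 0)
    (hgen : ∀ j : ℕ, j ≤ n → h (bi 1 (gen K T n i j) b) = F j) (j : ℤ) :
    h (bi 1 (genZ K T n i j) b) = F j := by
  by_cases hj : j < 0 ∨ n < j
  · rw [hF j hj]
    exact (congrArg (fun z => h (bi 1 z b)) (genZ_of_notMem i hj)).trans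
      ((congrArg h (bi_zero (M := Q K T n) 1 b)).trans (map_zero h))
  · obtain ⟨j, rfl⟩ := Int.eq_ofNat_of_zero_le (by omega : 0 ≤ j)
    exact (congrArg (fun z => h (bi 1 z b)) (genZ_natCast n i j)).trans (hgen j (by omega))

theorem homotopyEven_genZ {n m : ℕ} (hn : n = 2 * m) (γ : ZMod 4 → ℤ → M)
    (hγ : ∀ i j, bi (e K T i) (γ i j) (1 : A K T) = γ i j)
    (hγ0 : ∀ i (j : ℤ), j < 0 ∨ (n + 1 : ℕ) < j → γ i j = 0) (i : ZMod 4) (j : ℤ) (b : A K T) :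
    homotopyEven n m γ (bi 1 (genZ K T n i j) b) =
      contrEven K T (parity i) m (i + n) (fun j b => bi 1 (γ i j) b) j b := by
  refine map_genZ (homotopyEven n m γ) i b
    (fun j => contrEven K T (parity i) m (i + n) (fun j b => bi 1 (γ i j) b) j b) (fun j hj => ?_)
    (fun j hj => homotopyEven_gen n m γ hγ i hj b) j
  unfold contrEven
  push_cast at hγ0
  rcases hj with hj | hj
  · rw [if_pos (by omega)]
    simp only [hγ0 i j (by omega), bi_zero]
  · rw [if_neg (by omega), if_neg (by omega)]
    simp only [hγ0 i (j + 1) (by omega), bi_zero]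

theorem homotopyOdd_genZ {n m : ℕ} (hn : n = 2 * m + 1) (γ : ZMod 4 → ℤ → M)
    (hγ : ∀ i j, bi (e K T i) (γ i j) (1 : A K T) = γ i j)
    (hγ0 : ∀ i (j : ℤ), j < 0 ∨ (n + 1 : ℕ) < j → γ i j = 0) (i : ZMod 4) (j : ℤ) (b : A K T) :
    homotopyOdd n m γ (bi 1 (genZ K T n i j) b) =
      contrOdd K T (parity i) (m + 1) (i + n) (fun j b => bi 1 (γ i j) b) j b := by
  refine map_genZ (homotopyOdd n m γ) i b
    (fun j => contrOdd K T (parity i) (m + 1) (i + n) (fun j b => bi 1 (γ i j) b) j b)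
    (fun j hj => ?_) (fun j hj => homotopyOdd_gen n m γ hγ i hj b) j
  unfold contrOdd
  push_cast at hγ0
  rcases hj with hj | hj
  · rw [if_pos (by omega)]
    simp only [hγ0 i j (by omega), bi_zero]
  · rw [if_neg (by omega), if_neg (by omega)]
    simp only [hγ0 i (j + 1) (by omega), bi_zero]

theorem homotopyOdd_genZ' {n m : ℕ} (hn : n = 2 * m + 1) (γ : ZMod 4 → ℤ → M)
    (hγ : ∀ i j, bi (e K T i) (γ i j) (1 : A K T) = γ i j)
    (hγ0 : ∀ i (j : ℤ), j < 0 ∨ (n + 1 : ℕ) < j → γ i j = 0) (i : ZMod 4) (j : ℤ) (b : A K T) :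
    homotopyOdd n m γ (bi 1 (genZ K T n i j) b) =
      contrOdd K T (parity i) ((m + 1 : ℕ) : ℤ) (i + n) (fun j b => bi 1 (γ i j) b) j b := by
  rw [Nat.cast_succ]
  exact homotopyOdd_genZ hn γ hγ hγ0 i j b

theorem e_bi_genZ (n : ℕ) (i : ZMod 4) (j : ℤ) :
    bi (e K T i) (genZ K T n i j) (1 : A K T) = genZ K T n i j := by
  have hgen (j : ℕ) : bi (e K T i) (gen K T n i j) (1 : A K T) = gen K T n i j := by
    have h : Fixed K T i (i + n) (gen K T n i j) := fixed_gen n i j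
    have h2 := e_bi_gen (K := K) (T := T) n i j (e K T i) 1
    rw [e_mul_self, mul_one] at h2
    exact h2.symm.trans h
  by_cases hj : j < 0 ∨ n < j
  · exact (congrArg (fun z => bi (e K T i) z 1) (genZ_of_notMem i hj)).trans
      ((bi_zero (M := Q K T n) _ _).trans (genZ_of_notMem i hj).symm)
  · obtain ⟨j, rfl⟩ := Int.eq_ofNat_of_zero_le (by omega : 0 ≤ j)
    exact (congrArg (fun z => bi (e K T i) z 1) (genZ_natCast n i j)).trans
      ((hgen j).trans (genZ_natCast n i j).symm)

theorem mem_leftRad_of_genZ {n : ℕ} (ν : Q K T n → Q K T n)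
    (hadd : ∀ z z', ν (z + z') = ν z + ν z')
    (hbi : ∀ (a : A K T) z, ν (bi a z 1) = bi a (ν z) 1)
    (hgen : ∀ i (j : ℕ) c l, j ≤ n →
      ν (bi (1 : A K T) (genZ K T n i j) (letter K T c ^ l)) ∈ leftRad K T (Q K T n) 1)
    (z : Q K T n) : ν z ∈ leftRad K T (Q K T n) 1 :=
  mem_leftRad_of_gen (M := Q K T n) ν hadd hbi (fun i j c l hj =>
    Eq.mp (congrArg (fun z => ν (bi (1 : A K T) z (letter K T c ^ l)) ∈ leftRad K T (Q K T n) 1)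
      (genZ_natCast n i j)) (hgen i j c l hj)) z

theorem d_genZ_of_even {n m : ℕ} (hn : n = 2 * m) (i : ZMod 4) (j : ℤ) :
    d K T n (genZ K T (n + 1) i j) = oddDiff K T m (genZ K T n) i j := by
  subst hn
  exact d_genZ_odd m i j

theorem d_genZ_of_odd {n m : ℕ} (hn : n = 2 * m + 1) (i : ZMod 4) (j : ℤ) :
    d K T n (genZ K T (n + 1) i j) = evenDiff K T (m + 1) (genZ K T n) i j := by
  subst hn
  exact d_genZ_even m i j

section Criterion

variable {M₀ : Type*} [AddCommGroup M₀] [Module (Env K T) M₀]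

/-- Exactness at a bimodule `M` with generators `β i j`, for `0 ≤ j ≤ n`, on which a contraction
modulo the left radical is given. The hypothesis `hM` says that the `β i j` generate `M` as
`Q^n` is generated by the `𝔞^n_{i,j}`. -/
theorem exact_of_contraction_gen {n : ℕ} {β : ZMod 4 → ℤ → M} {M₂ : Type*} [AddCommGroup M₂]
    [Module (Env K T) M₂]
    (hM : ∀ ν : M → M, (∀ z z', ν (z + z') = ν z + ν z') →
      (∀ (a : A K T) z, ν (bi a z 1) = bi a (ν z) 1) →
      (∀ i (j : ℕ) c l, j ≤ n →
        ν (bi (1 : A K T) (β i j) (letter K T c ^ l)) ∈ leftRad K T M 1) →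
      ∀ z, ν z ∈ leftRad K T M 1)
    (d₁ : M₂ →ₗ[Env K T] M)
    (d₀ : M →ₗ[Env K T] M₀) (hd : ∀ z, d₀ (d₁ z) = 0) (h₁ : M →+ M₂)
    (h₀ : M₀ →+ M)
    (hh₁ : ∀ (a : A K T) z, h₁ (bi a z 1) = bi a (h₁ z) 1)
    (hh₀ : ∀ (a : A K T) z, h₀ (bi a z 1) = bi a (h₀ z) 1)
    (hν : ∀ i (j : ℕ) c l, j ≤ n →
      d₁ (h₁ (bi 1 (β i j) (letter K T c ^ l))) +
          h₀ (d₀ (bi 1 (β i j) (letter K T c ^ l))) -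
        bi 1 (β i j) (letter K T c ^ l) ∈ leftRad K T M 1) :
    Function.Exact d₁ d₀ := by
  refine exact_of_contraction d₁ d₀ hd h₁ h₀ hh₁ hh₀
    (hM (fun z => d₁ (h₁ z) + h₀ (d₀ z) - z) ?_ ?_ hν)
  · intro z z'
    simp only [map_add]
    abel
  · intro a z
    rw [hh₁, map_bi d₁, map_bi d₀, hh₀, bi_sub, bi_add]

end Criterion

end Exactness

section ExactnessQ

variable {K : Type u} [Field K] {T : ℕ}

theorem exact_of_odd {n m : ℕ} (hn : n = 2 * m + 1) :
    Function.Exact (d K T (n + 1)) (d K T n) := by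
  have hn' : n + 1 = 2 * (m + 1) := by omega
  have hν := contraction_mem_leftRad_even (M := Q K T (n + 1))
    (M₀ := Q K T n) (M₂ := Q K T (n + 1 + 1)) (d K T (n + 1)) (d K T n)
    (homotopyEven (M := Q K T (n + 1 + 1)) (n + 1) (m + 1) (genZ K T (n + 1 + 1)))
    (homotopyOdd (M := Q K T (n + 1)) n m (genZ K T (n + 1)))
    (homotopyOdd_bi (M := Q K T (n + 1)) n m (genZ K T (n + 1))) (m + 1)
    (genZ K T n) (genZ K T (n + 1)) (genZ K T (n + 1 + 1))
    (d_genZ_of_even hn') (d_genZ_of_odd hn) (fun i => i + (n + 1 : ℕ)) (fun i => i + (n : ℕ))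
    (homotopyEven_genZ (M := Q K T (n + 1 + 1)) hn' (genZ K T (n + 1 + 1))
      (e_bi_genZ (n + 1 + 1)) fun i j => genZ_of_notMem i)
    (homotopyOdd_genZ' (M := Q K T (n + 1)) hn (genZ K T (n + 1))
      (e_bi_genZ (n + 1)) fun i j => genZ_of_notMem i)
  exact exact_of_contraction_gen (M := Q K T (n + 1)) (M₀ := Q K T n) (M₂ := Q K T (n + 1 + 1))
    (β := genZ K T (n + 1)) (n := n + 1) mem_leftRad_of_genZ
    (d K T (n + 1)) (d K T n) (d_d n)
    (homotopyEven (M := Q K T (n + 1 + 1)) (n + 1) (m + 1) (genZ K T (n + 1 + 1)))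
    (homotopyOdd (M := Q K T (n + 1)) n m (genZ K T (n + 1)))
    (homotopyEven_bi (M := Q K T (n + 1 + 1)) (n + 1) (m + 1) (genZ K T (n + 1 + 1)))
    (homotopyOdd_bi (M := Q K T (n + 1)) n m (genZ K T (n + 1)))
    fun i j c l _ => hν i j c l

theorem exact_of_even {n m : ℕ} (hn : n = 2 * m) :
    Function.Exact (d K T (n + 1)) (d K T n) := by
  have hn' : n + 1 = 2 * m + 1 := by omega
  have hν := contraction_mem_leftRad_odd (M := Q K T (n + 1))
    (M₀ := Q K T n) (M₂ := Q K T (n + 1 + 1)) (d K T (n + 1)) (d K T n)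
    (homotopyOdd (M := Q K T (n + 1 + 1)) (n + 1) m (genZ K T (n + 1 + 1)))
    (homotopyEven (M := Q K T (n + 1)) n m (genZ K T (n + 1)))
    (homotopyEven_bi (M := Q K T (n + 1)) n m (genZ K T (n + 1))) m
    (genZ K T n) (genZ K T (n + 1)) (genZ K T (n + 1 + 1))
    (d_genZ_of_odd hn') (d_genZ_of_even hn) (fun i => i + (n + 1 : ℕ)) (fun i => i + (n : ℕ))
    (homotopyOdd_genZ (M := Q K T (n + 1 + 1)) hn' (genZ K T (n + 1 + 1))
      (e_bi_genZ (n + 1 + 1)) fun i j => genZ_of_notMem i)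
    (homotopyEven_genZ (M := Q K T (n + 1)) hn (genZ K T (n + 1))
      (e_bi_genZ (n + 1)) fun i j => genZ_of_notMem i)
  exact exact_of_contraction_gen (M := Q K T (n + 1)) (M₀ := Q K T n) (M₂ := Q K T (n + 1 + 1))
    (β := genZ K T (n + 1)) (n := n + 1) mem_leftRad_of_genZ
    (d K T (n + 1)) (d K T n) (d_d n)
    (homotopyOdd (M := Q K T (n + 1 + 1)) (n + 1) m (genZ K T (n + 1 + 1)))
    (homotopyEven (M := Q K T (n + 1)) n m (genZ K T (n + 1)))
    (homotopyOdd_bi (M := Q K T (n + 1 + 1)) (n + 1) m (genZ K T (n + 1 + 1)))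
    (homotopyEven_bi (M := Q K T (n + 1)) n m (genZ K T (n + 1)))
    fun i j c l _ => hν i j c l

theorem exact_d (n : ℕ) : Function.Exact (d K T (n + 1)) (d K T n) := by
  rcases Nat.even_or_odd' n with ⟨m, hm | hm⟩
  · exact exact_of_even hm
  · exact exact_of_odd hm

end ExactnessQ

/-! ### The augmentation -/

section Augmentation

variable {K : Type u} [Field K] {T : ℕ} {M : Type*} [AddCommGroup M] [Module (Env K T) M]

/-- The additive map `A_T → M` which sends `a` to the sum of the `a q_i`. -/
def sumHom (q : ZMod 4 → M) : A K T →+ M where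
  toFun a := ∑ i, bi a (q i) 1
  map_zero' := Finset.sum_eq_zero fun i _ => zero_bi _ _
  map_add' a b := by simp only [add_bi, Finset.sum_add_distrib]

theorem sumHom_apply (q : ZMod 4 → M) (a : A K T) : sumHom q a = ∑ i, bi a (q i) 1 := rfl

theorem sumHom_bi (q : ZMod 4 → M) (a z : A K T) :
    sumHom q (bi a z 1) = bi a (sumHom q z) 1 := by
  rw [sumHom_apply, sumHom_apply, bi_self, mul_one, bi, Finset.smul_sum]
  refine Finset.sum_congr rfl fun i _ => ?_
  change _ = bi a (bi z (q i) 1) 1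
  rw [bi_bi, mul_one]

theorem sumHom_e (q : ZMod 4 → M) (hq : ∀ i, bi (e K T i) (q i) (1 : A K T) = q i) (i : ZMod 4) :
    sumHom q (e K T i) = q i := by
  rw [sumHom_apply, Finset.sum_eq_single i]
  · exact hq i
  · intro k _ hk
    rw [← hq k, bi_bi, e_mul_e_of_ne K T hk.symm, zero_bi]
  · simp

theorem surjective_of_map_eq_e (f : M →ₗ[Env K T] A K T) (q : ZMod 4 → M)
    (hq : ∀ i, f (q i) = e K T i) : Function.Surjective f := by
  intro a
  refine ⟨sumHom q a, ?_⟩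
  rw [sumHom_apply, map_sum]
  simp only [map_bi, hq, bi_self, mul_one]
  rw [← Finset.mul_sum, sum_e, mul_one]

/-- The composite `∂^0 ∂^1` vanishes since `e_i c = c e_{i+1}` for both letters `c`. -/
theorem oddDiff_zero_e (α : ZMod 4 → ℤ → A K T) (h0 : ∀ i, α i 0 = e K T i)
    (hα : ∀ i j, j ≠ 0 → α i j = 0) (i : ZMod 4) (j : ℤ) : oddDiff K T 0 α i j = 0 := by
  have key (c : Bool) : rightLetter K T c • e K T i = leftLetter K T c • e K T (i + 1) := by
    rw [← bi_one_letter, ← bi_letter_one, bi_self, bi_self, one_mul, mul_one]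
    simpa using e_mul_letter_pow K T c 1 i
  unfold oddDiff oddLow oddHigh
  by_cases hj0 : j = 0
  · subst hj0
    rw [if_pos (by simp), h0, h0, hα i (0 - 1) (by omega), hα (i + 1) (0 - 1) (by omega), key]
    simp only [smul_zero, zero_add, sub_self]
  rw [hα i j hj0, hα (i + 1) j hj0]
  by_cases hj1 : j = 1
  · subst hj1
    rw [if_neg (by omega), sub_self, h0, h0, key]
    simp only [smul_zero, add_zero, sub_zero, sub_self]
  rw [hα i (j - 1) (by omega), hα (i + 1) (j - 1) (by omega)]
  simp only [smul_zero, add_zero, sub_zero, ite_self]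

theorem map_oddDiff_zero_eq_zero (f : M →ₗ[Env K T] A K T) (α : ZMod 4 → ℤ → M)
    (h0 : ∀ i, f (α i 0) = e K T i) (hα : ∀ i j, j ≠ 0 → α i j = 0) (i : ZMod 4) (j : ℤ) :
    f (oddDiff K T 0 α i j) = 0 := by
  rw [map_oddDiff]
  exact oddDiff_zero_e _ h0 (fun i j hj => by rw [hα i j hj, map_zero]) i j

theorem dZero_genZ (i : ZMod 4) : dZero K T (genZ K T 0 i 0) = e K T i :=
  (congrArg (dZero K T) (genZ_natCast 0 i 0)).trans (dZero_gen K T i)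

theorem genZ_zero_of_ne (i : ZMod 4) (j : ℤ) (hj : j ≠ 0) : genZ K T 0 i j = 0 :=
  genZ_of_notMem i (by omega)

theorem d_genZ_zero (i : ZMod 4) (j : ℤ) :
    d K T 0 (genZ K T 1 i j) = oddDiff K T 0 (genZ K T 0) i j :=
  d_genZ_of_even (n := 0) (m := 0) rfl i j

theorem dZero_d (z : Q K T 1) : dZero K T (d K T 0 z) = 0 := by
  have hcomp : dZero K T ∘ₗ d K T 0 = 0 :=
    hom_ext_gen (K := K) (T := T) (M := A K T) 1 (dZero K T ∘ₗ d K T 0) 0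
      fun i j _ => (congrArg (fun z => dZero K T (d K T 0 z)) (genZ_natCast 1 i j).symm).trans
        ((congrArg (dZero K T) (d_genZ_zero i j)).trans
          (map_oddDiff_zero_eq_zero (M := Q K T 0) (dZero K T) (genZ K T 0) dZero_genZ
            genZ_zero_of_ne i j))
  exact LinearMap.congr_fun hcomp z

theorem surjective_dZero : Function.Surjective (dZero K T) :=
  surjective_of_map_eq_e (M := Q K T 0) (dZero K T) (fun i => genZ K T 0 i 0) dZero_genZ

theorem exact_dZero : Function.Exact (d K T 0) (dZero K T) := by
  have hν := contraction_mem_leftRad_zero (M := Q K T 0) (M₂ := Q K T 1) (d K T 0) (dZero K T)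
    (homotopyEven (M := Q K T 1) 0 0 (genZ K T 1))
    (sumHom (M := Q K T 0) fun i => genZ K T 0 i 0)
    (sumHom_bi (M := Q K T 0) fun i => genZ K T 0 i 0) (genZ K T 0) (genZ K T 1)
    genZ_zero_of_ne d_genZ_zero dZero_genZ (fun i => i + (0 : ℕ))
    (homotopyEven_genZ (M := Q K T 1) (n := 0) (m := 0) rfl (genZ K T 1)
      (e_bi_genZ 1) fun i j => genZ_of_notMem i)
    (sumHom_e (M := Q K T 0) (fun i => genZ K T 0 i 0) fun i => e_bi_genZ 0 i 0)
  refine exact_of_contraction_gen (M := Q K T 0) (M₀ := A K T) (M₂ := Q K T 1)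
    (β := genZ K T 0) (n := 0) mem_leftRad_of_genZ (d K T 0) (dZero K T) dZero_d
    (homotopyEven (M := Q K T 1) 0 0 (genZ K T 1))
    (sumHom (M := Q K T 0) fun i => genZ K T 0 i 0)
    (homotopyEven_bi (M := Q K T 1) 0 0 (genZ K T 1))
    (sumHom_bi (M := Q K T 0) fun i => genZ K T 0 i 0) fun i j c l hj => ?_
  obtain rfl := Nat.le_zero.1 hj
  exact hν i c l

end Augmentation

/-! ### Minimality -/

section Minimality

variable {K : Type u} [Field K] {T : ℕ} {M : Type*} [AddCommGroup M] [Module (Env K T) M]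

theorem smul_mem_biRad (r : Env K T) {z : M} (hz : z ∈ biRad K T M) : r • z ∈ biRad K T M := by
  induction r using TensorProduct.induction_on with
  | zero => exact (zero_smul (Env K T) z).symm ▸ zero_mem _
  | tmul a b => exact bi_mem_biRad a b.unop hz
  | add r r' hr hr' => rw [add_smul]; exact add_mem hr hr'

theorem letterRing_smul_mem_biRad (r : LetterRing K T) {z : M} (hz : z ∈ biRad K T M) :
    r • z ∈ biRad K T M :=
  smul_mem_biRad (LetterRing.toEnv K T r) hz

theorem leftLetter_smul_mem_biRad (c : Bool) (z : M) : leftLetter K T c • z ∈ biRad K T M := by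
  rw [← bi_letter_one]
  exact bi_left_letter_mem_biRad c z 1

theorem rightLetter_smul_mem_biRad (c : Bool) (z : M) : rightLetter K T c • z ∈ biRad K T M := by
  rw [← bi_one_letter]
  exact bi_right_letter_mem_biRad c z 1

theorem leftLetter_pow_smul_mem_biRad (c : Bool) (k : ℕ) (z : M) :
    leftLetter K T c ^ (k + 1) • z ∈ biRad K T M := by
  rw [pow_succ, mul_smul]
  exact letterRing_smul_mem_biRad _ (leftLetter_smul_mem_biRad c z)

theorem rightLetter_pow_smul_mem_biRad (c : Bool) (k : ℕ) (z : M) :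
    rightLetter K T c ^ (k + 1) • z ∈ biRad K T M := by
  rw [pow_succ, mul_smul]
  exact letterRing_smul_mem_biRad _ (rightLetter_smul_mem_biRad c z)

theorem oddDiff_mem_biRad (m : ℕ) (α : ZMod 4 → ℤ → M) (i : ZMod 4) (j : ℤ) :
    oddDiff K T m α i j ∈ biRad K T M := by
  unfold oddDiff oddLow oddHigh
  split_ifs
  · exact sub_mem (sub_mem (add_mem (rightLetter_pow_smul_mem_biRad _ _ _)
      (rightLetter_smul_mem_biRad _ _)) (leftLetter_smul_mem_biRad _ _))
      (leftLetter_pow_smul_mem_biRad _ _ _)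
  · exact sub_mem (sub_mem (add_mem (rightLetter_smul_mem_biRad _ _)
      (rightLetter_pow_smul_mem_biRad _ _ _)) (leftLetter_pow_smul_mem_biRad _ _ _))
      (leftLetter_smul_mem_biRad _ _)

theorem evenDiff_mem_biRad (m : ℕ) (α : ZMod 4 → ℤ → M) (i : ZMod 4) (j : ℤ) :
    evenDiff K T m α i j ∈ biRad K T M := by
  have hmid (r : LetterRing K T) (c : Bool) (z z' : M) :
      r • (rightLetter K T c • z + leftLetter K T c • z') ∈ biRad K T M :=
    letterRing_smul_mem_biRad r
      (add_mem (rightLetter_smul_mem_biRad c z) (leftLetter_smul_mem_biRad c z'))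
  unfold evenDiff evenLow evenMid evenHigh
  split_ifs
  · exact add_mem (add_mem (add_mem (rightLetter_pow_smul_mem_biRad _ _ _)
      (rightLetter_smul_mem_biRad _ _)) (leftLetter_smul_mem_biRad _ _))
      (leftLetter_pow_smul_mem_biRad _ _ _)
  · exact add_mem (add_mem (add_mem (hmid _ _ _ _) (hmid _ _ _ _)) (hmid _ _ _ _)) (hmid _ _ _ _)
  · exact add_mem (add_mem (add_mem (rightLetter_smul_mem_biRad _ _)
      (rightLetter_pow_smul_mem_biRad _ _ _)) (leftLetter_pow_smul_mem_biRad _ _ _))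
      (leftLetter_smul_mem_biRad _ _)

theorem map_mem_biRad_of_gen {n : ℕ} (f : Q K T n →ₗ[Env K T] M)
    (hf : ∀ i j, f (gen K T n i j) ∈ biRad K T M) (z : Q K T n) : f z ∈ biRad K T M := by
  induction z using Q_induction with
  | zero => rw [map_zero]; exact zero_mem _
  | add z z' hz hz' => rw [map_add]; exact add_mem hz hz'
  | bi_gen a b i j hj =>
    have h : f (bi a (gen K T n i j) b) = bi a (f (gen K T n i j)) b :=
      map_bi (M := Q K T n) f a b (gen K T n i j)
    rw [h]
    exact bi_mem_biRad a b (hf i j)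

theorem d_mem_biRad (n : ℕ) (z : Q K T (n + 1)) : d K T n z ∈ biRad K T (Q K T n) := by
  refine map_mem_biRad_of_gen (M := Q K T n) (d K T n) (fun i j => ?_) z
  have hgen : d K T n (gen K T (n + 1) i j) = d K T n (genZ K T (n + 1) i j) :=
    congrArg (d K T n) (genZ_natCast (n + 1) i j).symm
  rcases Nat.even_or_odd' n with ⟨m, hm | hm⟩
  · exact (hgen.trans (d_genZ_of_even hm i j)) ▸
      oddDiff_mem_biRad (M := Q K T n) m (genZ K T n) i j
  · exact (hgen.trans (d_genZ_of_odd hm i j)) ▸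
      evenDiff_mem_biRad (M := Q K T n) (m + 1) (genZ K T n) i j

theorem isSuperfluous_ker_of_exact {M₀ M₂ : Type*} [AddCommGroup M₀] [Module (Env K T) M₀]
    [AddCommGroup M₂] [Module (Env K T) M₂] (d₁ : M₂ →ₗ[Env K T] M) (d₀ : M →ₗ[Env K T] M₀)
    (h : Function.Exact d₁ d₀) (hd : ∀ z, d₁ z ∈ biRad K T M) :
    IsSuperfluous (LinearMap.ker d₀) := by
  refine isSuperfluous_of_le_biRad _ fun z hz => ?_
  obtain ⟨z, rfl⟩ := (h z).1 hz
  exact hd z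

/-- An exact sequence of projective bimodules is a minimal resolution if the image of every
differential is contained in the radical. -/
theorem isMinimalProjectiveResolution_of_le_biRad {M : Type*} [AddCommGroup M]
    [Module (Env K T) M] {P : ℕ → Type*} [∀ n, AddCommGroup (P n)] [∀ n, Module (Env K T) (P n)]
    (del : ∀ n, P (n + 1) →ₗ[Env K T] P n) (ε : P 0 →ₗ[Env K T] M)
    (hP : ∀ n, Module.Projective (Env K T) (P n)) (hε : Function.Surjective ε)
    (h0 : Function.Exact (del 0) ε) (h : ∀ n, Function.Exact (del (n + 1)) (del n))
    (hdel : ∀ n z, del n z ∈ biRad K T (P n)) : IsMinimalProjectiveResolution P del ε where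
  projective := hP
  surjective := hε
  exact_zero := h0
  exact_succ := h
  minimal_zero := isSuperfluous_ker_of_exact (del 0) ε h0 (hdel 0)
  minimal_succ n := isSuperfluous_ker_of_exact (del (n + 1)) (del n) (h n) (hdel (n + 1))

end Minimality

end CircBiserial

end

theorem theorem2p1 (K : Type*) [Field K] [IsAlgClosed K] (T : ℕ) :
    CircBiserial.IsMinimalProjectiveResolution (CircBiserial.Q K T)
      (CircBiserial.d K T) (CircBiserial.dZero K T) :=
  CircBiserial.isMinimalProjectiveResolution_of_le_biRad (P := CircBiserial.Q K T)
    (CircBiserial.d K T) (CircBiserial.dZero K T) CircBiserial.projective_Q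
    CircBiserial.surjective_dZero CircBiserial.exact_dZero CircBiserial.exact_d
    CircBiserial.d_mem_biRad
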